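/- Let $A\to M$ be a (real or complex) vector bundle of rank $n$ over a smooth manifold $M$ of dimension $m$, and suppose that $A$ and its dual $A^*$ are each endowed with a Lie algebroid structure, $(A,[\cdot,\cdot],\rho)$ and $(A^*,[\cdot,\cdot]_*,\rho_*)$. (In the complex case functions, vector fields and forms on $M$ are complex-valued.) Write $[\cdot,\cdot]$ and $[\cdot,\cdot]_*$ also for the Schouten brackets on $\Gamma(\wedge A)$ and $\Gamma(\wedge A^*)$, and let $d:\Gamma(\wedge^kA^*)\to\Gamma(\wedge^{k+1}A^*)$ and $d_*:\Gamma(\wedge^kA)\to\Gamma(\wedge^{k+1}A)$ be the differentials of the Lie algebroids $A$ and $A^*$. For $u\in\Gamma(A)$ put $L_u=[u,\cdot]$ on $\Gamma(\wedge A)$ and $L_u=\iota_ud+d\iota_u$ on $\Gamma(\wedge A^*)$; for $\theta\in\Gamma(A^*)$ put $L_\theta=[\theta,\cdot]_*$ on $\Gamma(\wedge A^*)$ and $L_\theta=\iota_\theta d_*+d_*\iota_\theta$ on $\Gamma(\wedge A)$; and $L_{u+\theta}=L_u+L_\theta$. Put $$u\circ\theta=-\iota_\theta d_*u+L_u\theta,\qquad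 \theta\circ u=-\iota_u d\theta+L_\theta u,$$ which are sections of $A\oplus A^*$. Contractions are normalised by $\iota_{a\wedge b}=\iota_b\iota_a$, and $\langle\cdot,\cdot\rangle$ is the determinant pairing of $\wedge^kA$ with $\wedge^kA^*$, so $\langle\omega,U\rangle=\iota_U\omega$ for $U\in\Gamma(\wedge^kA)$, $\omega\in\Gamma(\wedge^kA^*)$. Let $s\in\Gamma(\wedge^mT^*M)$ be a volume form, let $\Omega\in\Gamma(\wedge^nA^*)$ be nowhere vanishing, and let $V\in\Gamma(\wedge^nA)$ be the section with $\langle\Omega,V\rangle=1$. Let $\Omega^\sharp(X)=\iota_X\Omega$ and $V^\sharp(\xi)=\iota_\xi V$, and define $\partial$ on $\Gamma(\wedge A)$ and $\partial_*$ on $\Gamma(\wedge A^*)$ by $$\Omega^\sharp\partial\beta=(-1)^l\,d\,\Omega^\sharp\beta\quad(\beta\in\Gamma(\wedge^lA)),\qquad V^\sharp\partial_*\alpha=(-1)^k\,d_*V^\sharp\alpha\quad(\alpha\in\Gamma(\wedge^kA^*)).$$ Put $\Delta=d_*\partial+\partial d_*$ on $\Gamma(\wedge A)$ and $\Delta_*=d\partial_*+\partial_*d$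 on $\Gamma(\wedge A^*)$. Let $X_0\in\Gamma(A)$ and $\xi_0\in\Gamma(A^*)$ be the modular cocycles, i.e. the sections such that, for all $\theta\in\Gamma(A^*)$ and $u\in\Gamma(A)$, $$(L_\theta\Omega)\otimes s+\Omega\otimes L_{\rho_*(\theta)}s=\langle X_0,\theta\rangle\,\Omega\otimes s,\qquad (L_{\rho(u)}s)\otimes V+s\otimes L_uV=\langle\xi_0,u\rangle\,s\otimes V.$$ Then the following six assertions are equivalent: 1. $d_*[u,v]=[d_*u,v]+(-1)^{k-1}[u,d_*v]$ for all $u\in\Gamma(\wedge^kA)$, $v\in\Gamma(\wedge^lA)$ and all $k,l$; 2. $d[\theta,\eta]_*=[d\theta,\eta]_*+(-1)^{k-1}[\theta,d\eta]_*$ for all $\theta\in\Gamma(\wedge^kA^*)$, $\eta\in\Gamma(\wedge^lA^*)$ and all $k,l$; 3. $\Delta(u\wedge v)=\Delta u\wedge v+u\wedge\Delta v$ for all $u,v\in\Gamma(\wedge A)$; 4. $\Delta_*(\theta\wedge\eta)=\Delta_*\theta\wedge\eta+\theta\wedge\Delta_*\eta$ for all $\theta,\eta\in\Gamma(\wedge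 A^*)$; 5. $\Delta=\frac12(L_{X_0}+L_{\xi_0})$ on $\Gamma(\wedge A)$; 6. $\Delta_*=\frac12(L_{X_0}+L_{\xi_0})$ on $\Gamma(\wedge A^*)$. They imply the following six assertions, which are equivalent to each other: 7. $\Delta_*\langle\theta,u\rangle=\langle\Delta_*\theta,u\rangle+\langle\theta,\Delta u\rangle$ for all $u\in\Gamma(A)$, $\theta\in\Gamma(A^*)$; 8. $\Delta\langle\theta,u\rangle=\langle\Delta_*\theta,u\rangle+\langle\theta,\Delta u\rangle$ for all $u\in\Gamma(A)$, $\theta\in\Gamma(A^*)$; 9. for all $u\in\Gamma(A)$ and $\theta\in\Gamma(A^*)$, the map $L_{u\circ\theta}-[L_u,L_\theta]:\Gamma(A^*)\to\Gamma(A^*)$ is $C^\infty(M)$-linear and its trace is $2\langle d_*u,d\theta\rangle$; 10. for all $\theta\in\Gamma(A^*)$ and $u\in\Gamma(A)$, the map $L_{\theta\circ u}-[L_\theta,L_u]:\Gamma(A)\to\Gamma(A)$ is $C^\infty(M)$-linear and its trace is $2\langle d\theta,d_*u\rangle$; 11. $\Delta f=\frac12(L_{X_0}+L_{\xi_0})f$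 and $\Delta u=\frac12(L_{X_0}+L_{\xi_0})u$ for all $f\in C^\infty(M)$ and $u\in\Gamma(A)$; 12. $\Delta_*f=\frac12(L_{X_0}+L_{\xi_0})f$ and $\Delta_*\theta=\frac12(L_{X_0}+L_{\xi_0})\theta$ for all $f\in C^\infty(M)$ and $\theta\in\Gamma(A^*)$. -/

import Mathlib

open scoped TensorProduct

noncomputable section

namespace LieAlgebroidPair

section ExteriorDerivations

variable {R L : Type*} [CommRing R] [AddCommGroup L] [Module R L]

/-- The parity automorphism of the exterior algebra: `(-1)^k` on elements of degree `k`. -/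
abbrev parity : ExteriorAlgebra R L →ₐ[R] ExteriorAlgebra R L := CliffordAlgebra.involute

theorem parity_ι (x : L) : parity (ExteriorAlgebra.ι R x) = -ExteriorAlgebra.ι R x :=
  CliffordAlgebra.involute_ι x

theorem ι_mul_eq (x : L) (w : ExteriorAlgebra R L) :
    ExteriorAlgebra.ι R x * w = parity w * ExteriorAlgebra.ι R x := by
  induction w using ExteriorAlgebra.induction with
  | algebraMap r => simpa using (Algebra.commutes r (ExteriorAlgebra.ι R x)).symm
  | ι y =>
    rw [parity_ι, neg_mul]
    exact eq_neg_of_add_eq_zero_left (ExteriorAlgebra.ι_add_mul_swap x y)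
  | mul a b ha hb => rw [map_mul, ← mul_assoc, ha, mul_assoc, hb, mul_assoc]
  | add a b ha hb => rw [mul_add, ha, hb, map_add, add_mul]

theorem even_mul_comm {w : ExteriorAlgebra R L} (hw : parity w = w) (a : ExteriorAlgebra R L) :
    a * w = w * a := by
  induction a using ExteriorAlgebra.induction with
  | algebraMap r => exact Algebra.commutes r w
  | ι y => rw [ι_mul_eq, hw]
  | mul a b ha hb => rw [mul_assoc, hb, ← mul_assoc, ha, mul_assoc]
  | add a b ha hb => rw [mul_add, ← ha, ← hb, add_mul]

theorem odd_mul_comm {w : ExteriorAlgebra R L} (hw : parity w = -w) (a : ExteriorAlgebra R L) :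
    parity a * w = w * a := by
  induction a using ExteriorAlgebra.induction with
  | algebraMap r => simpa using Algebra.commutes r w
  | ι y => rw [parity_ι, neg_mul, ι_mul_eq, hw]; simp
  | mul a b ha hb => rw [map_mul, mul_assoc, hb, ← mul_assoc, ha, mul_assoc]
  | add a b ha hb => rw [mul_add, ← ha, ← hb, map_add, add_mul]

/-- Pairs `(a, b)` with the product `(a, b) (a', b') = (a a', τ a b' + b a')`. -/
@[ext] structure Tw (S : Type*) [Ring S] (τ : S →+* S) where
  fst : S
  snd : S

namespace Tw
variable {S : Type*} [Ring S] {τ : S →+* S}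

instance : Zero (Tw S τ) := ⟨⟨0, 0⟩⟩
instance : One (Tw S τ) := ⟨⟨1, 0⟩⟩
instance : Add (Tw S τ) := ⟨fun a b => ⟨a.fst + b.fst, a.snd + b.snd⟩⟩
instance : Neg (Tw S τ) := ⟨fun a => ⟨-a.fst, -a.snd⟩⟩
instance : Mul (Tw S τ) := ⟨fun a b => ⟨a.fst * b.fst, τ a.fst * b.snd + a.snd * b.fst⟩⟩
@[simp] theorem zero_fst : (0 : Tw S τ).fst = 0 := rfl
@[simp] theorem zero_snd : (0 : Tw S τ).snd = 0 := rfl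
@[simp] theorem one_fst : (1 : Tw S τ).fst = 1 := rfl
@[simp] theorem one_snd : (1 : Tw S τ).snd = 0 := rfl
@[simp] theorem add_fst (a b : Tw S τ) : (a + b).fst = a.fst + b.fst := rfl
@[simp] theorem add_snd (a b : Tw S τ) : (a + b).snd = a.snd + b.snd := rfl
@[simp] theorem neg_fst (a : Tw S τ) : (-a).fst = -a.fst := rfl
@[simp] theorem neg_snd (a : Tw S τ) : (-a).snd = -a.snd := rfl
@[simp] theorem mul_fst (a b : Tw S τ) : (a * b).fst = a.fst * b.fst := rfl
@[simp] theorem mul_snd (a b : Tw S τ) :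
    (a * b).snd = τ a.fst * b.snd + a.snd * b.fst := rfl

instance : Ring (Tw S τ) where
  add_assoc a b c := by ext <;> simp [add_assoc]
  zero_add a := by ext <;> simp
  add_zero a := by ext <;> simp
  add_comm a b := by ext <;> simp [add_comm]
  nsmul := nsmulRec
  zsmul := zsmulRec
  neg_add_cancel a := by ext <;> simp
  mul_assoc a b c := by ext <;> simp [mul_assoc, mul_add, add_mul, add_assoc]
  one_mul a := by ext <;> simp
  mul_one a := by ext <;> simp
  zero_mul a := by ext <;> simp
  mul_zero a := by ext <;> simp
  left_distrib a b c := by ext <;> simp [mul_add, add_add_add_comm]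
  right_distrib a b c := by ext <;> simp [add_mul, add_add_add_comm]
end Tw

/-- Twisted derivations of the exterior algebra exist with prescribed values on generators. -/
theorem exists_twisted_derivation (τ : ExteriorAlgebra R L →ₐ[R] ExteriorAlgebra R L)
    (δ₀ : R →+ ExteriorAlgebra R L) (δ₁ : L →+ ExteriorAlgebra R L)
    (h₀ : ∀ f g, δ₀ (f * g) = f • δ₀ g + g • δ₀ f)
    (h₁ : ∀ (f : R) x, δ₁ (f • x) = f • δ₁ x + δ₀ f * ExteriorAlgebra.ι R x)
    (hc : ∀ f a, τ a * δ₀ f = δ₀ f * a)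
    (hs : ∀ x, τ (ExteriorAlgebra.ι R x) * δ₁ x + δ₁ x * ExteriorAlgebra.ι R x = 0) :
    ∃ D : ExteriorAlgebra R L →+ ExteriorAlgebra R L,
      (∀ f, D (algebraMap R _ f) = δ₀ f) ∧ (∀ x, D (ExteriorAlgebra.ι R x) = δ₁ x) ∧
      ∀ a b, D (a * b) = τ a * D b + D a * b := by
  let T := Tw (ExteriorAlgebra R L) (τ : ExteriorAlgebra R L →+* ExteriorAlgebra R L)
  have h1 : δ₀ 1 = 0 := by simpa using h₀ 1 1
  let φ : R →+* T :=
    { toFun := fun f => ⟨algebraMap R _ f, δ₀ f⟩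
      map_zero' := Tw.ext (map_zero _) (map_zero _)
      map_one' := Tw.ext (map_one _) h1
      map_add' := fun f g => Tw.ext (map_add _ f g) (map_add _ f g)
      map_mul' := fun f g => by
        refine Tw.ext (map_mul _ f g) ?_
        change δ₀ (f * g) = τ (algebraMap R _ f) * δ₀ g + δ₀ f * algebraMap R _ g
        rw [h₀, Algebra.smul_def, Algebra.smul_def, AlgHom.commutes, Algebra.commutes g] }
  let _ : Algebra R T := φ.toAlgebra' fun f a => by
    ext
    · exact Algebra.commutes f a.fst
    · change τ (algebraMap R _ f) * a.snd + δ₀ f * a.fst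
        = τ a.fst * δ₀ f + a.snd * algebraMap R _ f
      rw [hc, AlgHom.commutes, Algebra.commutes, add_comm]
  let ψ : L →ₗ[R] T :=
    { toFun := fun x => ⟨ExteriorAlgebra.ι R x, δ₁ x⟩
      map_add' := fun x y => Tw.ext (map_add _ x y) (map_add _ x y)
      map_smul' := fun f x => by
        rw [RingHom.id_apply, Algebra.smul_def]
        change _ = φ f * _
        ext
        · change ExteriorAlgebra.ι R (f • x) = algebraMap R _ f * ExteriorAlgebra.ι R x
          rw [map_smul, Algebra.smul_def]
        · change δ₁ (f • x) = τ (algebraMap R _ f) * δ₁ x + δ₀ f * ExteriorAlgebra.ι R x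
          rw [AlgHom.commutes, h₁, Algebra.smul_def] }
  let Φ : ExteriorAlgebra R L →ₐ[R] T := ExteriorAlgebra.lift R ⟨ψ, fun x => by
    ext
    · exact ExteriorAlgebra.ι_sq_zero x
    · exact hs x⟩
  have hΦι : ∀ x, Φ (ExteriorAlgebra.ι R x) = ψ x := fun x => ExteriorAlgebra.lift_ι_apply ..
  have hΦa : ∀ f, Φ (algebraMap R _ f) = φ f := fun f => Φ.commutes f
  have hfst : ∀ a, (Φ a).fst = a := fun a => by
    induction a using ExteriorAlgebra.induction with
    | algebraMap r => rw [hΦa]; rfl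
    | ι x => rw [hΦι]; rfl
    | mul a b ha hb => rw [map_mul, Tw.mul_fst, ha, hb]
    | add a b ha hb => rw [map_add, Tw.add_fst, ha, hb]
  refine ⟨{ toFun := fun a => (Φ a).snd, map_zero' := by rw [map_zero]; rfl,
            map_add' := fun a b => by rw [map_add]; rfl }, fun f => ?_, fun x => ?_, fun a b => ?_⟩
  · change (Φ _).snd = _; rw [hΦa]; rfl
  · change (Φ _).snd = _; rw [hΦι]; rfl
  · change (Φ _).snd = τ a * (Φ b).snd + (Φ a).snd * b
    rw [map_mul, Tw.mul_snd, hfst, hfst]; rfl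

theorem twisted_derivation_ext (τ : ExteriorAlgebra R L →ₐ[R] ExteriorAlgebra R L)
    {D D' : ExteriorAlgebra R L →+ ExteriorAlgebra R L}
    (h₀ : ∀ f, D (algebraMap R _ f) = D' (algebraMap R _ f))
    (h₁ : ∀ x, D (ExteriorAlgebra.ι R x) = D' (ExteriorAlgebra.ι R x))
    (h : ∀ a b, D (a * b) = τ a * D b + D a * b)
    (h' : ∀ a b, D' (a * b) = τ a * D' b + D' a * b) : D = D' := by
  ext a
  induction a using ExteriorAlgebra.induction with
  | algebraMap r => exact h₀ r
  | ι x => exact h₁ x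
  | mul a b ha hb => rw [h, h', ha, hb]
  | add a b ha hb => rw [map_add, map_add, ha, hb]

end ExteriorDerivations

section Structures

variable (𝕜 R L : Type*) [Field 𝕜] [CommRing R] [Algebra 𝕜 R] [AddCommGroup L] [Module R L]

/-- A Lie algebroid structure, expressed on the `R`-module `L` of sections, where `R` is the algebra
of smooth functions and `Derivation 𝕜 R R` the module of vector fields. A bundle map into the
tangent bundle is the same as an `R`-linear map on sections. The bracket is automatically
`𝕜`-bilinear, by the Leibniz rule for constant functions. -/
structure LieAlgebroid where
  bracket : L →+ L →+ L
  anchor : L →ₗ[R] Derivation 𝕜 R R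
  bracket_self : ∀ x, bracket x x = 0
  jacobi : ∀ x y z, bracket x (bracket y z) = bracket (bracket x y) z + bracket y (bracket x z)
  anchor_bracket : ∀ x y, anchor (bracket x y) = ⁅anchor x, anchor y⁆
  leibniz : ∀ x (f : R) y, bracket x (f • y) = anchor x f • y + f • bracket x y

end Structures

section Schouten

variable {𝕜 R L : Type*} [Field 𝕜] [CommRing R] [Algebra 𝕜 R] [AddCommGroup L] [Module R L]
variable (𝔞 : LieAlgebroid 𝕜 R L)

theorem LieAlgebroid.bracket_skew (x y : L) : 𝔞.bracket x y = -𝔞.bracket y x := by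
  have h := 𝔞.bracket_self (x + y)
  simp only [map_add, AddMonoidHom.add_apply, 𝔞.bracket_self, zero_add, add_zero] at h
  exact eq_neg_of_add_eq_zero_right h

/-- `Br` is the Schouten bracket: the graded skew-symmetric biderivation of the exterior algebra
(with the degree shifted by one) that extends the bracket and the anchor. -/
structure IsSchouten
    (Br : ExteriorAlgebra R L →+ ExteriorAlgebra R L →+ ExteriorAlgebra R L) : Prop where
  fun_fun : ∀ f g, Br (algebraMap R _ f) (algebraMap R _ g) = 0
  section_fun : ∀ x f, Br (ExteriorAlgebra.ι R x) (algebraMap R _ f) =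
    algebraMap R _ (𝔞.anchor x f)
  section_section : ∀ x y, Br (ExteriorAlgebra.ι R x) (ExteriorAlgebra.ι R y) =
    ExteriorAlgebra.ι R (𝔞.bracket x y)
  skew : ∀ (k l : ℕ), ∀ u ∈ ⋀[R]^k L, ∀ v ∈ ⋀[R]^l L,
    Br u v = -((-1 : R) ^ ((k + 1) * (l + 1)) • Br v u)
  leibniz : ∀ (k l : ℕ), ∀ u ∈ ⋀[R]^k L, ∀ v ∈ ⋀[R]^l L, ∀ w,
    Br u (v * w) = Br u v * w + (-1 : R) ^ ((k + 1) * l) • (v * Br u w)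

/-- The differential of a function, as a linear form on sections. -/
def anchorDual : R →+ Module.Dual R L where
  toFun f :=
    { toFun := fun x => 𝔞.anchor x f
      map_add' := fun x y => by simp
      map_smul' := fun r x => by simp }
  map_zero' := by ext x; simp
  map_add' f g := by ext x; simp

theorem anchorDual_apply (f : R) (x : L) : anchorDual 𝔞 f x = 𝔞.anchor x f := rfl

theorem anchorDual_mul (f g : R) :
    anchorDual 𝔞 (f * g) = f • anchorDual 𝔞 g + g • anchorDual 𝔞 f := by
  ext x; simp [anchorDual_apply]

/-- Contraction of the exterior algebra of `L` with a linear form on `L`. -/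
abbrev contract (φ : Module.Dual R L) : ExteriorAlgebra R L →ₗ[R] ExteriorAlgebra R L :=
  CliffordAlgebra.contractLeft φ

theorem contract_ι (φ : Module.Dual R L) (x : L) :
    contract φ (ExteriorAlgebra.ι R x) = algebraMap R _ (φ x) :=
  CliffordAlgebra.contractLeft_ι _ φ x

theorem contract_algebraMap (φ : Module.Dual R L) (f : R) :
    contract φ (algebraMap R (ExteriorAlgebra R L) f) = 0 :=
  CliffordAlgebra.contractLeft_algebraMap _ φ f

theorem contract_ι_mul (φ : Module.Dual R L) (x : L) (b : ExteriorAlgebra R L) :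
    contract φ (ExteriorAlgebra.ι R x * b) = φ x • b - ExteriorAlgebra.ι R x * contract φ b :=
  CliffordAlgebra.contractLeft_ι_mul φ x b

theorem contract_mul (φ : Module.Dual R L) (a b : ExteriorAlgebra R L) :
    contract φ (a * b) = parity a * contract φ b + contract φ a * b := by
  induction a using ExteriorAlgebra.induction generalizing b with
  | algebraMap r =>
    rw [contract_algebraMap, AlgHom.commutes, zero_mul, add_zero, ← Algebra.smul_def, map_smul,
      Algebra.smul_def]
  | ι x => rw [contract_ι_mul, parity_ι, contract_ι, Algebra.smul_def]; noncomm_ring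
  | mul a a' ha ha' =>
    rw [mul_assoc, ha, ha', ha, map_mul]; noncomm_ring
  | add a a' ha ha' => rw [add_mul, map_add, ha, ha', map_add, map_add]; noncomm_ring

theorem parity_contract (φ : Module.Dual R L) (a : ExteriorAlgebra R L) :
    parity (contract φ a) = -contract φ (parity a) := by
  induction a using ExteriorAlgebra.induction with
  | algebraMap r => simp
  | ι x => rw [contract_ι, parity_ι, map_neg, contract_ι, AlgHom.commutes, neg_neg]
  | mul a b ha hb =>
    rw [contract_mul, map_add, map_mul, map_mul, ha, hb, map_mul, contract_mul,
      CliffordAlgebra.involute_involute]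
    noncomm_ring
  | add a b ha hb => rw [map_add, map_add, ha, hb, map_add, map_add]; abel

theorem parity_of_mem {k : ℕ} {u : ExteriorAlgebra R L} (hu : u ∈ ⋀[R]^k L) :
    parity u = (-1 : R) ^ k • u := by
  induction hu using Submodule.pow_induction_on_left' with
  | algebraMap r => simp
  | add x y i hx hy ihx ihy => rw [map_add, ihx, ihy, smul_add]
  | mem_mul m hm i x hx ih =>
    obtain ⟨y, rfl⟩ := hm
    rw [map_mul, ih, parity_ι, pow_succ]
    simp

/-- The Lie derivative of multisections along a section exists. -/
theorem exists_lie (x : L) : ∃ D : ExteriorAlgebra R L →+ ExteriorAlgebra R L,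
    (∀ f, D (algebraMap R _ f) = algebraMap R _ (𝔞.anchor x f)) ∧
    (∀ y, D (ExteriorAlgebra.ι R y) = ExteriorAlgebra.ι R (𝔞.bracket x y)) ∧
    ∀ a b, D (a * b) = a * D b + D a * b := by
  refine exists_twisted_derivation (AlgHom.id R _)
    ((algebraMap R (ExteriorAlgebra R L)).toAddMonoidHom.comp
      ((𝔞.anchor x : R →ₗ[𝕜] R).toAddMonoidHom))
    ((ExteriorAlgebra.ι R).toAddMonoidHom.comp (𝔞.bracket x)) ?_ ?_ ?_ ?_
  · intro f g
    change algebraMap R _ (𝔞.anchor x (f * g)) =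
      f • algebraMap R _ (𝔞.anchor x g) + g • algebraMap R _ (𝔞.anchor x f)
    simp [Algebra.smul_def]
  · intro f y
    change ExteriorAlgebra.ι R (𝔞.bracket x (f • y)) = f • ExteriorAlgebra.ι R (𝔞.bracket x y) +
      algebraMap R _ (𝔞.anchor x f) * ExteriorAlgebra.ι R y
    rw [𝔞.leibniz, map_add, map_smul, map_smul, ← Algebra.smul_def, add_comm]
  · intro f a
    exact (Algebra.commutes (R := R) (𝔞.anchor x f) a).symm
  · intro y
    exact ExteriorAlgebra.ι_add_mul_swap y (𝔞.bracket x y)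

theorem half_smul_add [CharZero 𝕜] (u : ExteriorAlgebra R L) :
    algebraMap 𝕜 R (1 / 2) • u + algebraMap 𝕜 R (1 / 2) • u = u := by
  rw [← add_smul, ← map_add, show (1 / 2 + 1 / 2 : 𝕜) = 1 by norm_num, map_one, one_smul]

theorem exists_isSchouten [CharZero 𝕜] : ∃ Br, IsSchouten 𝔞 Br := by
  choose Lv Lv0 Lv1 LvD using exists_lie 𝔞
  have Ladd : ∀ x y, Lv (x + y) = Lv x + Lv y := fun x y => by
    refine twisted_derivation_ext (AlgHom.id R _) (fun f => ?_) (fun z => ?_) (LvD _) ?_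
    · simp [Lv0]
    · simp [Lv1]
    · intro a b
      simp only [AddMonoidHom.add_apply, LvD, AlgHom.id_apply]
      noncomm_ring
  have Lsmul : ∀ (f : R) x a, Lv (f • x) a =
      f • Lv x a - ExteriorAlgebra.ι R x * contract (anchorDual 𝔞 f) a := fun f x a => by
    let D' : ExteriorAlgebra R L →+ ExteriorAlgebra R L := AddMonoidHom.mk'
      (fun a => f • Lv x a - ExteriorAlgebra.ι R x * contract (anchorDual 𝔞 f) a)
      (fun a b => by rw [map_add, map_add, smul_add, mul_add]; abel)
    refine DFunLike.congr_fun (show Lv (f • x) = D' from ?_) a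
    refine twisted_derivation_ext (AlgHom.id R _) (fun g => ?_) (fun z => ?_) (LvD _) ?_
    · change _ = f • Lv x _ - ExteriorAlgebra.ι R x * contract (anchorDual 𝔞 f) _
      rw [Lv0, Lv0, contract_algebraMap, Algebra.smul_def, ← map_mul]
      simp
    · change _ = f • Lv x _ - ExteriorAlgebra.ι R x * contract (anchorDual 𝔞 f) _
      rw [Lv1, Lv1, contract_ι, 𝔞.bracket_skew, 𝔞.leibniz, ← Algebra.commutes, ← Algebra.smul_def,
        anchorDual_apply, 𝔞.bracket_skew x z]
      simp only [map_neg, map_add, map_smul, smul_neg]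
      abel
    · intro a b
      change f • Lv x _ - ExteriorAlgebra.ι R x * contract (anchorDual 𝔞 f) _ =
        a * (f • Lv x b - ExteriorAlgebra.ι R x * contract (anchorDual 𝔞 f) b) +
        (f • Lv x a - ExteriorAlgebra.ι R x * contract (anchorDual 𝔞 f) a) * b
      rw [contract_mul, LvD, mul_add, ← mul_assoc _ (parity a), ι_mul_eq x (parity a),
        CliffordAlgebra.involute_involute, smul_add, mul_sub, sub_mul, mul_smul_comm,
        smul_mul_assoc]
      noncomm_ring
  have Lpar : ∀ x a, parity (Lv x a) = Lv x (parity a) := fun x a => by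
    induction a using ExteriorAlgebra.induction with
    | algebraMap r => rw [Lv0, AlgHom.commutes, AlgHom.commutes, Lv0]
    | ι y => rw [Lv1, parity_ι, parity_ι, map_neg, Lv1]
    | mul a b ha hb => rw [LvD, map_add, map_mul, map_mul, ha, hb, map_mul, LvD]
    | add a b ha hb => rw [map_add, map_add, ha, hb, map_add, map_add]
  -- the inner derivation of a multisection of definite parity
  have key : ∀ (τ : ExteriorAlgebra R L →ₐ[R] ExteriorAlgebra R L) (u : ExteriorAlgebra R L),
      ((τ = AlgHom.id R _ ∧ parity u = -u) ∨ (τ = parity ∧ parity u = u)) →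
      ∃ D : ExteriorAlgebra R L →+ ExteriorAlgebra R L,
        (∀ f, D (algebraMap R _ f) = -contract (anchorDual 𝔞 f) (parity u)) ∧
        (∀ y, D (ExteriorAlgebra.ι R y) = -Lv y u) ∧
        ∀ a b, D (a * b) = τ a * D b + D a * b := by
    intro τ u hτ
    refine exists_twisted_derivation τ
      (AddMonoidHom.mk' (fun f => -contract (anchorDual 𝔞 f) (parity u)) fun f g => by
        rw [map_add (anchorDual 𝔞), contract, map_add, LinearMap.add_apply, neg_add])
      (AddMonoidHom.mk' (fun y => -Lv y u) fun x y => by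
        rw [Ladd, AddMonoidHom.add_apply, neg_add]) ?_ ?_ ?_ ?_
    · intro f g
      simp only [AddMonoidHom.mk'_apply, anchorDual_mul, map_add, map_smul, LinearMap.add_apply,
        LinearMap.smul_apply, smul_neg]
      abel
    · intro f y
      simp only [AddMonoidHom.mk'_apply]
      rw [Lsmul, ι_mul_eq, parity_contract, smul_neg]
      abel
    · intro f a
      simp only [AddMonoidHom.mk'_apply]
      rcases hτ with ⟨rfl, hu⟩ | ⟨rfl, hu⟩
      · refine even_mul_comm ?_ a
        rw [map_neg, parity_contract, hu, map_neg parity, hu, neg_neg, map_neg]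
      · refine odd_mul_comm ?_ a
        rw [map_neg, parity_contract, hu, hu]
    · intro y
      simp only [AddMonoidHom.mk'_apply]
      rcases hτ with ⟨rfl, hu⟩ | ⟨rfl, hu⟩
      · rw [AlgHom.id_apply, ι_mul_eq, map_neg, Lpar, hu, map_neg]
        noncomm_ring
      · rw [parity_ι, neg_mul, ι_mul_eq, map_neg, Lpar, hu]
        noncomm_ring
  have keyO := fun (u : ExteriorAlgebra R L) (hu : parity u = -u) => key _ u (Or.inl ⟨rfl, hu⟩)
  have keyE := fun (u : ExteriorAlgebra R L) (hu : parity u = u) => key _ u (Or.inr ⟨rfl, hu⟩)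
  choose adO adO0 adO1 adOD using keyO
  choose adE adE0 adE1 adED using keyE
  let h : R := algebraMap 𝕜 R (1 / 2)
  have hO : ∀ u : ExteriorAlgebra R L, parity (h • u - h • parity u) = -(h • u - h • parity u) :=
    fun u => by rw [map_sub, map_smul, map_smul, CliffordAlgebra.involute_involute]; abel
  have hE : ∀ u : ExteriorAlgebra R L, parity (h • u + h • parity u) = h • u + h • parity u :=
    fun u => by rw [map_add, map_smul, map_smul, CliffordAlgebra.involute_involute]; abel
  have hhalf : ∀ u : ExteriorAlgebra R L, h • u + h • u = u := half_smul_add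
  let Br : ExteriorAlgebra R L →+ ExteriorAlgebra R L →+ ExteriorAlgebra R L :=
    AddMonoidHom.mk' (fun u => adO _ (hO u) + adE _ (hE u)) fun u v => by
      have e1 : adO _ (hO (u + v)) = adO _ (hO u) + adO _ (hO v) := by
        refine twisted_derivation_ext (AlgHom.id R _) (fun f => ?_) (fun z => ?_) (adOD _ _) ?_
        · simp only [AddMonoidHom.add_apply, adO0, ← neg_add, ← map_add]
          congr 3
          simp only [smul_add, map_add]; abel
        · simp only [AddMonoidHom.add_apply, adO1, ← neg_add, ← map_add]
          congr 2
          simp only [smul_add, map_add]; abel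
        · intro a b
          simp only [AddMonoidHom.add_apply, adOD]
          noncomm_ring
      have e2 : adE _ (hE (u + v)) = adE _ (hE u) + adE _ (hE v) := by
        refine twisted_derivation_ext parity (fun f => ?_) (fun z => ?_) (adED _ _) ?_
        · simp only [AddMonoidHom.add_apply, adE0, ← neg_add, ← map_add]
          congr 3
          simp only [smul_add, map_add]; abel
        · simp only [AddMonoidHom.add_apply, adE1, ← neg_add, ← map_add]
          congr 2
          simp only [smul_add, map_add]; abel
        · intro a b
          simp only [AddMonoidHom.add_apply, adED]
          noncomm_ring
      rw [e1, e2]; abel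
  have hBr : ∀ u, Br u = adO _ (hO u) + adE _ (hE u) := fun u => rfl
  have Br0 : ∀ u f, Br u (algebraMap R _ f) = -contract (anchorDual 𝔞 f) (parity u) :=
    fun u f => by
      rw [hBr, AddMonoidHom.add_apply, adO0, adE0, ← neg_add, ← map_add, ← map_add,
        show h • u - h • parity u + (h • u + h • parity u) = h • u + h • u by abel, hhalf]
  have Br1 : ∀ u y, Br u (ExteriorAlgebra.ι R y) = -Lv y u := fun u y => by
    rw [hBr, AddMonoidHom.add_apply, adO1, adE1, ← neg_add, ← map_add,
        show h • u - h • parity u + (h • u + h • parity u) = h • u + h • u by abel, hhalf]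
  have BrO : ∀ u, parity u = -u → ∀ a b, Br u (a * b) = a * Br u b + Br u a * b := by
    intro u hu a b
    have hz : adE _ (hE u) = 0 := by
      have e : h • u + h • parity u = 0 := by rw [hu, smul_neg, add_neg_cancel]
      refine twisted_derivation_ext parity (fun f => ?_) (fun z => ?_) (adED _ _) ?_
      · rw [adE0, e]; simp
      · rw [adE1, e]; simp
      · intro a b; simp
    rw [hBr, hz, add_zero, adOD]; rfl
  have BrE : ∀ u, parity u = u → ∀ a b, Br u (a * b) = parity a * Br u b + Br u a * b := by
    intro u hu a b
    have hz : adO _ (hO u) = 0 := by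
      have e : h • u - h • parity u = 0 := by rw [hu, sub_self]
      refine twisted_derivation_ext (AlgHom.id R _) (fun f => ?_) (fun z => ?_) (adOD _ _) ?_
      · rw [adO0, e]; simp
      · rw [adO1, e]; simp
      · intro a b; simp
    rw [hBr, hz, zero_add, adED]
  have hparE : ∀ {k : ℕ} {u : ExteriorAlgebra R L}, Even k → u ∈ ⋀[R]^k L → parity u = u :=
    fun hk hu => by rw [parity_of_mem hu, hk.neg_one_pow, one_smul]
  have hparO : ∀ {k : ℕ} {u : ExteriorAlgebra R L}, Odd k → u ∈ ⋀[R]^k L → parity u = -u :=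
    fun hk hu => by rw [parity_of_mem hu, hk.neg_one_pow, neg_smul, one_smul]
  have Brι : ∀ x, Br (ExteriorAlgebra.ι R x) = Lv x := fun x => by
    refine twisted_derivation_ext (AlgHom.id R _) (fun f => ?_) (fun z => ?_)
      (BrO _ (parity_ι x)) (LvD x)
    · rw [Br0, parity_ι, map_neg, neg_neg, contract_ι, Lv0, anchorDual_apply]
    · rw [Br1, Lv1, Lv1, 𝔞.bracket_skew x z, map_neg]
  have Bralg : ∀ r a, Br (algebraMap R _ r) a = -contract (anchorDual 𝔞 r) a := fun r a => by
    refine DFunLike.congr_fun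
      (show Br (algebraMap R _ r) = -(contract (anchorDual 𝔞 r)).toAddMonoidHom from ?_) a
    refine twisted_derivation_ext parity (fun f => ?_) (fun z => ?_)
      (BrE _ (AlgHom.commutes _ r)) ?_
    · rw [Br0, AlgHom.commutes, contract_algebraMap]
      simp
    · rw [Br1, Lv0]
      simp [anchorDual_apply]
    · intro a b
      simp only [AddMonoidHom.neg_apply, LinearMap.toAddMonoidHom_coe, contract_mul]
      noncomm_ring
  have BrLE : ∀ x u, parity u = u → ∀ v, Br (ExteriorAlgebra.ι R x * u) v =
      ExteriorAlgebra.ι R x * Br u v + Lv x v * u := by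
    intro x u hu v
    let D' : ExteriorAlgebra R L →+ ExteriorAlgebra R L := AddMonoidHom.mk'
      (fun v => ExteriorAlgebra.ι R x * Br u v + Lv x v * u)
      (fun a b => by rw [map_add, map_add, mul_add, add_mul]; abel)
    have hp : parity (ExteriorAlgebra.ι R x * u) = -(ExteriorAlgebra.ι R x * u) := by
      rw [map_mul, parity_ι, hu, neg_mul]
    refine DFunLike.congr_fun (show Br (ExteriorAlgebra.ι R x * u) = D' from ?_) v
    refine twisted_derivation_ext (AlgHom.id R _) (fun f => ?_) (fun z => ?_) (BrO _ hp) ?_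
    · change _ = ExteriorAlgebra.ι R x * Br u _ + Lv x _ * u
      rw [Br0, hp, map_neg, neg_neg, contract_ι_mul, Br0, hu, Lv0, Algebra.smul_def,
        anchorDual_apply]
      noncomm_ring
    · change _ = ExteriorAlgebra.ι R x * Br u _ + Lv x _ * u
      rw [Br1, Br1, LvD, Lv1, Lv1, 𝔞.bracket_skew x z, map_neg]
      noncomm_ring
    · intro a b
      change ExteriorAlgebra.ι R x * Br u (a * b) + Lv x (a * b) * u =
        a * (ExteriorAlgebra.ι R x * Br u b + Lv x b * u) +
        (ExteriorAlgebra.ι R x * Br u a + Lv x a * u) * b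
      rw [BrE u hu, LvD, mul_add, ← mul_assoc _ (parity a), ι_mul_eq x (parity a),
        CliffordAlgebra.involute_involute, add_mul, mul_assoc _ b u, even_mul_comm hu b]
      noncomm_ring
  have BrLO : ∀ x u, parity u = -u → ∀ v, Br (ExteriorAlgebra.ι R x * u) v =
      ExteriorAlgebra.ι R x * Br u v - Lv x (parity v) * u := by
    intro x u hu v
    let D' : ExteriorAlgebra R L →+ ExteriorAlgebra R L := AddMonoidHom.mk'
      (fun v => ExteriorAlgebra.ι R x * Br u v - Lv x (parity v) * u)
      (fun a b => by rw [map_add, map_add, map_add, mul_add, add_mul]; abel)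
    have hp : parity (ExteriorAlgebra.ι R x * u) = ExteriorAlgebra.ι R x * u := by
      rw [map_mul, parity_ι, hu, neg_mul_neg]
    refine DFunLike.congr_fun (show Br (ExteriorAlgebra.ι R x * u) = D' from ?_) v
    refine twisted_derivation_ext parity (fun f => ?_) (fun z => ?_) (BrE _ hp) ?_
    · change _ = ExteriorAlgebra.ι R x * Br u _ - Lv x (parity _) * u
      rw [Br0, hp, contract_ι_mul, Br0, hu, AlgHom.commutes, Lv0, Algebra.smul_def,
        anchorDual_apply, map_neg]
      noncomm_ring
    · change _ = ExteriorAlgebra.ι R x * Br u _ - Lv x (parity _) * u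
      rw [Br1, Br1, LvD, parity_ι, map_neg, Lv1, Lv1, 𝔞.bracket_skew x z, map_neg]
      noncomm_ring
    · intro a b
      change ExteriorAlgebra.ι R x * Br u (a * b) - Lv x (parity (a * b)) * u =
        parity a * (ExteriorAlgebra.ι R x * Br u b - Lv x (parity b) * u) +
        (ExteriorAlgebra.ι R x * Br u a - Lv x (parity a) * u) * b
      rw [BrO u hu, map_mul, LvD, mul_add, ← mul_assoc _ a, ι_mul_eq x a, add_mul,
        mul_assoc _ (parity b) u, odd_mul_comm hu b]
      noncomm_ring
  refine ⟨Br, fun f g => ?_, fun x f => ?_, fun x y => ?_, ?_, ?_⟩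
  · rw [Br0, AlgHom.commutes, contract_algebraMap, neg_zero]
  · rw [Brι, Lv0]
  · rw [Brι, Lv1]
  · intro k l u hu v hv
    induction hu using Submodule.pow_induction_on_left' with
    | algebraMap r =>
      rw [Bralg, Br0, parity_of_mem hv, map_smul, smul_neg, neg_neg, smul_smul, ← pow_add,
        Odd.neg_one_pow (by exact ⟨l, by ring⟩), neg_smul, one_smul]
    | add x y i hx hy ihx ihy =>
      rw [map_add, AddMonoidHom.add_apply, ihx, ihy, map_add, smul_add, neg_add]
    | mem_mul m hm i x hx ih =>
      obtain ⟨y, rfl⟩ := hm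
      have e : Br v (ExteriorAlgebra.ι R y * x) =
          -(Lv y v * x) + (-1 : R) ^ (l + 1) • (ExteriorAlgebra.ι R y * Br v x) := by
        rcases Nat.even_or_odd l with hl | hl
        · rw [BrE _ (hparE hl hv), Br1, parity_ι, hl.add_one.neg_one_pow, neg_smul, one_smul]
          noncomm_ring
        · rw [BrO _ (hparO hl hv), Br1, hl.add_one.neg_one_pow, one_smul]
          noncomm_ring
      have e' : Br x v = -((-1 : R) ^ ((i + 1) * (l + 1)) • Br v x) := ih
      rw [e, Nat.succ_eq_add_one]
      rcases Nat.even_or_odd i with hi | hi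
      · rw [BrLE y x (hparE hi hx), e', Even.neg_one_pow (n := (i + 1 + 1) * (l + 1))
          ((by simpa [parity_simps] using hi : Even (i + 1 + 1)).mul_right _), one_smul]
        rcases Nat.even_or_odd l with hl | hl
        · rw [hl.add_one.neg_one_pow, (hi.add_one.mul hl.add_one).neg_one_pow]
          simp only [neg_smul, one_smul]
          noncomm_ring
        · rw [hl.add_one.neg_one_pow, (hl.add_one.mul_left _).neg_one_pow]
          simp only [one_smul]
          noncomm_ring
      · rw [BrLO y x (hparO hi hx), e', parity_of_mem hv]
        rcases Nat.even_or_odd l with hl | hl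
        · rw [hl.add_one.neg_one_pow, (hi.add_one.mul_right _).neg_one_pow, hl.neg_one_pow,
            (hi.add_one.add_one.mul hl.add_one).neg_one_pow]
          simp only [neg_smul, one_smul]
          noncomm_ring
        · rw [hl.add_one.neg_one_pow, (hi.add_one.mul_right _).neg_one_pow, hl.neg_one_pow,
            (hl.add_one.mul_left _).neg_one_pow]
          simp only [neg_smul, one_smul, map_neg]
          noncomm_ring
  · intro k l u hu v hv w
    rcases Nat.even_or_odd k with hk | hk
    · rw [BrE _ (hparE hk hu), parity_of_mem hv, pow_mul, hk.add_one.neg_one_pow, smul_mul_assoc,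
        add_comm]
    · rw [BrO _ (hparO hk hu), pow_mul, hk.add_one.neg_one_pow, one_pow, one_smul, add_comm]

/-- The Schouten bracket on `Γ(∧A)`. -/
def schouten [CharZero 𝕜] : ExteriorAlgebra R L →+ ExteriorAlgebra R L →+ ExteriorAlgebra R L :=
  (exists_isSchouten 𝔞).choose

theorem schouten_spec [CharZero 𝕜] : IsSchouten 𝔞 (schouten 𝔞) := (exists_isSchouten 𝔞).choose_spec

end Schouten

section Duality

variable {𝕜 R L L' : Type*} [Field 𝕜] [CommRing R] [Algebra 𝕜 R] [AddCommGroup L] [Module R L]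
  [AddCommGroup L'] [Module R L']

/-- The contraction `i_U` of forms by a multisection `U`, characterised by `i_f = f` for functions,
`(i_x ω)(x₁, …) = ω(x, x₁, …)` for sections, and `i_{U ∧ W} = i_W ∘ i_U`.
Here `B` is the duality pairing. -/
def interiorHom (B : L →ₗ[R] L' →ₗ[R] R) :
    ExteriorAlgebra R L →ₐ[R] (Module.End R (ExteriorAlgebra R L'))ᵐᵒᵖ :=
  ExteriorAlgebra.lift R
    ⟨(MulOpposite.opLinearEquiv R).toLinearMap ∘ₗ CliffordAlgebra.contractLeft ∘ₗ B, fun x => by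
      apply MulOpposite.unop_injective
      refine LinearMap.ext fun w => ?_
      exact CliffordAlgebra.contractLeft_contractLeft (B x) w⟩

/-- The contraction `i_U ω`. -/
def interior (B : L →ₗ[R] L' →ₗ[R] R) (U : ExteriorAlgebra R L) :
    ExteriorAlgebra R L' →ₗ[R] ExteriorAlgebra R L' :=
  (interiorHom B U).unop

theorem interior_ι (B : L →ₗ[R] L' →ₗ[R] R) (x : L) :
    interior B (ExteriorAlgebra.ι R x) = contract (B x) := by
  simp only [interior, interiorHom, ExteriorAlgebra.lift_ι_apply]
  rfl

theorem interior_mul (B : L →ₗ[R] L' →ₗ[R] R) (U W : ExteriorAlgebra R L)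
    (ω : ExteriorAlgebra R L') :
    interior B (U * W) ω = interior B W (interior B U ω) := by
  simp only [interior, map_mul]
  rfl

/-- The duality pairing of multisections and forms, i.e. the determinant pairing in each degree:
the degree-zero part of `i_U ω`. -/
def pair (B : L →ₗ[R] L' →ₗ[R] R) (U : ExteriorAlgebra R L) (ω : ExteriorAlgebra R L') : R :=
  ExteriorAlgebra.algebraMapInv (interior B U ω)

variable (𝔞 : LieAlgebroid 𝕜 R L)

/-- `D` is the Lie algebroid differential on forms: the derivation of degree one given
by `(df)(x) = ρ(x) f` and `(dθ)(x, y) = ρ(x) θ(y) - ρ(y) θ(x) - θ([x, y])`. -/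
structure IsDifferential (B : L →ₗ[R] L' →ₗ[R] R)
    (D : ExteriorAlgebra R L' →+ ExteriorAlgebra R L') : Prop where
  degree_fun : ∀ f, D (algebraMap R _ f) ∈ ⋀[R]^1 L'
  eval_fun : ∀ f x, pair B (ExteriorAlgebra.ι R x) (D (algebraMap R _ f)) = 𝔞.anchor x f
  degree_section : ∀ θ, D (ExteriorAlgebra.ι R θ) ∈ ⋀[R]^2 L'
  eval_section : ∀ θ x y,
    pair B (ExteriorAlgebra.ι R x * ExteriorAlgebra.ι R y) (D (ExteriorAlgebra.ι R θ)) =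
      𝔞.anchor x (B y θ) - 𝔞.anchor y (B x θ) - B (𝔞.bracket x y) θ
  derivation : ∀ k, ∀ a ∈ ⋀[R]^k L', ∀ b, D (a * b) = D a * b + (-1 : R) ^ k • (a * D b)

open Classical in
/-- The Lie algebroid differential `d` on `Γ(∧A*)`. -/
def differential (B : L →ₗ[R] L' →ₗ[R] R) : ExteriorAlgebra R L' →+ ExteriorAlgebra R L' :=
  if h : ∃ D, IsDifferential 𝔞 B D then h.choose else 0

/-- A finite dual basis for the pairing `B`. -/
def HasDualBasis (B : L →ₗ[R] L' →ₗ[R] R) : Prop :=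
  ∃ (J : Type) (_ : Fintype J) (e : J → L) (ε : J → L'),
    (∀ x, x = ∑ i, B x (ε i) • e i) ∧ ∀ θ, θ = ∑ i, B (e i) θ • ε i

theorem pair_ι_ι (B : L →ₗ[R] L' →ₗ[R] R) (x : L) (θ : L') :
    pair B (ExteriorAlgebra.ι R x) (ExteriorAlgebra.ι R θ) = B x θ := by
  rw [pair, interior_ι, contract_ι, AlgHom.commutes]
  rfl

theorem pair_ι_mul_ι (B : L →ₗ[R] L' →ₗ[R] R) (x y : L) (θ η : L') :
    pair B (ExteriorAlgebra.ι R x * ExteriorAlgebra.ι R y)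
      (ExteriorAlgebra.ι R θ * ExteriorAlgebra.ι R η) = B x θ * B y η - B y θ * B x η := by
  rw [pair, interior_mul, interior_ι, interior_ι, contract_ι_mul, contract_ι, map_sub, map_smul,
    contract_ι, contract_ι_mul, contract_algebraMap, mul_zero, sub_zero]
  simp [Algebra.smul_def, ExteriorAlgebra.algebraMap_leftInverse _ _]

theorem pair_add (B : L →ₗ[R] L' →ₗ[R] R) (U : ExteriorAlgebra R L)
    (ω ω' : ExteriorAlgebra R L') : pair B U (ω + ω') = pair B U ω + pair B U ω' := by
  simp [pair]

theorem pair_smul (B : L →ₗ[R] L' →ₗ[R] R) (U : ExteriorAlgebra R L) (f : R)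
    (ω : ExteriorAlgebra R L') : pair B U (f • ω) = f * pair B U ω := by
  simp [pair]

theorem pair_sum (B : L →ₗ[R] L' →ₗ[R] R) (U : ExteriorAlgebra R L) {ι : Type*} (s : Finset ι)
    (ω : ι → ExteriorAlgebra R L') : pair B U (∑ i ∈ s, ω i) = ∑ i ∈ s, pair B U (ω i) := by
  simp [pair]

theorem ι_mul_ι_mem (θ η : L') :
    ExteriorAlgebra.ι R θ * ExteriorAlgebra.ι R η ∈ ⋀[R]^2 L' := by
  rw [ExteriorAlgebra.exteriorPower, pow_two]
  exact Submodule.mul_mem_mul ⟨θ, rfl⟩ ⟨η, rfl⟩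

theorem exists_isDifferential [CharZero 𝕜] (B : L →ₗ[R] L' →ₗ[R] R) (hB : HasDualBasis B) :
    ∃ D, IsDifferential 𝔞 B D := by
  obtain ⟨J, _, e, ε, he, hε⟩ := hB
  let h : R := algebraMap 𝕜 R (1 / 2)
  let F : L → L → L' → R := fun x y θ =>
    𝔞.anchor x (B y θ) - 𝔞.anchor y (B x θ) - B (𝔞.bracket x y) θ
  have F_skew : ∀ x y θ, F y x θ = -F x y θ := fun x y θ => by
    simp only [F, 𝔞.bracket_skew y x, map_neg, LinearMap.neg_apply]; ring
  have F_smul : ∀ (f : R) x y θ, F x (f • y) θ = f * F x y θ := fun f x y θ => by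
    simp only [F, 𝔞.leibniz, map_smul, map_add, LinearMap.add_apply, LinearMap.smul_apply,
      smul_eq_mul, Derivation.leibniz, Derivation.smul_apply]; ring
  have F_add : ∀ x y z θ, F x (y + z) θ = F x y θ + F x z θ := fun x y z θ => by
    simp only [F, map_add, LinearMap.add_apply, Derivation.add_apply]; ring
  have F_zero : ∀ x θ, F x 0 θ = 0 := fun x θ => by
    simp [F]
  have F_sum : ∀ x θ (c : J → R) (s : Finset J),
      F x (∑ i ∈ s, c i • e i) θ = ∑ i ∈ s, c i * F x (e i) θ := fun x θ c s => by
    classical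
    induction s using Finset.induction_on with
    | empty => simp [F_zero]
    | insert a s ha ih => rw [Finset.sum_insert ha, F_add, F_smul, ih, Finset.sum_insert ha]
  have F_exp : ∀ x y θ, F x y θ = ∑ i, B y (ε i) * F x (e i) θ := fun x y θ => by
    conv_lhs => rw [he y]
    rw [F_sum]
  have F_exp' : ∀ x y θ, F x y θ = ∑ i, B x (ε i) * F (e i) y θ := fun x y θ => by
    rw [F_skew y x, F_exp, ← Finset.sum_neg_distrib]
    exact Finset.sum_congr rfl fun i _ => by rw [F_skew (e i) y]; ring
  let d0 : R →+ L' := AddMonoidHom.mk' (fun f => ∑ i, 𝔞.anchor (e i) f • ε i) fun f g => by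
    simp only [map_add, add_smul, Finset.sum_add_distrib]
  have hd0 : ∀ f, d0 f = ∑ i, 𝔞.anchor (e i) f • ε i := fun f => rfl
  have Bd0 : ∀ x f, B x (d0 f) = 𝔞.anchor x f := fun x f => by
    conv_rhs => rw [he x]
    rw [hd0]
    rw [← anchorDual_apply]
    simp only [map_sum, map_smul, smul_eq_mul, anchorDual_apply]
    exact Finset.sum_congr rfl fun i _ => mul_comm _ _
  let d1 : L' →+ ExteriorAlgebra R L' := AddMonoidHom.mk'
    (fun θ => h • ∑ i, ∑ j, F (e i) (e j) θ • (ExteriorAlgebra.ι R (ε i) *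
      ExteriorAlgebra.ι R (ε j))) fun θ η => by
    have : ∀ x y, F x y (θ + η) = F x y θ + F x y η := fun x y => by
      simp only [F, map_add]; ring
    simp only [this, add_smul, Finset.sum_add_distrib, smul_add]
  have hd1 : ∀ θ, d1 θ = h • ∑ i, ∑ j, F (e i) (e j) θ • (ExteriorAlgebra.ι R (ε i) *
      ExteriorAlgebra.ι R (ε j)) := fun θ => rfl
  have d1_mem : ∀ θ, d1 θ ∈ ⋀[R]^2 L' := fun θ =>
    Submodule.smul_mem _ _ (Submodule.sum_mem _ fun i _ => Submodule.sum_mem _ fun j _ =>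
      Submodule.smul_mem _ _ (ι_mul_ι_mem _ _))
  have d0ι : ∀ f, ExteriorAlgebra.ι R (d0 f) =
      ∑ i, 𝔞.anchor (e i) f • ExteriorAlgebra.ι R (ε i) := fun f => by
    rw [hd0]; simp only [map_sum, map_smul]
  have ιε : ∀ θ, ExteriorAlgebra.ι R θ = ∑ i, B (e i) θ • ExteriorAlgebra.ι R (ε i) := fun θ => by
    conv_lhs => rw [hε θ]
    simp only [map_sum, map_smul]
  have pev : ∀ θ, parity (d1 θ) = d1 θ := fun θ => by
    rw [parity_of_mem (d1_mem θ)]; simp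
  obtain ⟨D, D0, D1, DD⟩ := exists_twisted_derivation (R := R) (L := L') parity
    ((ExteriorAlgebra.ι R).toAddMonoidHom.comp d0) d1
    (by
      intro f g
      change ExteriorAlgebra.ι R (d0 (f * g)) = f • ExteriorAlgebra.ι R (d0 g) +
        g • ExteriorAlgebra.ι R (d0 f)
      rw [← map_smul (ExteriorAlgebra.ι R), ← map_smul (ExteriorAlgebra.ι R),
        ← map_add (ExteriorAlgebra.ι R)]
      congr 1
      simp only [hd0, Derivation.leibniz, add_smul, Finset.sum_add_distrib, Finset.smul_sum,
        smul_eq_mul, mul_smul])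
    (by
      intro f θ
      change d1 (f • θ) = f • d1 θ + ExteriorAlgebra.ι R (d0 f) * ExteriorAlgebra.ι R θ
      have hF : ∀ x y, F x y (f • θ) =
          f * F x y θ + (𝔞.anchor x f * B y θ - 𝔞.anchor y f * B x θ) := fun x y => by
        simp only [F, map_smul, smul_eq_mul, Derivation.leibniz]; ring
      have e1 : ExteriorAlgebra.ι R (d0 f) * ExteriorAlgebra.ι R θ =
          ∑ i, ∑ j, (𝔞.anchor (e i) f * B (e j) θ) • (ExteriorAlgebra.ι R (ε i) *
            ExteriorAlgebra.ι R (ε j)) := by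
        rw [d0ι, ιε θ, Finset.sum_mul_sum]
        simp only [smul_mul_smul_comm]
      have e2 : ExteriorAlgebra.ι R θ * ExteriorAlgebra.ι R (d0 f) =
          ∑ i, ∑ j, (𝔞.anchor (e j) f * B (e i) θ) • (ExteriorAlgebra.ι R (ε i) *
            ExteriorAlgebra.ι R (ε j)) := by
        rw [d0ι, ιε θ, Finset.sum_mul_sum]
        simp only [smul_mul_smul_comm, mul_comm]
      have e3 : ExteriorAlgebra.ι R θ * ExteriorAlgebra.ι R (d0 f) =
          -(ExteriorAlgebra.ι R (d0 f) * ExteriorAlgebra.ι R θ) :=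
        eq_neg_of_add_eq_zero_left (ExteriorAlgebra.ι_add_mul_swap _ _)
      rw [hd1, hd1]
      simp only [hF, add_smul, sub_smul, Finset.sum_add_distrib, Finset.sum_sub_distrib]
      rw [← e1, ← e2, e3, sub_neg_eq_add, smul_add, smul_add, half_smul_add]
      congr 1
      simp only [Finset.smul_sum, smul_smul]
      refine Finset.sum_congr rfl fun i _ => Finset.sum_congr rfl fun j _ => ?_
      congr 1; ring)
    (by
      intro f a
      exact odd_mul_comm (parity_ι _) a)
    (by
      intro θ
      rw [parity_ι, neg_mul, even_mul_comm (pev θ), neg_add_cancel])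
  refine ⟨D, fun f => ?_, fun f x => ?_, fun θ => ?_, fun θ x y => ?_, fun k a ha b => ?_⟩
  · rw [D0, ExteriorAlgebra.exteriorPower, pow_one]
    exact ⟨d0 f, rfl⟩
  · rw [D0]
    exact (pair_ι_ι B x (d0 f)).trans (Bd0 x f)
  · rw [D1]; exact d1_mem θ
  · rw [D1, hd1, pair_smul, pair_sum]
    simp only [pair_sum, pair_smul, pair_ι_mul_ι]
    have e1 : ∑ i, ∑ j, F (e i) (e j) θ * (B x (ε i) * B y (ε j) - B y (ε i) * B x (ε j)) =
        F x y θ - F y x θ := by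
      simp only [mul_sub, Finset.sum_sub_distrib]
      congr 1
      · rw [F_exp' x y]
        refine Finset.sum_congr rfl fun i _ => ?_
        rw [F_exp (e i) y, Finset.mul_sum]
        exact Finset.sum_congr rfl fun j _ => by ring
      · rw [F_exp' y x]
        refine Finset.sum_congr rfl fun i _ => ?_
        rw [F_exp (e i) x, Finset.mul_sum]
        exact Finset.sum_congr rfl fun j _ => by ring
    rw [e1, F_skew x y, sub_neg_eq_add, mul_add, ← add_mul]
    change (algebraMap 𝕜 R (1 / 2) + algebraMap 𝕜 R (1 / 2)) * _ = _
    rw [← map_add, show (1 / 2 + 1 / 2 : 𝕜) = 1 by norm_num, map_one, one_mul]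
  · rw [DD, parity_of_mem ha, smul_mul_assoc, add_comm]

theorem differential_spec [CharZero 𝕜] (B : L →ₗ[R] L' →ₗ[R] R) (hB : HasDualBasis B) :
    IsDifferential 𝔞 B (differential 𝔞 B) := by
  have h := exists_isDifferential 𝔞 B hB
  rw [differential, dif_pos h]
  exact h.choose_spec

end Duality

section Operators

variable {𝕜 R L L' : Type*} [Field 𝕜] [CharZero 𝕜] [CommRing R] [Algebra 𝕜 R]
  [AddCommGroup L] [Module R L] [AddCommGroup L'] [Module R L']
variable (𝔞 : LieAlgebroid 𝕜 R L) (𝔟 : LieAlgebroid 𝕜 R L') (B : L →ₗ[R] L' →ₗ[R] R)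

/-- The Lie derivative `L_x = [x, ·]` of multisections along a section `x`. -/
def lieMulti (x : L) : ExteriorAlgebra R L →+ ExteriorAlgebra R L :=
  schouten 𝔞 (ExteriorAlgebra.ι R x)

/-- The Lie derivative `L_x = i_x d + d i_x` of forms along a section `x`. -/
def lieForm (x : L) : ExteriorAlgebra R L' →+ ExteriorAlgebra R L' :=
  (contract (B x)).toAddMonoidHom.comp (differential 𝔞 B) +
    (differential 𝔞 B).comp (contract (B x)).toAddMonoidHom

/-- The map `Ω^♯ : U ↦ i_U Ω` from multisections to forms. -/
def sharp (Ω : ExteriorAlgebra R L') (U : ExteriorAlgebra R L) : ExteriorAlgebra R L' :=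
  interior B U Ω

/-- The Batalin-Vilkovisky operator `∂` on multisections: `Ω^♯ ∂β = (-1)^l d Ω^♯ β` for `β` of
degree `l`. -/
def bv (Ω : ExteriorAlgebra R L') (β : ExteriorAlgebra R L) : ExteriorAlgebra R L :=
  Function.invFun (sharp B Ω) (differential 𝔞 B (sharp B Ω (parity β)))

/-- The Laplacian `Δ = d_* ∂ + ∂ d_*` on multisections of the first algebroid. -/
def laplacian (Ω : ExteriorAlgebra R L') (u : ExteriorAlgebra R L) : ExteriorAlgebra R L :=
  differential 𝔟 B.flip (bv 𝔞 B Ω u) + bv 𝔞 B Ω (differential 𝔟 B.flip u)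

/-- The Lie derivative `L_{x + ξ} = L_x + L_ξ` on `Γ(∧A*)`, for `x ∈ Γ(A)` and `ξ ∈ Γ(A*)`.
With the roles of `A` and `A*` exchanged it is the one on `Γ(∧A)`. -/
def lieSum (x : L) (ξ : L') : ExteriorAlgebra R L' →+ ExteriorAlgebra R L' :=
  lieForm 𝔞 B x + lieMulti 𝔟 ξ

/-- The Dorfman product `u ∘ θ = -i_θ d_* u + L_u θ` of `u ∈ Γ(A)` and `θ ∈ Γ(A*)`. With the roles
of `A` and `A*` exchanged it is `θ ∘ u = -i_u dθ + L_θ u`. -/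
def dorfman (u : L) (θ : L') : L × L' :=
  (-ExteriorAlgebra.ιInv
      (contract (B.flip θ) (differential 𝔟 B.flip (ExteriorAlgebra.ι R u))),
    ExteriorAlgebra.ιInv (lieForm 𝔞 B u (ExteriorAlgebra.ι R θ)))

/-- The operator `L_{u ∘ θ} - [L_u, L_θ]` on `Γ(∧A*)`. -/
def dorfmanDefect (u : L) (θ : L') (α : ExteriorAlgebra R L') : ExteriorAlgebra R L' :=
  lieSum 𝔞 𝔟 B (dorfman 𝔞 𝔟 B u θ).1 (dorfman 𝔞 𝔟 B u θ).2 α -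
    (lieForm 𝔞 B u (lieMulti 𝔟 θ α) - lieMulti 𝔟 θ (lieForm 𝔞 B u α))

end Operators

section BaseForms

variable {𝕜 R : Type*} [Field 𝕜] [CommRing R] [Algebra 𝕜 R]

/-- The differential forms on the base: the exterior algebra of the dual of the vector fields. -/
abbrev BaseForms (𝕜 R : Type*) [Field 𝕜] [CommRing R] [Algebra 𝕜 R] : Type _ :=
  ExteriorAlgebra R (Module.Dual R (Derivation 𝕜 R R))

/-- The Lie derivative of a one-form: `(L_X α)(Y) = X (α Y) - α [X, Y]`. -/
def lieOneForm (X : Derivation 𝕜 R R) :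
    Module.Dual R (Derivation 𝕜 R R) →+ Module.Dual R (Derivation 𝕜 R R) where
  toFun α :=
    { toFun := fun Y => X (α Y) - α ⁅X, Y⁆
      map_add' := fun Y Z => by rw [lie_add]; simp only [map_add]; ring
      map_smul' := fun f Y => by
        rw [LieRinehartRing.leibniz_smul_right]
        simp only [map_add, map_smul, smul_eq_mul, Derivation.leibniz, RingHom.id_apply]
        change _ + α Y * X f - (_ + X f * α Y) = _
        ring }
  map_zero' := by ext Y; simp
  map_add' α β := by ext Y; simp; ring

theorem exists_lieBaseForm (X : Derivation 𝕜 R R) : ∃ D : BaseForms 𝕜 R →+ BaseForms 𝕜 R,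
    (∀ f, D (algebraMap R _ f) = algebraMap R _ (X f)) ∧
    (∀ α, D (ExteriorAlgebra.ι R α) = ExteriorAlgebra.ι R (lieOneForm X α)) ∧
    ∀ a b, D (a * b) = a * D b + D a * b := by
  refine exists_twisted_derivation (AlgHom.id R _)
    ((algebraMap R (BaseForms 𝕜 R)).toAddMonoidHom.comp (X : R →ₗ[𝕜] R).toAddMonoidHom)
    ((ExteriorAlgebra.ι R).toAddMonoidHom.comp (lieOneForm X)) ?_ ?_ ?_ ?_
  · intro f g
    change algebraMap R _ (X (f * g)) = f • algebraMap R _ (X g) + g • algebraMap R _ (X f)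
    simp [Algebra.smul_def]
  · intro f α
    change ExteriorAlgebra.ι R (lieOneForm X (f • α)) = f • ExteriorAlgebra.ι R (lieOneForm X α) +
      algebraMap R _ (X f) * ExteriorAlgebra.ι R α
    rw [← Algebra.smul_def, ← map_smul (ExteriorAlgebra.ι R), ← map_smul (ExteriorAlgebra.ι R),
      ← map_add (ExteriorAlgebra.ι R)]
    congr 1
    ext Y
    simp [lieOneForm]
    ring
  · intro f a
    exact (Algebra.commutes (R := R) (X f) a).symm
  · intro α
    exact ExteriorAlgebra.ι_add_mul_swap α (lieOneForm X α)

/-- The Lie derivative of differential forms on the base along a vector field: the derivation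
of degree zero with `L_X f = X f` and `(L_X α)(Y) = X (α Y) - α [X, Y]`. -/
def lieBaseForm (X : Derivation 𝕜 R R) : BaseForms 𝕜 R →+ BaseForms 𝕜 R :=
  (exists_lieBaseForm X).choose

/-- The value `s(Y₁, …, Y_k)` of the degree `k` part of a differential form on vector fields. -/
def evalBaseForm {k : ℕ} (s : BaseForms 𝕜 R) (Y : Fin k → Derivation 𝕜 R R) : R :=
  pair (Module.Dual.eval R (Derivation 𝕜 R R)) (ExteriorAlgebra.ιMulti R k Y) s

variable {L L' : Type*} [AddCommGroup L] [Module R L] [AddCommGroup L'] [Module R L'] [CharZero 𝕜]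

/-- `ξ₀` is the modular cocycle of the Lie algebroid `𝔞` with respect to the top multisection `V`
and the volume form `s` of the base:
`(L_u V) ⊗ s + V ⊗ (L_{ρ(u)} s) = ⟨ξ₀, u⟩ V ⊗ s` for all sections `u`. -/
def IsModularCocycle (𝔞 : LieAlgebroid 𝕜 R L) (B : L →ₗ[R] L' →ₗ[R] R)
    (V : ExteriorAlgebra R L) (s : BaseForms 𝕜 R) (ξ₀ : L') : Prop :=
  ∀ u : L, lieMulti 𝔞 u V ⊗ₜ[R] s + V ⊗ₜ[R] lieBaseForm (𝔞.anchor u) s = B u ξ₀ • (V ⊗ₜ[R] s)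

end BaseForms

end LieAlgebroidPair

open scoped Manifold ContDiff Bundle TensorProduct

namespace LieAlgebroidPair

section Geometry

variable (𝕜 : Type*) [RCLike 𝕜] (m n : ℕ) (M : Type*) [TopologicalSpace M]
  [ChartedSpace (EuclideanSpace ℝ (Fin m)) M]

/-- The smooth `𝕜`-valued functions on the real manifold `M`, as a subalgebra of all functions. -/
def smoothFun : Subalgebra 𝕜 (M → 𝕜) where
  carrier := {f | ContMDiff (𝓡 m) 𝓘(ℝ, 𝕜) ∞ f}
  mul_mem' hf hg := (contDiff_mul (𝕜 := ℝ) (𝔸 := 𝕜)).comp_contMDiff (hf.prodMk_space hg)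
  add_mem' hf hg := ContMDiff.add hf hg
  algebraMap_mem' _ := contMDiff_const

/-- The algebra `C^∞(M, 𝕜)`. -/
def Fn : Type _ := smoothFun 𝕜 m M

instance : CommRing (Fn 𝕜 m M) := inferInstanceAs (CommRing (smoothFun 𝕜 m M))
instance : Algebra 𝕜 (Fn 𝕜 m M) := inferInstanceAs (Algebra 𝕜 (smoothFun 𝕜 m M))

variable (A : M → Type*) [TopologicalSpace (Bundle.TotalSpace (Fin n → 𝕜) A)]
  [∀ p, TopologicalSpace (A p)] [∀ p, AddCommGroup (A p)] [∀ p, Module 𝕜 (A p)]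
  [∀ p, Module ℝ (A p)] [FiberBundle (Fin n → 𝕜) A]
  [VectorBundle 𝕜 (Fin n → 𝕜) A] [VectorBundle ℝ (Fin n → 𝕜) A]

/-- The smooth sections of the rank `n` vector bundle `A`, as a module over the smooth
functions. -/
def smoothSections : Submodule (smoothFun 𝕜 m M) (∀ p, A p) where
  carrier := {u | ContMDiff (𝓡 m) ((𝓡 m).prod 𝓘(ℝ, Fin n → 𝕜)) ∞
    fun p => Bundle.TotalSpace.mk' (Fin n → 𝕜) p (u p)}
  zero_mem' := Bundle.contMDiff_zeroSection ℝ A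
  add_mem' hu hv := ContMDiff.add_section hu hv
  smul_mem' f u hu := by
    intro p
    have hu := hu p
    rw [Bundle.contMDiffAt_section] at hu ⊢
    set e := trivializationAt (Fin n → 𝕜) A p
    have hf : ContMDiffAt (𝓡 m) 𝓘(ℝ, 𝕜) ∞ (f : M → 𝕜) p := f.2 p
    have hs : ContDiff ℝ ∞ fun x : 𝕜 × (Fin n → 𝕜) => x.1 • x.2 :=
      contDiff_fst.smul contDiff_snd
    refine (hs.contDiffAt.comp_contMDiffAt (hf.prodMk_space hu)).congr_of_eventuallyEq ?_
    filter_upwards [e.open_baseSet.mem_nhds (FiberBundle.mem_baseSet_trivializationAt' p)]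
      with x hx
    exact (e.linear 𝕜 hx).2 _ _

/-- The module `Γ(A)` of smooth sections of `A`. -/
def Sec : Type _ := smoothSections 𝕜 m n M A

instance : AddCommGroup (Sec 𝕜 m n M A) := inferInstanceAs (AddCommGroup (smoothSections 𝕜 m n M A))
instance : Module (Fn 𝕜 m M) (Sec 𝕜 m n M A) :=
  inferInstanceAs (Module (smoothFun 𝕜 m M) (smoothSections 𝕜 m n M A))

/-- The smooth sections of the dual bundle `A*`: the families of linear forms on the fibres whose
value on every smooth section of `A` is a smooth function. -/
def smoothDualSections : Submodule (smoothFun 𝕜 m M) (∀ p, Module.Dual 𝕜 (A p)) where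
  carrier := {θ | ∀ u ∈ smoothSections 𝕜 m n M A, (fun p => θ p (u p)) ∈ smoothFun 𝕜 m M}
  zero_mem' _ _ := (smoothFun 𝕜 m M).zero_mem
  add_mem' hθ hη u hu := (smoothFun 𝕜 m M).add_mem (hθ u hu) (hη u hu)
  smul_mem' f _ hθ u hu := (smoothFun 𝕜 m M).mul_mem f.2 (hθ u hu)

/-- The module `Γ(A*)` of smooth sections of `A*`. -/
def DualSec : Type _ := smoothDualSections 𝕜 m n M A

instance : AddCommGroup (DualSec 𝕜 m n M A) :=
  inferInstanceAs (AddCommGroup (smoothDualSections 𝕜 m n M A))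
instance : Module (Fn 𝕜 m M) (DualSec 𝕜 m n M A) :=
  inferInstanceAs (Module (smoothFun 𝕜 m M) (smoothDualSections 𝕜 m n M A))

/-- The duality pairing `⟨u, θ⟩` of sections of `A` and `A*`. -/
def duality : Sec 𝕜 m n M A →ₗ[Fn 𝕜 m M] DualSec 𝕜 m n M A →ₗ[Fn 𝕜 m M] Fn 𝕜 m M :=
  LinearMap.mk₂ _ (fun u θ => ⟨fun p => θ.1 p (u.1 p), θ.2 u.1 u.2⟩)
    (fun _ _ θ => Subtype.ext (funext fun p => map_add (θ.1 p) _ _))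
    (fun f _ θ => Subtype.ext (funext fun p => map_smul (θ.1 p) (f.1 p) _))
    (fun _ _ _ => rfl) (fun _ _ _ => rfl)

variable {𝕜 m n M A}

/-- `t` is the trace of the operator `T` on `Γ(A)`: `T` acts on each fibre by an endomorphism, and
the trace of that endomorphism is the value of `t`. -/
def HasTrace (T : Sec 𝕜 m n M A →ₗ[Fn 𝕜 m M] Sec 𝕜 m n M A) (t : Fn 𝕜 m M) : Prop :=
  ∀ p, ∃ Tp : A p →ₗ[𝕜] A p, (∀ x, (T x).1 p = Tp (x.1 p)) ∧ LinearMap.trace 𝕜 (A p) Tp = t.1 p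

/-- `t` is the trace of the operator `T` on `Γ(A*)`. -/
def HasDualTrace (T : DualSec 𝕜 m n M A →ₗ[Fn 𝕜 m M] DualSec 𝕜 m n M A) (t : Fn 𝕜 m M) : Prop :=
  ∀ p, ∃ Tp : Module.Dual 𝕜 (A p) →ₗ[𝕜] Module.Dual 𝕜 (A p),
    (∀ α, (T α).1 p = Tp (α.1 p)) ∧ LinearMap.trace 𝕜 (Module.Dual 𝕜 (A p)) Tp = t.1 p

/-- `s` is a volume form on `M`: a nowhere vanishing differential form of degree `m = dim M`. -/
def IsVolumeForm (s : BaseForms 𝕜 (Fn 𝕜 m M)) : Prop :=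
  s ∈ ⋀[Fn 𝕜 m M]^m (Module.Dual (Fn 𝕜 m M) (Derivation 𝕜 (Fn 𝕜 m M) (Fn 𝕜 m M))) ∧
    ∀ p : M, ∃ Y : Fin m → Derivation 𝕜 (Fn 𝕜 m M) (Fn 𝕜 m M), (evalBaseForm s Y).1 p ≠ 0

end Geometry

end LieAlgebroidPair

namespace LieAlgebroidPair

section Fibres

variable {𝕜 : Type*} [RCLike 𝕜] {m n : ℕ} {M : Type*} [TopologicalSpace M]
  [ChartedSpace (EuclideanSpace ℝ (Fin m)) M]
  {A : M → Type*} [TopologicalSpace (Bundle.TotalSpace (Fin n → 𝕜) A)]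
  [∀ p, TopologicalSpace (A p)] [∀ p, AddCommGroup (A p)] [∀ p, Module 𝕜 (A p)]
  [∀ p, Module ℝ (A p)] [FiberBundle (Fin n → 𝕜) A]
  [VectorBundle 𝕜 (Fin n → 𝕜) A] [VectorBundle ℝ (Fin n → 𝕜) A]

/-- Evaluation of functions at a point. -/
def evalAt (p : M) : Fn 𝕜 m M →+* 𝕜 :=
  (Pi.evalRingHom (fun _ : M => 𝕜) p).comp (smoothFun 𝕜 m M).val.toRingHom

/-- Evaluation of sections at a point. -/
def secAt (p : M) : Sec 𝕜 m n M A →+ A p where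
  toFun x := x.1 p
  map_zero' := rfl
  map_add' _ _ := rfl

/-- Evaluation of dual sections at a point. -/
def dualSecAt (p : M) : DualSec 𝕜 m n M A →+ Module.Dual 𝕜 (A p) where
  toFun x := x.1 p
  map_zero' := rfl
  map_add' _ _ := rfl

/-- A top form has a value in each fibre, which is an alternating form. -/
theorem exists_fibre_form (Ω : ExteriorAlgebra (Fn 𝕜 m M) (DualSec 𝕜 m n M A)) (p : M) :
    ∃ w : A p [⋀^Fin n]→ₗ[𝕜] 𝕜, ∀ v : Fin n → Sec 𝕜 m n M A,
      (pair (duality 𝕜 m n M A) (ExteriorAlgebra.ιMulti (Fn 𝕜 m M) n v) Ω).1 p =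
        w fun i => (v i).1 p := by
  let φ : Fn 𝕜 m M →+* 𝕜 := evalAt p
  let E := ExteriorAlgebra 𝕜 (Module.Dual 𝕜 (A p))
  let _ : Algebra (Fn 𝕜 m M) E := ((algebraMap 𝕜 E).comp φ).toAlgebra' fun c x =>
    Algebra.commutes (φ c) x
  have hsm : ∀ (f : Fn 𝕜 m M) (x : E), f • x = f.1 p • x := fun f x => by
    rw [Algebra.smul_def, Algebra.smul_def]; rfl
  let ev : ExteriorAlgebra (Fn 𝕜 m M) (DualSec 𝕜 m n M A) →ₐ[Fn 𝕜 m M] E :=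
    ExteriorAlgebra.lift (Fn 𝕜 m M)
      ⟨{ toFun := fun θ => ExteriorAlgebra.ι 𝕜 (θ.1 p)
         map_add' := fun θ η => map_add (ExteriorAlgebra.ι 𝕜) (θ.1 p) (η.1 p)
         map_smul' := fun f θ => by
          rw [RingHom.id_apply, hsm]
          exact map_smul (ExteriorAlgebra.ι 𝕜) (f.1 p) (θ.1 p) },
        fun θ => ExteriorAlgebra.ι_sq_zero (θ.1 p)⟩
  have evι : ∀ θ : DualSec 𝕜 m n M A, ev (ExteriorAlgebra.ι _ θ) = ExteriorAlgebra.ι 𝕜 (θ.1 p) :=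
    fun θ => ExteriorAlgebra.lift_ι_apply ..
  have evc : ∀ f : Fn 𝕜 m M, ev (algebraMap _ _ f) = algebraMap 𝕜 E (f.1 p) :=
    fun f => ev.commutes f
  let b : A p →ₗ[𝕜] Module.Dual 𝕜 (A p) →ₗ[𝕜] 𝕜 := Module.Dual.eval 𝕜 (A p)
  have evcon : ∀ (x : Sec 𝕜 m n M A) w,
      ev (contract (duality 𝕜 m n M A x) w) = contract (b (x.1 p)) (ev w) := by
    intro x w
    induction w using CliffordAlgebra.left_induction with
    | algebraMap r =>
      have e := evc r
      change ev (algebraMap _ (CliffordAlgebra 0) r) = _ at e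
      rw [e]
      refine (congrArg ev (contract_algebraMap _ r)).trans ?_
      rw [map_zero]
      exact (contract_algebraMap _ _).symm
    | add a c ha hc => rw [map_add, map_add, ha, hc, map_add, map_add]
    | ι_mul a θ ha =>
      erw [contract_ι_mul, map_sub, map_smul, map_mul, map_mul, ha, evι, contract_ι_mul, hsm]
  have evint : ∀ (k : ℕ) (v : Fin k → Sec 𝕜 m n M A) w,
      ev (interior (duality 𝕜 m n M A) (ExteriorAlgebra.ιMulti _ k v) w) =
        interior b (ExteriorAlgebra.ιMulti 𝕜 k fun i => (v i).1 p) (ev w) := by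
    intro k
    induction k with
    | zero => intro v w; simp [interior]
    | succ k ih =>
      intro v w
      rw [ExteriorAlgebra.ιMulti_succ_apply, ExteriorAlgebra.ιMulti_succ_apply, interior_mul,
        interior_mul, ih, interior_ι, interior_ι, evcon]
      rfl
  have evinv : ∀ w, (ExteriorAlgebra.algebraMapInv w).1 p =
      ExteriorAlgebra.algebraMapInv (ev w) := by
    intro w
    induction w using ExteriorAlgebra.induction with
    | algebraMap r =>
      rw [evc, ExteriorAlgebra.algebraMap_leftInverse, ExteriorAlgebra.algebraMap_leftInverse]
    | ι θ =>
      rw [evι]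
      simp [ExteriorAlgebra.algebraMapInv]
      rfl
    | mul a c ha hc =>
      rw [map_mul, map_mul, map_mul, ← ha, ← hc]; rfl
    | add a c ha hc =>
      rw [map_add, map_add, map_add, ← ha, ← hc]; rfl
  let ℓ : ExteriorAlgebra 𝕜 (A p) →ₗ[𝕜] 𝕜 :=
    { toFun := fun U => pair b U (ev Ω)
      map_add' := fun U W => by simp [pair, interior]
      map_smul' := fun c U => by simp [pair, interior] }
  refine ⟨ℓ.compAlternatingMap (ExteriorAlgebra.ιMulti 𝕜 n), fun v => ?_⟩
  rw [pair, evinv, evint]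
  rfl

theorem finrank_fibre (p : M) : Module.finrank 𝕜 (A p) = n := by
  have e := (trivializationAt (Fin n → 𝕜) A p).linearEquivAt 𝕜 p
    (FiberBundle.mem_baseSet_trivializationAt' p)
  rw [e.finrank_eq, Module.finrank_fin_fun]

theorem smul_eq_sum_update {K E : Type*} [Field K] [AddCommGroup E] [Module K E] [Module.Finite K E]
    (hE : Module.finrank K E = n) (w : E [⋀^Fin n]→ₗ[K] K) (v : Fin n → E) (y : E) :
    (w v) ^ 2 • y = ∑ k, (w v * w (Function.update v k y)) • v k := by
  classical
  by_cases h : w v = 0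
  · simp [h]
  have hli : LinearIndependent K v := by
    by_contra hv
    exact h (w.map_linearDependent v hv)
  rcases Nat.eq_zero_or_pos n with rfl | hn
  · have : Subsingleton E := Module.finrank_zero_iff.mp hE
    exact Subsingleton.elim _ _
  have : Nonempty (Fin n) := ⟨⟨0, hn⟩⟩
  let bs := basisOfLinearIndependentOfCardEqFinrank hli (by simp [hE])
  have hbs : ∀ i, bs i = v i := fun i => by simp [bs]
  have hy : y = ∑ i, bs.repr y i • v i := by
    conv_lhs => rw [← bs.sum_repr y]
    simp [hbs]
  have hc : ∀ k, w (Function.update v k y) = bs.repr y k * w v := fun k => by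
    conv_lhs => rw [hy]
    rw [AlternatingMap.map_update_sum, Finset.sum_eq_single k]
    · simp
    · intro j _ hj
      rw [AlternatingMap.map_update_smul, AlternatingMap.map_update_self _ _ hj.symm, smul_zero]
    · simp
  simp only [hc]
  conv_lhs => rw [hy, Finset.smul_sum]
  refine Finset.sum_congr rfl fun i _ => ?_
  rw [smul_smul]
  congr 1; ring

/-- A pair of dual top sections provides a finite dual basis of `Γ(A)` and `Γ(A*)`. -/
theorem hasDualBasis_duality (Ω : ExteriorAlgebra (Fn 𝕜 m M) (DualSec 𝕜 m n M A))
    (V : ExteriorAlgebra (Fn 𝕜 m M) (Sec 𝕜 m n M A)) (hV : V ∈ ⋀[Fn 𝕜 m M]^n (Sec 𝕜 m n M A))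
    (hΩV : pair (duality 𝕜 m n M A) V Ω = 1) : HasDualBasis (duality 𝕜 m n M A) := by
  classical
  choose w hw using exists_fibre_form (n := n) Ω
  let F : (Fin n → Sec 𝕜 m n M A) → Fn 𝕜 m M := fun v =>
    pair (duality 𝕜 m n M A) (ExteriorAlgebra.ιMulti (Fn 𝕜 m M) n v) Ω
  let ℓ : ExteriorAlgebra (Fn 𝕜 m M) (Sec 𝕜 m n M A) →ₗ[Fn 𝕜 m M] Fn 𝕜 m M :=
    { toFun := fun U => pair (duality 𝕜 m n M A) U Ω
      map_add' := fun U W => by simp [pair, interior]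
      map_smul' := fun c U => by simp [pair, interior] }
  have htop : Ideal.span (Set.range F) = ⊤ := by
    rw [Ideal.eq_top_iff_one]
    have h1 : ℓ V ∈ Submodule.map ℓ (⋀[Fn 𝕜 m M]^n (Sec 𝕜 m n M A)) := ⟨V, hV, rfl⟩
    rw [← ExteriorAlgebra.ιMulti_span_fixedDegree, Submodule.map_span, ← Set.range_comp] at h1
    rw [← hΩV]
    exact h1
  have h1 : (1 : Fn 𝕜 m M) ∈ Submodule.span (Fn 𝕜 m M) ((fun x => x ^ 2) '' Set.range F) := by
    have := Ideal.span_pow_eq_top _ htop 2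
    rwa [Ideal.eq_top_iff_one] at this
  obtain ⟨N, h, g, hg⟩ := Submodule.mem_span_set'.mp h1
  have hg2 : ∀ j, ∃ v, F v ^ 2 = (g j : Fn 𝕜 m M) := fun j => by
    obtain ⟨_, ⟨v, rfl⟩, e⟩ := (g j).2
    exact ⟨v, e⟩
  choose v hv using hg2
  have hsum : ∀ p, ∑ j, (h j).1 p * ((w p) fun i => (v j i).1 p) ^ 2 = 1 := fun p => by
    have e : evalAt p (∑ j, h j • (g j : Fn 𝕜 m M)) = 1 := by rw [hg, map_one]
    rw [map_sum] at e
    rw [← e]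
    refine Finset.sum_congr rfl fun j _ => ?_
    rw [← hv, smul_eq_mul, map_mul, map_pow, ← hw]
    rfl
  have hup : ∀ (a : Fin n → Sec 𝕜 m n M A) (k : Fin n) (x : Sec 𝕜 m n M A) (p : M),
      (fun i => (Function.update a k x i).1 p) =
        Function.update (fun i => (a i).1 p) k (x.1 p) := fun a k x p => by
    funext i
    by_cases hi : i = k
    · subst hi; simp
    · simp [hi]
  let θ : Fin N → Fin n → DualSec 𝕜 m n M A := fun j k =>
    ⟨fun p => (w p).toMultilinearMap.toLinearMap (fun i => (v j i).1 p) k, fun u hu => by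
      have e := (F (Function.update (v j) k ⟨u, hu⟩)).2
      convert e using 1
      funext p
      change (w p) (Function.update _ _ _) = _
      refine Eq.trans ?_ (hw p _).symm
      exact congrArg (w p) (hup (v j) k ⟨u, hu⟩ p).symm⟩
  have hθ : ∀ j k p y, (θ j k).1 p y = w p (Function.update (fun i => (v j i).1 p) k y) :=
    fun _ _ _ _ => rfl
  have key : ∀ (p : M) (y : A p), y = ∑ jk : Fin N × Fin n,
      ((h jk.1).1 p * (F (v jk.1)).1 p * (θ jk.1 jk.2).1 p y) • (v jk.1 jk.2).1 p := by
    intro p y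
    have : Module.Finite 𝕜 (A p) := Module.Finite.equiv
      ((trivializationAt (Fin n → 𝕜) A p).linearEquivAt 𝕜 p
        (FiberBundle.mem_baseSet_trivializationAt' p)).symm
    rw [Fintype.sum_prod_type]
    conv_lhs => rw [← one_smul 𝕜 y, ← hsum p, Finset.sum_smul]
    refine Finset.sum_congr rfl fun j _ => ?_
    rw [mul_smul, smul_eq_sum_update (finrank_fibre p) (w p), Finset.smul_sum]
    refine Finset.sum_congr rfl fun k _ => ?_
    rw [smul_smul, hθ, ← hw, mul_assoc]
  refine ⟨Fin N × Fin n, inferInstance, fun jk => v jk.1 jk.2,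
    fun jk => (h jk.1 * F (v jk.1)) • θ jk.1 jk.2, fun x => ?_, fun η => ?_⟩
  · refine Subtype.ext (funext fun p => (key p (x.1 p)).trans ?_)
    exact (map_sum (secAt (𝕜 := 𝕜) (m := m) (n := n) (A := A) p)
      (fun jk : Fin N × Fin n => duality 𝕜 m n M A x ((h jk.1 * F (v jk.1)) • θ jk.1 jk.2) • v jk.1 jk.2)
      Finset.univ).symm
  · refine Subtype.ext (funext fun p => LinearMap.ext fun y => ?_)
    refine (congrArg (η.1 p) (key p y)).trans ((map_sum (η.1 p) _ _).trans ?_)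
    refine Eq.trans ?_ (DFunLike.congr_fun (map_sum (dualSecAt p) _ _).symm y)
    rw [LinearMap.sum_apply]
    refine Finset.sum_congr rfl fun jk _ => ?_
    rw [map_smul]
    exact mul_comm _ _

theorem differential_isDifferential (𝔞 : LieAlgebroid 𝕜 (Fn 𝕜 m M) (Sec 𝕜 m n M A))
    (𝔟 : LieAlgebroid 𝕜 (Fn 𝕜 m M) (DualSec 𝕜 m n M A))
    (Ω : ExteriorAlgebra (Fn 𝕜 m M) (DualSec 𝕜 m n M A))
    (V : ExteriorAlgebra (Fn 𝕜 m M) (Sec 𝕜 m n M A)) (hV : V ∈ ⋀[Fn 𝕜 m M]^n (Sec 𝕜 m n M A))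
    (hΩV : pair (duality 𝕜 m n M A) V Ω = 1) :
    IsDifferential 𝔞 (duality 𝕜 m n M A) (differential 𝔞 (duality 𝕜 m n M A)) ∧
      IsDifferential 𝔟 (duality 𝕜 m n M A).flip (differential 𝔟 (duality 𝕜 m n M A).flip) := by
  have h := hasDualBasis_duality Ω V hV hΩV
  refine ⟨differential_spec 𝔞 _ h, differential_spec 𝔟 _ ?_⟩
  obtain ⟨J, hJ, e, ε, he, hε⟩ := h
  exact ⟨J, hJ, ε, e, hε, he⟩

end Fibres

end LieAlgebroidPair

end

open LieAlgebroidPair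
open scoped Manifold ContDiff

/-!
The operator `∂` generates the Schouten bracket, `∂(uv) = (∂u)v + (-1)^k u ∂v + (-1)^k [u, v]` for
`u` of degree `k`, and `d_*` is a derivation of the exterior product. Hence the failure of
`Δ = d_* ∂ + ∂ d_*` to be a derivation is exactly the failure of `d_*` to be a derivation of the
bracket. Moreover `Ω^♯` intertwines `Δ` with `Δ_*`, and `Δ V = 0`.

A derivation is determined by its values on functions and sections, and compatibility of `Δ` and
`Δ_*` with the pairing makes `½(L_{X₀} + L_{ξ₀})` the only candidate: `Δ` of a section is expressed
by divergences, and these are compared by taking the coefficient of the volume form `s` in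
`L_{[X, Y]} s = L_X L_Y s - L_Y L_X s` on the base. Conversely, if `Δ` is half of
`L_{X₀} + L_{ξ₀}`, then `Δ V = 0` shows that this derivation kills `V` and so commutes with `Ω^♯`,
which carries the formula over to `Δ_*`.

The trace of a linear endomorphism of sections is read off from its action on `Ω` as a derivation of
the exterior algebra. For `L_{u ∘ θ} - [L_u, L_θ]` this action is computed by divergences as well,
which ties the trace condition to the pairing condition.

All this takes place for modules in duality over a commutative algebra. The bundles enter only
through a finite dual basis of sections: although no global frame need exist, Cramer's rule writes
`Ω(v₁, …, vₙ)² x` as a combination of the `vᵢ`, and these functions generate the unit ideal.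
-/

noncomputable section

namespace LieAlgebroidPair

open ExteriorAlgebra (ι algebraMapInv ιInv)

section Contractions

variable {R L L' : Type*} [CommRing R] [AddCommGroup L] [Module R L] [AddCommGroup L'] [Module R L']

theorem homogeneous_induction {p : ExteriorAlgebra R L → Prop}
    (homogeneous : ∀ k, ∀ u ∈ ⋀[R]^k L, p u) (add : ∀ u v, p u → p v → p (u + v))
    (u : ExteriorAlgebra R L) : p u := by
  classical
  exact DirectSum.Decomposition.inductionOn (fun k : ℕ => ⋀[R]^k L)
    (homogeneous 0 0 (Submodule.zero_mem _)) (fun {k} w => homogeneous k w w.2) add u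

@[elab_as_elim]
theorem left_induction {p : ExteriorAlgebra R L → Prop}
    (algebraMap : ∀ r, p (algebraMap R _ r)) (add : ∀ u v, p u → p v → p (u + v))
    (ι_mul : ∀ u x, p u → p (ι R x * u)) (u : ExteriorAlgebra R L) : p u :=
  CliffordAlgebra.left_induction (Q := 0) algebraMap add ι_mul u

@[elab_as_elim]
theorem right_induction {p : ExteriorAlgebra R L → Prop}
    (algebraMap : ∀ r, p (algebraMap R _ r)) (add : ∀ u v, p u → p v → p (u + v))
    (mul_ι : ∀ x u, p u → p (u * ι R x)) (u : ExteriorAlgebra R L) : p u :=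
  CliffordAlgebra.right_induction (Q := 0) algebraMap add mul_ι u

theorem algebraMap_mem (r : R) : algebraMap R (ExteriorAlgebra R L) r ∈ ⋀[R]^0 L :=
  SetLike.algebraMap_mem_graded (fun k : ℕ => ⋀[R]^k L) r

theorem ι_mem (x : L) : ι R x ∈ ⋀[R]^1 L := by
  rw [ExteriorAlgebra.exteriorPower, pow_one]
  exact ⟨x, rfl⟩

theorem exists_eq_algebraMap {u : ExteriorAlgebra R L} (hu : u ∈ ⋀[R]^0 L) :
    ∃ r, u = algebraMap R _ r := by
  rw [ExteriorAlgebra.exteriorPower, pow_zero, Submodule.mem_one] at hu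
  exact hu.imp fun _ => Eq.symm

theorem exists_eq_ι {u : ExteriorAlgebra R L} (hu : u ∈ ⋀[R]^1 L) : ∃ x, u = ι R x := by
  rw [ExteriorAlgebra.exteriorPower, pow_one] at hu
  exact hu.imp fun _ => Eq.symm

theorem mul_mem {k l : ℕ} {u v : ExteriorAlgebra R L} (hu : u ∈ ⋀[R]^k L)
    (hv : v ∈ ⋀[R]^l L) : u * v ∈ ⋀[R]^(k + l) L :=
  SetLike.mul_mem_graded (A := fun k : ℕ => ⋀[R]^k L) hu hv

theorem ι_mul_mem {k : ℕ} {u : ExteriorAlgebra R L} (x : L) (hu : u ∈ ⋀[R]^k L) :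
    ι R x * u ∈ ⋀[R]^(k + 1) L :=
  add_comm 1 k ▸ mul_mem (ι_mem x) hu

theorem mul_ι_eq (w : ExteriorAlgebra R L) (x : L) : w * ι R x = ι R x * parity w := by
  rw [ι_mul_eq, CliffordAlgebra.involute_involute]

/-- The degree `k - 1` is truncated: a function contracts to zero, which has degree zero. -/
theorem contract_mem (φ : Module.Dual R L) {k : ℕ} {a : ExteriorAlgebra R L}
    (ha : a ∈ ⋀[R]^k L) : contract φ a ∈ ⋀[R]^(k - 1) L := by
  induction ha using Submodule.pow_induction_on_left' with
  | algebraMap r => exact contract_algebraMap φ r ▸ Submodule.zero_mem _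
  | add x y i _ _ ihx ihy => exact map_add (contract φ) x y ▸ Submodule.add_mem _ ihx ihy
  | mem_mul m hm i x hx ih =>
    obtain ⟨y, rfl⟩ := hm
    rw [contract_ι_mul]
    refine Submodule.sub_mem _ (Submodule.smul_mem _ _ hx) ?_
    rcases i with _ | i
    · obtain ⟨r, rfl⟩ := exists_eq_algebraMap hx
      exact contract_algebraMap φ r ▸ (mul_zero (ι R y)).symm ▸ Submodule.zero_mem _
    · exact ι_mul_mem y ih

variable (B : L →ₗ[R] L' →ₗ[R] R)

theorem interior_algebraMap (r : R) (w : ExteriorAlgebra R L') :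
    interior B (algebraMap R _ r) w = r • w := by
  simp only [interior, AlgHom.commutes]
  rfl

theorem interior_add (U W : ExteriorAlgebra R L) (w : ExteriorAlgebra R L') :
    interior B (U + W) w = interior B U w + interior B W w := by
  simp [interior]

theorem interior_zero (w : ExteriorAlgebra R L') : interior B 0 w = 0 := by
  simp [interior]

theorem interior_neg (U : ExteriorAlgebra R L) (w : ExteriorAlgebra R L') :
    interior B (-U) w = -interior B U w := by
  simp [interior]

theorem interior_smul (r : R) (U : ExteriorAlgebra R L) (w : ExteriorAlgebra R L') :
    interior B (r • U) w = r • interior B U w := by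
  simp [interior]

theorem interior_ι_mul (x : L) (U : ExteriorAlgebra R L) (w : ExteriorAlgebra R L') :
    interior B (ι R x * U) w = interior B U (contract (B x) w) := by
  rw [interior_mul, interior_ι]

theorem interior_mul_ι (x : L) (U : ExteriorAlgebra R L) (w : ExteriorAlgebra R L') :
    interior B (U * ι R x) w = contract (B x) (interior B U w) := by
  rw [interior_mul, interior_ι]

theorem parity_interior (U : ExteriorAlgebra R L) (w : ExteriorAlgebra R L') :
    parity (interior B U w) = interior B (parity U) (parity w) := by
  induction U using ExteriorAlgebra.induction generalizing w with
  | algebraMap r => rw [interior_algebraMap, map_smul, AlgHom.commutes, interior_algebraMap]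
  | ι x => rw [interior_ι, parity_contract, parity_ι, interior_neg, interior_ι]
  | mul a b ha hb => rw [interior_mul, hb, ha, map_mul, interior_mul]
  | add a b ha hb => rw [interior_add, map_add, ha, hb, map_add, interior_add]

theorem interior_mem {k l : ℕ} {U : ExteriorAlgebra R L} {w : ExteriorAlgebra R L'}
    (hU : U ∈ ⋀[R]^k L) (hw : w ∈ ⋀[R]^l L') : interior B U w ∈ ⋀[R]^(l - k) L' := by
  induction hU using Submodule.pow_induction_on_left' generalizing l w with
  | algebraMap r => exact interior_algebraMap B r w ▸ Submodule.smul_mem _ _ hw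
  | add x y i _ _ ihx ihy =>
    exact interior_add B x y w ▸ Submodule.add_mem _ (ihx hw) (ihy hw)
  | mem_mul m hm i x _ ih =>
    obtain ⟨y, rfl⟩ := hm
    rw [interior_ι_mul, Nat.succ_eq_add_one, Nat.add_comm, ← Nat.sub_sub]
    exact ih (contract_mem _ hw)

theorem algebraMapInv_ι_mul (θ : L') (w : ExteriorAlgebra R L') :
    algebraMapInv (ι R θ * w) = 0 := by
  simp [ExteriorAlgebra.algebraMapInv]

theorem pair_algebraMap (r : R) (w : ExteriorAlgebra R L') :
    pair B (algebraMap R _ r) w = r * algebraMapInv w := by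
  rw [pair, interior_algebraMap, map_smul, smul_eq_mul]

theorem pair_add_left (U W : ExteriorAlgebra R L) (w : ExteriorAlgebra R L') :
    pair B (U + W) w = pair B U w + pair B W w := by
  rw [pair, interior_add, map_add, pair, pair]

theorem pair_ι_mul (x : L) (U : ExteriorAlgebra R L) (w : ExteriorAlgebra R L') :
    pair B (ι R x * U) w = pair B U (contract (B x) w) := by
  rw [pair, interior_ι_mul, pair]

theorem pair_flip_ι_mul (x : L) (U : ExteriorAlgebra R L) (w : ExteriorAlgebra R L') :
    pair B.flip w (ι R x * U) = pair B.flip (contract (B x) w) U := by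
  induction w using left_induction generalizing U with
  | algebraMap r =>
    rw [pair_algebraMap, algebraMapInv_ι_mul, contract_algebraMap, mul_zero, pair, interior_zero,
      map_zero]
  | add a b ha hb => rw [map_add, pair_add_left, pair_add_left, ha, hb]
  | ι_mul a θ ha =>
    rw [pair_ι_mul, contract_ι_mul, contract_ι_mul, LinearMap.flip_apply, sub_eq_add_neg,
      sub_eq_add_neg, pair_add, pair_add_left, ← neg_one_smul R (ι R x * _), pair_smul, pair_smul,
      ha, ← pair_ι_mul]
    simp [pair, interior_smul, interior_neg]

theorem pair_one (U : ExteriorAlgebra R L) : pair B U 1 = algebraMapInv U := by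
  induction U using left_induction with
  | algebraMap r =>
    rw [pair_algebraMap, map_one, mul_one, AlgHom.commutes, Algebra.algebraMap_self_apply]
  | add a b ha hb => rw [pair_add_left, map_add, ha, hb]
  | ι_mul a x _ =>
    rw [pair_ι_mul, algebraMapInv_ι_mul, ← map_one (algebraMap R _), contract_algebraMap, pair,
      map_zero, map_zero]

theorem pair_flip (U : ExteriorAlgebra R L) (w : ExteriorAlgebra R L') :
    pair B.flip w U = pair B U w := by
  induction U using left_induction generalizing w with
  | algebraMap r =>
    rw [pair_algebraMap, Algebra.algebraMap_eq_smul_one, pair_smul, pair_one]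
  | add a b ha hb => rw [pair_add, pair_add_left, ha, hb]
  | ι_mul a x ha => rw [pair_flip_ι_mul, pair_ι_mul, ha]

theorem interior_eq_pair {k : ℕ} {U : ExteriorAlgebra R L} {w : ExteriorAlgebra R L'}
    (hU : U ∈ ⋀[R]^k L) (hw : w ∈ ⋀[R]^k L') : interior B U w = algebraMap R _ (pair B U w) := by
  obtain ⟨r, hr⟩ := exists_eq_algebraMap (Nat.sub_self k ▸ interior_mem B hU hw)
  rw [pair, hr, AlgHom.commutes, Algebra.algebraMap_self_apply]

end Contractions

section Derivations

variable {R L L' : Type*} [CommRing R] [AddCommGroup L] [Module R L] [AddCommGroup L'] [Module R L']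

/-- `D` is a derivation of degree zero of the exterior algebra of `L` that acts on the functions
`R` by `Y`. -/
structure IsDerivationOver (Y : R → R) (D : ExteriorAlgebra R L →+ ExteriorAlgebra R L) :
    Prop where
  map_algebraMap : ∀ f, D (algebraMap R _ f) = algebraMap R _ (Y f)
  map_mul : ∀ a b, D (a * b) = D a * b + a * D b
  map_ι_mem : ∀ x, D (ι R x) ∈ ⋀[R]^1 L

namespace IsDerivationOver

variable {Y Y₂ : R → R} {D D₂ : ExteriorAlgebra R L →+ ExteriorAlgebra R L}

theorem ext (h : IsDerivationOver Y D) (h₂ : IsDerivationOver Y₂ D₂) (hY : Y = Y₂)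
    (hι : ∀ x, D (ι R x) = D₂ (ι R x)) : D = D₂ :=
  twisted_derivation_ext (AlgHom.id R _)
    (fun f => by rw [h.map_algebraMap, h₂.map_algebraMap, hY]) hι
    (fun a b => (h.map_mul a b).trans (add_comm _ _))
    fun a b => (h₂.map_mul a b).trans (add_comm _ _)

theorem add (h : IsDerivationOver Y D) (h₂ : IsDerivationOver Y₂ D₂) :
    IsDerivationOver (fun f => Y f + Y₂ f) (D + D₂) where
  map_algebraMap f := by simp [h.map_algebraMap, h₂.map_algebraMap]
  map_mul a b := by
    simp only [AddMonoidHom.add_apply, h.map_mul, h₂.map_mul]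
    noncomm_ring
  map_ι_mem x := Submodule.add_mem _ (h.map_ι_mem x) (h₂.map_ι_mem x)

theorem sub (h : IsDerivationOver Y D) (h₂ : IsDerivationOver Y₂ D₂) :
    IsDerivationOver (fun f => Y f - Y₂ f) (D - D₂) where
  map_algebraMap f := by simp [h.map_algebraMap, h₂.map_algebraMap]
  map_mul a b := by
    simp only [AddMonoidHom.sub_apply, h.map_mul, h₂.map_mul]
    noncomm_ring
  map_ι_mem x := Submodule.sub_mem _ (h.map_ι_mem x) (h₂.map_ι_mem x)

variable (h : IsDerivationOver Y D)
include h

theorem map_smul (f : R) (a : ExteriorAlgebra R L) : D (f • a) = Y f • a + f • D a := by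
  rw [Algebra.smul_def, h.map_mul, h.map_algebraMap, ← Algebra.smul_def, ← Algebra.smul_def]

theorem map_mem {k : ℕ} {a : ExteriorAlgebra R L} (ha : a ∈ ⋀[R]^k L) : D a ∈ ⋀[R]^k L := by
  induction ha using Submodule.pow_induction_on_left' with
  | algebraMap r => exact h.map_algebraMap r ▸ algebraMap_mem _
  | add x y i _ _ ihx ihy => exact map_add D x y ▸ Submodule.add_mem _ ihx ihy
  | mem_mul m hm i x hx ih =>
    obtain ⟨y, rfl⟩ := hm
    rw [h.map_mul, Nat.succ_eq_add_one, add_comm i]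
    exact Submodule.add_mem _ (mul_mem (h.map_ι_mem y) hx) (mul_mem (ι_mem y) ih)

theorem commutator (h₂ : IsDerivationOver Y₂ D₂) :
    IsDerivationOver (fun f => Y (Y₂ f) - Y₂ (Y f)) (D.comp D₂ - D₂.comp D) where
  map_algebraMap f := by
    simp only [AddMonoidHom.sub_apply, AddMonoidHom.comp_apply, h.map_algebraMap,
      h₂.map_algebraMap, map_sub]
  map_mul a b := by
    simp only [AddMonoidHom.sub_apply, AddMonoidHom.comp_apply, h.map_mul, h₂.map_mul, map_add]
    noncomm_ring
  map_ι_mem x := Submodule.sub_mem _ (h.map_mem (h₂.map_ι_mem x)) (h₂.map_mem (h.map_ι_mem x))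

theorem exists_linearMap (hY : ∀ f, Y f = 0) :
    ∃ T : L →ₗ[R] L, ∀ x, ι R (T x) = D (ι R x) := by
  choose T hT using fun x => exists_eq_ι (h.map_ι_mem x)
  refine ⟨⟨⟨T, fun x y => ?_⟩, fun f x => ?_⟩, fun x => (hT x).symm⟩ <;>
    apply (ExteriorAlgebra.ι_inj R _ _).mp
  · rw [map_add, ← hT, ← hT, ← hT, map_add, map_add]
  · change ι R (T (f • x)) = ι R (f • T x)
    rw [← hT, LinearMap.map_smul, h.map_smul, hY, zero_smul, zero_add, hT, LinearMap.map_smul]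

theorem apply_eq_sum {B : L' →ₗ[R] L →ₗ[R] R} (hY : ∀ f, Y f = 0) {T : L →ₗ[R] L}
    (hT : ∀ x, ι R (T x) = D (ι R x)) {J : Type*} [Fintype J] {ε : J → L'} {e : J → L}
    (he : ∀ x, x = ∑ i, B (ε i) x • e i) (w : ExteriorAlgebra R L) :
    D w = ∑ i, ι R (T (e i)) * contract (B (ε i)) w := by
  induction w using left_induction with
  | algebraMap r =>
    simp only [h.map_algebraMap, hY, map_zero, contract_algebraMap, mul_zero,
      Finset.sum_const_zero]
  | add a b ha hb => simp only [map_add, ha, hb, mul_add, Finset.sum_add_distrib]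
  | ι_mul a x ha =>
    have hx : ι R (T x) = ∑ i, B (ε i) x • ι R (T (e i)) := by
      conv_lhs => rw [he x]
      simp only [map_sum, LinearMap.map_smul]
    rw [h.map_mul, ← hT, hx, ha, Finset.sum_mul, Finset.mul_sum, ← Finset.sum_add_distrib]
    refine Finset.sum_congr rfl fun i _ => ?_
    rw [contract_ι_mul, mul_sub, mul_smul_comm, smul_mul_assoc, ← mul_assoc, ← mul_assoc,
      mul_ι_eq (ι R x), parity_ι, mul_neg, neg_mul, sub_eq_add_neg]

end IsDerivationOver

/-- Derivations of degree zero of the exterior algebras of `L` and `L'` that are dual to each other: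
both act on functions by `Y`, and the pairing `B` is invariant. -/
structure IsDualDerivation (B : L →ₗ[R] L' →ₗ[R] R) (Y : R → R)
    (D : ExteriorAlgebra R L →+ ExteriorAlgebra R L)
    (D' : ExteriorAlgebra R L' →+ ExteriorAlgebra R L') : Prop where
  left : IsDerivationOver Y D
  right : IsDerivationOver Y D'
  pairing : ∀ x θ, pair B (D (ι R x)) (ι R θ) + pair B (ι R x) (D' (ι R θ)) = Y (B x θ)

namespace IsDualDerivation

variable {B : L →ₗ[R] L' →ₗ[R] R} {Y : R → R} {D : ExteriorAlgebra R L →+ ExteriorAlgebra R L}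
  {D' : ExteriorAlgebra R L' →+ ExteriorAlgebra R L'} (h : IsDualDerivation B Y D D')

include h

theorem flip : IsDualDerivation B.flip Y D' D where
  left := h.right
  right := h.left
  pairing θ x := by rw [pair_flip, pair_flip, add_comm, h.pairing, LinearMap.flip_apply]

theorem apply_contract (x : L) (w : ExteriorAlgebra R L') :
    D' (contract (B x) w) = interior B (D (ι R x)) w + contract (B x) (D' w) := by
  obtain ⟨y, hy⟩ := exists_eq_ι (h.left.map_ι_mem x)
  rw [hy, interior_ι]
  induction w using left_induction with
  | algebraMap r => simp only [h.right.map_algebraMap, contract_algebraMap, map_zero, add_zero]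
  | add a b ha hb => simp only [map_add, ha, hb]; abel
  | ι_mul a θ ha =>
    obtain ⟨η, hη⟩ := exists_eq_ι (h.right.map_ι_mem θ)
    have hY : B y θ + B x η = Y (B x θ) := by
      rw [← h.pairing, hy, hη, pair_ι_ι, pair_ι_ι]
    simp only [contract_ι_mul, h.right.map_mul, hη, map_sub, map_add, h.right.map_smul, ha, ← hY]
    rw [add_smul, mul_add]
    abel

theorem apply_interior (U : ExteriorAlgebra R L) (w : ExteriorAlgebra R L') :
    D' (interior B U w) = interior B (D U) w + interior B U (D' w) := by
  induction U using ExteriorAlgebra.induction generalizing w with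
  | algebraMap r =>
    simp only [interior_algebraMap, h.left.map_algebraMap, h.right.map_smul]
  | ι x => rw [interior_ι, h.apply_contract]
  | mul a b ha hb => simp only [interior_mul, hb, ha, h.left.map_mul, interior_add, map_add]; abel
  | add a b ha hb => simp only [interior_add, map_add, ha, hb]; abel

theorem add {Y₂ : R → R} {D₂ : ExteriorAlgebra R L →+ ExteriorAlgebra R L}
    {D₂' : ExteriorAlgebra R L' →+ ExteriorAlgebra R L'} (h₂ : IsDualDerivation B Y₂ D₂ D₂') :
    IsDualDerivation B (fun f => Y f + Y₂ f) (D + D₂) (D' + D₂') where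
  left := h.left.add h₂.left
  right := h.right.add h₂.right
  pairing x θ := by
    rw [← h.pairing, ← h₂.pairing, AddMonoidHom.add_apply, AddMonoidHom.add_apply, pair_add,
      pair_add_left]
    ring

end IsDualDerivation

end Derivations

section Cartan

variable {𝕜 R L L' : Type*} [Field 𝕜] [CommRing R] [Algebra 𝕜 R]
  [AddCommGroup L] [Module R L] [AddCommGroup L'] [Module R L']
  {𝔞 : LieAlgebroid 𝕜 R L} {B : L →ₗ[R] L' →ₗ[R] R}

namespace IsDifferential

variable {D : ExteriorAlgebra R L' →+ ExteriorAlgebra R L'} (hD : IsDifferential 𝔞 B D)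

include hD

theorem map_mul (a b : ExteriorAlgebra R L') : D (a * b) = D a * b + parity a * D b := by
  induction a using homogeneous_induction with
  | homogeneous k u hu => rw [hD.derivation k u hu, parity_of_mem hu, smul_mul_assoc]
  | add u v hu hv => simp only [add_mul, map_add, hu, hv]; abel

theorem map_smul (f : R) (a : ExteriorAlgebra R L') :
    D (f • a) = D (algebraMap R _ f) * a + f • D a := by
  rw [Algebra.smul_def, hD.map_mul, AlgHom.commutes, ← Algebra.smul_def]

theorem map_one : D 1 = 0 := by
  have h := hD.map_mul 1 1
  rwa [_root_.map_one parity, mul_one, mul_one, one_mul, left_eq_add] at h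

theorem map_mem {k : ℕ} {a : ExteriorAlgebra R L'} (ha : a ∈ ⋀[R]^k L') :
    D a ∈ ⋀[R]^(k + 1) L' := by
  induction ha using Submodule.pow_induction_on_left' with
  | algebraMap r => exact hD.degree_fun r
  | add x y i _ _ ihx ihy => exact map_add D x y ▸ Submodule.add_mem _ ihx ihy
  | mem_mul m hm i x hx ih =>
    obtain ⟨y, rfl⟩ := hm
    rw [hD.map_mul, parity_ι, neg_mul]
    refine Submodule.add_mem _ ?_ (Submodule.neg_mem _ (ι_mul_mem y ih))
    exact add_comm 2 i ▸ mul_mem (hD.degree_section y) hx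

theorem parity_apply (a : ExteriorAlgebra R L') : parity (D a) = -D (parity a) := by
  induction a using homogeneous_induction with
  | homogeneous k u hu =>
    rw [parity_of_mem (hD.map_mem hu), parity_of_mem hu]
    rcases Nat.even_or_odd k with hk | hk <;> simp [hk.neg_one_pow, hk.add_one.neg_one_pow]
  | add u v hu hv => simp only [map_add, hu, hv]; abel

end IsDifferential

theorem mul_comm_of_mem {k l : ℕ} {u v : ExteriorAlgebra R L} (hu : u ∈ ⋀[R]^k L)
    (hv : v ∈ ⋀[R]^l L) : v * u = (-1 : R) ^ (k * l) • (u * v) := by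
  have hu' := parity_of_mem hu
  rcases Nat.even_or_odd k with hk | hk
  · rw [hk.neg_one_pow, one_smul] at hu'
    rw [even_mul_comm hu', (hk.mul_right l).neg_one_pow, one_smul]
  · rw [hk.neg_one_pow, neg_smul, one_smul] at hu'
    rw [← odd_mul_comm hu', parity_of_mem hv, smul_mul_assoc, smul_smul, pow_mul, hk.neg_one_pow,
      ← mul_pow, neg_one_mul, neg_neg, one_pow, one_smul]

variable [CharZero 𝕜]

variable (𝔞) in
theorem schouten_ι_mul (x : L) (a b : ExteriorAlgebra R L) :
    schouten 𝔞 (ι R x) (a * b) = schouten 𝔞 (ι R x) a * b + a * schouten 𝔞 (ι R x) b := by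
  induction a using homogeneous_induction with
  | homogeneous k u hu =>
    rw [(schouten_spec 𝔞).leibniz 1 k _ (ι_mem x) u hu, pow_mul, one_add_one_eq_two,
      neg_one_sq, one_pow, one_smul]
  | add u v hu hv => simp only [add_mul, map_add, hu, hv]; abel

variable (𝔞) in
theorem lieMulti_isDerivationOver (x : L) : IsDerivationOver (𝔞.anchor x) (lieMulti 𝔞 x) where
  map_algebraMap := (schouten_spec 𝔞).section_fun x
  map_mul := schouten_ι_mul 𝔞 x
  map_ι_mem y := by
    rw [lieMulti, (schouten_spec 𝔞).section_section]
    exact ι_mem _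

variable (𝔞) in
theorem schouten_algebraMap (f : R) (a : ExteriorAlgebra R L) :
    schouten 𝔞 (algebraMap R _ f) a = -contract (anchorDual 𝔞 f) a := by
  refine DFunLike.congr_fun (show schouten 𝔞 (algebraMap R _ f) =
    -(contract (anchorDual 𝔞 f)).toAddMonoidHom from ?_) a
  refine twisted_derivation_ext parity (fun g => ?_) (fun z => ?_) (fun a b => ?_) (fun a b => ?_)
  · simp [(schouten_spec 𝔞).fun_fun]
  · rw [(schouten_spec 𝔞).skew 0 1 _ (algebraMap_mem f) _ (ι_mem z),
      (schouten_spec 𝔞).section_fun]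
    simp [anchorDual_apply]
  · induction a using homogeneous_induction with
    | homogeneous k u hu =>
      rw [(schouten_spec 𝔞).leibniz 0 k _ (algebraMap_mem f) u hu, parity_of_mem hu, zero_add,
        one_mul, smul_mul_assoc, add_comm]
    | add u v hu hv => simp only [add_mul, map_add, hu, hv]; abel
  · simp only [AddMonoidHom.neg_apply, LinearMap.toAddMonoidHom_coe, contract_mul]
    noncomm_ring

variable (𝔞) in
theorem schouten_mul_left (x : L) (c b : ExteriorAlgebra R L) :
    schouten 𝔞 (ι R x * c) b =
      ι R x * schouten 𝔞 c b + parity c * schouten 𝔞 (ι R x) b := by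
  have S := schouten_spec 𝔞
  induction c using homogeneous_induction with
  | homogeneous i c hc =>
    induction b using homogeneous_induction with
    | homogeneous l b hb =>
      have hcomm : schouten 𝔞 (ι R x) b * c = (-1 : R) ^ (i * l) • (c * schouten 𝔞 (ι R x) b) :=
        mul_comm_of_mem hc ((lieMulti_isDerivationOver 𝔞 x).map_mem hb)
      rw [S.skew (i + 1) l _ (ι_mul_mem x hc) b hb, S.leibniz l 1 b hb _ (ι_mem x),
        S.skew l 1 b hb _ (ι_mem x), S.skew l i b hb c hc, parity_of_mem hc, neg_mul,
        smul_mul_assoc, hcomm]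
      rcases Nat.even_or_odd i with hi | hi <;> rcases Nat.even_or_odd l with hl | hl <;>
      simp [hi, hl, pow_mul, pow_add]
    | add u v hu hv => simp only [map_add, hu, hv, mul_add]; abel
  | add u v hu hv =>
    simp only [mul_add, map_add, AddMonoidHom.add_apply, hu, hv, add_mul]; abel

variable (𝔞 B) in
/-- The differential `df` of a function, as a section of `A*`. -/
def differentialFun (f : R) : L' := ιInv (differential 𝔞 B (algebraMap R _ f))

variable (𝔞 B) in
/-- The Lie derivative `L_x θ` of a section `θ` of `A*`, as a section of `A*`. -/
def lieSection (x : L) (θ : L') : L' := ιInv (lieForm 𝔞 B x (ι R θ))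

variable (𝔞 B) in
/-- The contraction `i_x dθ`, as a section of `A*`. -/
def interiorDifferential (x : L) (θ : L') : L' :=
  ιInv (contract (B x) (differential 𝔞 B (ι R θ)))

theorem ι_ιInv {u : ExteriorAlgebra R L} (hu : u ∈ ⋀[R]^1 L) : ι R (ιInv u) = u := by
  obtain ⟨x, rfl⟩ := exists_eq_ι hu
  rw [ExteriorAlgebra.ι_leftInverse x]

theorem algebraMap_algebraMapInv {u : ExteriorAlgebra R L} (hu : u ∈ ⋀[R]^0 L) :
    algebraMap R _ (algebraMapInv u) = u := by
  obtain ⟨x, rfl⟩ := exists_eq_algebraMap hu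
  rw [ExteriorAlgebra.algebraMap_leftInverse]

theorem algebraMap_inj {f g : R} :
    algebraMap R (ExteriorAlgebra R L) f = algebraMap R _ g ↔ f = g :=
  (ExteriorAlgebra.algebraMap_leftInverse L).injective.eq_iff

namespace HasDualBasis

theorem flip (hB : HasDualBasis B) : HasDualBasis B.flip := by
  obtain ⟨J, hJ, e, ε, he, hε⟩ := hB
  exact ⟨J, hJ, ε, e, hε, he⟩

theorem ext_right (hB : HasDualBasis B) {θ η : L'} (h : ∀ x, B x θ = B x η) : θ = η := by
  obtain ⟨J, hJ, e, ε, -, hε⟩ := hB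
  rw [hε θ, hε η]
  simp only [h]

variable (hB : HasDualBasis B) (𝔞)

include hB

theorem differential_algebraMap (f : R) :
    differential 𝔞 B (algebraMap R _ f) = ι R (differentialFun 𝔞 B f) :=
  (ι_ιInv ((differential_spec 𝔞 B hB).degree_fun f)).symm

theorem pair_differentialFun (x : L) (f : R) : B x (differentialFun 𝔞 B f) = 𝔞.anchor x f := by
  rw [← (differential_spec 𝔞 B hB).eval_fun, hB.differential_algebraMap, pair_ι_ι]

theorem lieForm_isDerivationOver (x : L) :
    IsDerivationOver (𝔞.anchor x) (lieForm 𝔞 B x) where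
  map_algebraMap f := by
    change contract (B x) (differential 𝔞 B _) + differential 𝔞 B (contract (B x) _) = _
    rw [hB.differential_algebraMap, contract_ι, hB.pair_differentialFun, contract_algebraMap,
      map_zero, add_zero]
  map_mul a b := by
    have hD := differential_spec 𝔞 B hB
    change contract (B x) (differential 𝔞 B _) + differential 𝔞 B (contract (B x) _) =
      (contract (B x) (differential 𝔞 B _) + differential 𝔞 B (contract (B x) _)) * b +
      a * (contract (B x) (differential 𝔞 B _) + differential 𝔞 B (contract (B x) _))
    simp only [hD.map_mul, contract_mul, map_add, parity_contract, hD.parity_apply,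
      CliffordAlgebra.involute_involute]
    noncomm_ring
  map_ι_mem θ := by
    have hD := differential_spec 𝔞 B hB
    refine Submodule.add_mem _ (contract_mem _ (hD.degree_section θ)) ?_
    change differential 𝔞 B (contract (B x) (ι R θ)) ∈ _
    rw [contract_ι]
    exact hD.degree_fun _

theorem lie_isDualDerivation (x : L) :
    IsDualDerivation B (𝔞.anchor x) (lieMulti 𝔞 x) (lieForm 𝔞 B x) where
  left := lieMulti_isDerivationOver 𝔞 x
  right := hB.lieForm_isDerivationOver 𝔞 x
  pairing y θ := by
    have hD := differential_spec 𝔞 B hB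
    have h : pair B (ι R y) (contract (B x) (differential 𝔞 B (ι R θ))) =
        𝔞.anchor x (B y θ) - 𝔞.anchor y (B x θ) - B (𝔞.bracket x y) θ := by
      rw [← pair_ι_mul, hD.eval_section]
    change _ + pair B _ (contract (B x) (differential 𝔞 B (ι R θ)) +
      differential 𝔞 B (contract (B x) (ι R θ))) = _
    rw [pair_add, h, lieMulti, (schouten_spec 𝔞).section_section, pair_ι_ι, contract_ι,
      hD.eval_fun]
    ring

theorem lieForm_ι (x : L) (θ : L') : lieForm 𝔞 B x (ι R θ) = ι R (lieSection 𝔞 B x θ) :=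
  (ι_ιInv ((hB.lieForm_isDerivationOver 𝔞 x).map_ι_mem θ)).symm

theorem pair_lieSection (x y : L) (θ : L') :
    B y (lieSection 𝔞 B x θ) = 𝔞.anchor x (B y θ) - B (𝔞.bracket x y) θ := by
  rw [← (hB.lie_isDualDerivation 𝔞 x).pairing y θ, hB.lieForm_ι, lieMulti,
    (schouten_spec 𝔞).section_section, pair_ι_ι, pair_ι_ι, add_sub_cancel_left]

theorem contract_differential_ι (x : L) (θ : L') :
    contract (B x) (differential 𝔞 B (ι R θ)) = ι R (interiorDifferential 𝔞 B x θ) :=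
  (ι_ιInv (contract_mem _ ((differential_spec 𝔞 B hB).degree_section θ))).symm

theorem lieSection_eq (x : L) (θ : L') :
    lieSection 𝔞 B x θ = interiorDifferential 𝔞 B x θ + differentialFun 𝔞 B (B x θ) := by
  apply (ExteriorAlgebra.ι_inj R _ _).mp
  rw [← hB.lieForm_ι, map_add, ← hB.contract_differential_ι, ← hB.differential_algebraMap,
    ← contract_ι]
  rfl

theorem differentialFun_mul (f g : R) :
    differentialFun 𝔞 B (f * g) = f • differentialFun 𝔞 B g + g • differentialFun 𝔞 B f :=
  hB.ext_right fun x => by simp [hB.pair_differentialFun]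

theorem lieSection_smul (x : L) (f : R) (θ : L') :
    lieSection 𝔞 B x (f • θ) = 𝔞.anchor x f • θ + f • lieSection 𝔞 B x θ :=
  hB.ext_right fun y => by simp [hB.pair_lieSection]; ring

theorem anchor_differentialFun_comm (𝔟 : LieAlgebroid 𝕜 R L') (f g : R) :
    𝔞.anchor (differentialFun 𝔟 B.flip f) g = 𝔟.anchor (differentialFun 𝔞 B g) f := by
  rw [← hB.pair_differentialFun, ← hB.flip.pair_differentialFun, LinearMap.flip_apply]

end HasDualBasis

end Cartan

section Sharp

variable {R L L' : Type*} [CommRing R] [AddCommGroup L] [Module R L]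
  [AddCommGroup L'] [Module R L']

section

variable (B : L →ₗ[R] L' →ₗ[R] R) (Ω : ExteriorAlgebra R L')

theorem sharp_algebraMap (r : R) : sharp B Ω (algebraMap R _ r) = r • Ω :=
  interior_algebraMap B r Ω

theorem sharp_add (u v : ExteriorAlgebra R L) :
    sharp B Ω (u + v) = sharp B Ω u + sharp B Ω v :=
  interior_add B u v Ω

theorem sharp_neg (u : ExteriorAlgebra R L) : sharp B Ω (-u) = -sharp B Ω u :=
  interior_neg B u Ω

theorem sharp_zero : sharp B Ω (0 : ExteriorAlgebra R L) = 0 :=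
  interior_zero B Ω

theorem sharp_smul (r : R) (u : ExteriorAlgebra R L) : sharp B Ω (r • u) = r • sharp B Ω u :=
  interior_smul B r u Ω

theorem sharp_mul_ι (u : ExteriorAlgebra R L) (x : L) :
    sharp B Ω (u * ι R x) = contract (B x) (sharp B Ω u) :=
  interior_mul_ι B x u Ω

end

/-- Dual nowhere vanishing top sections `Ω` and `V` of two dual bundles of rank `n`. -/
structure IsTopPair (B : L →ₗ[R] L' →ₗ[R] R) (n : ℕ)
    (Ω : ExteriorAlgebra R L') (V : ExteriorAlgebra R L) : Prop where
  dual : HasDualBasis B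
  form_mem : Ω ∈ ⋀[R]^n L'
  multi_mem : V ∈ ⋀[R]^n L
  pair_eq_one : pair B V Ω = 1
  multi_top : ∀ u ∈ ⋀[R]^(n + 1) L, u = 0
  form_top : ∀ u ∈ ⋀[R]^(n + 1) L', u = 0

namespace IsTopPair

variable {B : L →ₗ[R] L' →ₗ[R] R} {n : ℕ} {Ω : ExteriorAlgebra R L'} {V : ExteriorAlgebra R L}
  (h : IsTopPair B n Ω V)

include h

theorem flip : IsTopPair B.flip n V Ω where
  dual := h.dual.flip
  form_mem := h.multi_mem
  multi_mem := h.form_mem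
  pair_eq_one := by rw [pair_flip, h.pair_eq_one]
  multi_top := h.form_top
  form_top := h.multi_top

theorem ι_mul_form (θ : L') : ι R θ * Ω = 0 := h.form_top _ (ι_mul_mem θ h.form_mem)

theorem eq_zero_of_mem {k : ℕ} (hk : n < k) {u : ExteriorAlgebra R L} (hu : u ∈ ⋀[R]^k L) :
    u = 0 := by
  obtain ⟨j, rfl⟩ := Nat.exists_eq_add_of_lt hk
  have htop : (LinearMap.range (ι R : L →ₗ[R] _)) ^ (n + 1) = ⊥ :=
    (Submodule.eq_bot_iff _).mpr h.multi_top
  rwa [ExteriorAlgebra.exteriorPower, add_right_comm, pow_add, htop, Submodule.bot_mul,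
    Submodule.mem_bot] at hu

theorem ι_mul_sharp (θ : L') (U : ExteriorAlgebra R L) :
    ι R θ * sharp B Ω U = sharp B Ω (parity (contract (B.flip θ) U)) := by
  induction U using right_induction with
  | algebraMap r =>
    rw [sharp_algebraMap, mul_smul_comm, h.ι_mul_form, smul_zero, contract_algebraMap, map_zero,
      sharp_zero]
  | add a b ha hb => simp only [sharp_add, mul_add, map_add, ha, hb]
  | mul_ι x a ha =>
    have hcontract : ι R θ * contract (B x) (sharp B Ω a) =
        B x θ • sharp B Ω a - contract (B x) (ι R θ * sharp B Ω a) := by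
      rw [contract_ι_mul, sub_sub_cancel]
    rw [sharp_mul_ι, hcontract, ha, ← sharp_mul_ι, contract_mul, contract_ι, map_add, map_mul,
      map_mul, sharp_add, CliffordAlgebra.involute_involute, AlgHom.commutes, parity_ι, mul_neg,
      sharp_neg, ← Algebra.commutes, ← Algebra.smul_def, sharp_smul, LinearMap.flip_apply]
    abel

theorem parity_sharp (U : ExteriorAlgebra R L) :
    parity (sharp B Ω U) = (-1 : R) ^ n • sharp B Ω (parity U) := by
  rw [sharp, parity_interior, parity_of_mem h.form_mem, map_smul, sharp]

theorem sharp_parity (U : ExteriorAlgebra R L) :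
    sharp B Ω (parity U) = (-1 : R) ^ n • parity (sharp B Ω U) := by
  rw [h.parity_sharp, smul_smul, ← mul_pow, neg_one_mul, neg_neg, one_pow, one_smul]

theorem sharp_form : sharp B.flip V Ω = 1 := by
  rw [sharp, interior_eq_pair B.flip h.form_mem h.multi_mem, h.flip.pair_eq_one, map_one]

theorem sharp_multi : sharp B Ω V = 1 := h.flip.sharp_form

theorem sharp_sharp (U : ExteriorAlgebra R L) :
    sharp B.flip V (sharp B Ω U) = if Even n then parity U else U := by
  induction U using right_induction with
  | algebraMap r =>
    rw [AlgHom.commutes, ite_self, sharp_algebraMap, sharp_smul, h.sharp_form,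
      Algebra.algebraMap_eq_smul_one]
  | add a b ha hb => rw [sharp_add, sharp_add, ha, hb]; split_ifs <;> simp
  | mul_ι x a ha =>
    have hstep : sharp B.flip V (sharp B Ω (a * ι R x)) =
        -((-1 : R) ^ n • (ι R x * parity (sharp B.flip V (sharp B Ω a)))) := by
      rw [← mul_smul_comm, ← h.flip.sharp_parity, h.flip.ι_mul_sharp, LinearMap.flip_flip,
        parity_contract, CliffordAlgebra.involute_involute, sharp_neg, neg_neg, sharp_mul_ι]
    rw [hstep, ha, map_mul, parity_ι]
    split_ifs with hn
    · rw [CliffordAlgebra.involute_involute, hn.neg_one_pow, one_smul, ι_mul_eq, mul_neg]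
    · rw [(Nat.not_even_iff_odd.mp hn).neg_one_pow, neg_smul, one_smul, neg_neg, mul_ι_eq]

theorem sharp_injective : Function.Injective (sharp B Ω) := by
  intro U W hUW
  have hs := h.sharp_sharp U
  rw [hUW, h.sharp_sharp W] at hs
  split_ifs at hs
  · exact (CliffordAlgebra.involute_involutive.injective hs).symm
  · exact hs.symm

theorem sharp_surjective : Function.Surjective (sharp B Ω) := by
  intro w
  by_cases hn : Even n
  · refine ⟨sharp B.flip V (parity w), ?_⟩
    simpa only [if_pos hn, CliffordAlgebra.involute_involute, LinearMap.flip_flip]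
      using h.flip.sharp_sharp (parity w)
  · refine ⟨sharp B.flip V w, ?_⟩
    simpa only [if_neg hn, LinearMap.flip_flip] using h.flip.sharp_sharp w

theorem sharp_mem {k : ℕ} {U : ExteriorAlgebra R L} (hU : U ∈ ⋀[R]^k L) :
    sharp B Ω U ∈ ⋀[R]^(n - k) L' :=
  interior_mem B hU h.form_mem

theorem mem_of_sharp_mem {k : ℕ} {U : ExteriorAlgebra R L} (hU : sharp B Ω U ∈ ⋀[R]^k L') :
    U ∈ ⋀[R]^(n - k) L := by
  have hs := h.flip.sharp_mem hU
  rw [h.sharp_sharp] at hs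
  split_ifs at hs
  · have hs' := parity_of_mem hs
    rw [CliffordAlgebra.involute_involute] at hs'
    exact hs' ▸ Submodule.smul_mem _ _ hs
  · exact hs

theorem mul_sharp_of_mem_two {w : ExteriorAlgebra R L'} (hw : w ∈ ⋀[R]^2 L')
    (U : ExteriorAlgebra R L) : w * sharp B Ω U = sharp B Ω (interior B.flip w U) := by
  rw [ExteriorAlgebra.exteriorPower, pow_two] at hw
  induction hw using Submodule.mul_induction_on' with
  | mem_mul_mem a ha b hb =>
    obtain ⟨θ, rfl⟩ := ha
    obtain ⟨η, rfl⟩ := hb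
    rw [mul_assoc, h.ι_mul_sharp, h.ι_mul_sharp, interior_mul, interior_ι, interior_ι,
      parity_contract, CliffordAlgebra.involute_involute, CliffordAlgebra.contractLeft_comm,
      neg_neg]
  | add x hx y hy h1 h2 => rw [add_mul, h1, h2, interior_add, sharp_add]

theorem eq_smul_of_mem {w : ExteriorAlgebra R L'} (hw : w ∈ ⋀[R]^n L') :
    w = pair B V w • Ω := by
  apply h.flip.sharp_injective
  rw [sharp_smul, h.sharp_form, sharp, interior_eq_pair B.flip hw h.multi_mem, pair_flip,
    Algebra.algebraMap_eq_smul_one]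

theorem smul_form_injective {r s : R} (hrs : r • Ω = s • Ω) : r = s := by
  simpa only [pair_smul, h.pair_eq_one, mul_one] using congrArg (pair B V) hrs

theorem eq_zero_of_forall_smul (hn : n ≠ 0) {r : R} (hr : ∀ θ : L', r • θ = 0) : r = 0 := by
  apply h.smul_form_injective
  obtain ⟨k, rfl⟩ := Nat.exists_eq_succ_of_ne_zero hn
  have hΩ := h.form_mem
  clear h
  rw [zero_smul]
  rw [ExteriorAlgebra.exteriorPower, pow_succ'] at hΩ
  induction hΩ using Submodule.mul_induction_on' with
  | mem_mul_mem a ha b _ =>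
    obtain ⟨θ, rfl⟩ := ha
    rw [← smul_mul_assoc, ← map_smul, hr, map_zero, zero_mul]
  | add x hx y hy h1 h2 => rw [smul_add, h1, h2, add_zero]

theorem section_eq_zero (hn : n = 0) (x : L) : x = 0 := by
  subst hn
  apply (ExteriorAlgebra.ι_inj R x 0).mp
  rw [map_zero]
  exact h.multi_top _ (ι_mem x)

end IsTopPair

end Sharp

section BatalinVilkovisky

variable {𝕜 R L L' : Type*} [Field 𝕜] [CommRing R] [Algebra 𝕜 R]
  [AddCommGroup L] [Module R L] [AddCommGroup L'] [Module R L']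

section SchoutenDefect

variable [CharZero 𝕜]

theorem schouten_parity (𝔞 : LieAlgebroid 𝕜 R L) {k : ℕ} {u : ExteriorAlgebra R L}
    (hu : u ∈ ⋀[R]^k L) (v : ExteriorAlgebra R L) :
    schouten 𝔞 (parity u) v = -((-1 : R) ^ (k + 1) • schouten 𝔞 u v) := by
  rw [parity_of_mem hu]
  rcases Nat.even_or_odd k with hk | hk <;> simp [hk.neg_one_pow, hk.add_one.neg_one_pow]

/-- The defect `d_*[u, v] - [d_* u, v] - (-1)^(k-1) [u, d_* v]` of `d_*` from being a derivation of
the Schouten bracket, where `k` is the degree of `u`. -/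
def schoutenDefect (𝔞 : LieAlgebroid 𝕜 R L) (𝔟 : LieAlgebroid 𝕜 R L') (B : L →ₗ[R] L' →ₗ[R] R)
    (u v : ExteriorAlgebra R L) : ExteriorAlgebra R L :=
  differential 𝔟 B.flip (schouten 𝔞 u v) - schouten 𝔞 (differential 𝔟 B.flip u) v +
    schouten 𝔞 (parity u) (differential 𝔟 B.flip v)

variable (𝔞 : LieAlgebroid 𝕜 R L) (𝔟 : LieAlgebroid 𝕜 R L') (B : L →ₗ[R] L' →ₗ[R] R)

theorem schoutenDefect_add_left (u v w : ExteriorAlgebra R L) :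
    schoutenDefect 𝔞 𝔟 B (u + v) w = schoutenDefect 𝔞 𝔟 B u w + schoutenDefect 𝔞 𝔟 B v w := by
  simp only [schoutenDefect, map_add, AddMonoidHom.add_apply]
  abel

theorem schoutenDefect_add_right (u v w : ExteriorAlgebra R L) :
    schoutenDefect 𝔞 𝔟 B u (v + w) = schoutenDefect 𝔞 𝔟 B u v + schoutenDefect 𝔞 𝔟 B u w := by
  simp only [schoutenDefect, map_add]
  abel

theorem schoutenDefect_eq_zero_iff {k : ℕ} {u : ExteriorAlgebra R L} (hu : u ∈ ⋀[R]^k L)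
    (v : ExteriorAlgebra R L) : schoutenDefect 𝔞 𝔟 B u v = 0 ↔
      differential 𝔟 B.flip (schouten 𝔞 u v) = schouten 𝔞 (differential 𝔟 B.flip u) v +
        (-1 : R) ^ (k + 1) • schouten 𝔞 u (differential 𝔟 B.flip v) := by
  rw [schoutenDefect, schouten_parity 𝔞 hu, ← sub_eq_add_neg, sub_sub, sub_eq_zero]

end SchoutenDefect

/-- The divergence `∂x` of a section `x`, determined by `L_x V = (∂x) V`, or by
`L_x Ω = -(∂x) Ω`. -/
def divergence (𝔞 : LieAlgebroid 𝕜 R L) (B : L →ₗ[R] L' →ₗ[R] R) (Ω : ExteriorAlgebra R L')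
    (x : L) : R :=
  algebraMapInv (bv 𝔞 B Ω (ι R x))

namespace IsTopPair

variable {B : L →ₗ[R] L' →ₗ[R] R} {n : ℕ} {Ω : ExteriorAlgebra R L'} {V : ExteriorAlgebra R L}
  (h : IsTopPair B n Ω V) (𝔞 : LieAlgebroid 𝕜 R L) (𝔟 : LieAlgebroid 𝕜 R L')

include h

theorem sharp_bv (u : ExteriorAlgebra R L) :
    sharp B Ω (bv 𝔞 B Ω u) = differential 𝔞 B (sharp B Ω (parity u)) :=
  Function.invFun_eq (h.sharp_surjective _)

theorem differential_sharp (u : ExteriorAlgebra R L) :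
    differential 𝔞 B (sharp B Ω u) = sharp B Ω (bv 𝔞 B Ω (parity u)) := by
  rw [h.sharp_bv, CliffordAlgebra.involute_involute]

theorem bv_add (u v : ExteriorAlgebra R L) :
    bv 𝔞 B Ω (u + v) = bv 𝔞 B Ω u + bv 𝔞 B Ω v := by
  apply h.sharp_injective
  simp only [sharp_add, h.sharp_bv, map_add]

theorem bv_neg (u : ExteriorAlgebra R L) : bv 𝔞 B Ω (-u) = -bv 𝔞 B Ω u :=
  map_neg (AddMonoidHom.mk' (bv 𝔞 B Ω) (h.bv_add 𝔞)) u

theorem bv_zero : bv 𝔞 B Ω (0 : ExteriorAlgebra R L) = 0 :=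
  map_zero (AddMonoidHom.mk' (bv 𝔞 B Ω) (h.bv_add 𝔞))

theorem divergence_add (x y : L) :
    divergence 𝔞 B Ω (x + y) = divergence 𝔞 B Ω x + divergence 𝔞 B Ω y := by
  rw [divergence, map_add, h.bv_add, map_add, divergence, divergence]

theorem divergence_neg (x : L) : divergence 𝔞 B Ω (-x) = -divergence 𝔞 B Ω x := by
  rw [divergence, map_neg, h.bv_neg, map_neg, divergence]

theorem divergence_zero : divergence 𝔞 B Ω 0 = 0 := by
  rw [divergence, map_zero, h.bv_zero, map_zero]

theorem laplacian_add (u v : ExteriorAlgebra R L) :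
    laplacian 𝔞 𝔟 B Ω (u + v) = laplacian 𝔞 𝔟 B Ω u + laplacian 𝔞 𝔟 B Ω v := by
  simp only [laplacian, h.bv_add, map_add]
  abel

variable [CharZero 𝕜]

theorem differential_form : differential 𝔞 B Ω = 0 :=
  h.form_top _ ((differential_spec 𝔞 B h.dual).map_mem h.form_mem)

theorem parity_bv (u : ExteriorAlgebra R L) :
    parity (bv 𝔞 B Ω u) = -bv 𝔞 B Ω (parity u) := by
  have hD := differential_spec 𝔞 B h.dual
  apply h.sharp_injective
  rw [sharp_neg, h.sharp_parity, h.sharp_bv, h.sharp_bv, hD.parity_apply, h.parity_sharp]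
  rcases Nat.even_or_odd n with hn | hn <;> simp [hn.neg_one_pow]

theorem bv_smul (f : R) (u : ExteriorAlgebra R L) :
    bv 𝔞 B Ω (f • u) = f • bv 𝔞 B Ω u - contract (anchorDual 𝔞 f) u := by
  have hdf : B.flip (differentialFun 𝔞 B f) = anchorDual 𝔞 f :=
    LinearMap.ext fun x => h.dual.pair_differentialFun 𝔞 x f
  apply h.sharp_injective
  rw [h.sharp_bv, map_smul, sharp_smul, (differential_spec 𝔞 B h.dual).map_smul,
    h.dual.differential_algebraMap, h.ι_mul_sharp, hdf, parity_contract,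
    CliffordAlgebra.involute_involute, sub_eq_add_neg, sharp_add, sharp_smul, h.sharp_bv, add_comm]

theorem bv_one : bv 𝔞 B Ω 1 = 0 := by
  apply h.sharp_injective
  rw [h.sharp_bv, map_one, ← map_one (algebraMap R _), sharp_algebraMap, one_smul,
    h.differential_form, sharp_zero]

theorem bv_algebraMap (f : R) : bv 𝔞 B Ω (algebraMap R _ f) = 0 := by
  rw [Algebra.algebraMap_eq_smul_one, h.bv_smul, h.bv_one, ← map_one (algebraMap R _),
    contract_algebraMap, smul_zero, sub_zero]

theorem bv_mem {k : ℕ} {u : ExteriorAlgebra R L} (hu : u ∈ ⋀[R]^k L) :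
    bv 𝔞 B Ω u ∈ ⋀[R]^(k - 1) L := by
  rcases lt_or_ge n k with hk | hk
  · rw [h.eq_zero_of_mem hk hu, h.bv_zero]
    exact Submodule.zero_mem _
  · rcases k with _ | k
    · obtain ⟨f, rfl⟩ := exists_eq_algebraMap hu
      exact h.bv_algebraMap 𝔞 f ▸ Submodule.zero_mem _
    have hsharp : sharp B Ω (bv 𝔞 B Ω u) ∈ ⋀[R]^(n - (k + 1) + 1) L' := by
      rw [h.sharp_bv, parity_of_mem hu]
      exact (differential_spec 𝔞 B h.dual).map_mem (h.sharp_mem (Submodule.smul_mem _ _ hu))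
    have hdegree : n - (n - (k + 1) + 1) = k + 1 - 1 := by omega
    exact hdegree ▸ h.mem_of_sharp_mem hsharp

theorem bv_ι (x : L) : bv 𝔞 B Ω (ι R x) = algebraMap R _ (divergence 𝔞 B Ω x) :=
  (algebraMap_algebraMapInv (h.bv_mem 𝔞 (ι_mem x))).symm

theorem lieForm_form (x : L) : lieForm 𝔞 B x Ω = -divergence 𝔞 B Ω x • Ω := by
  have hx := h.sharp_bv 𝔞 (ι R x)
  rw [h.bv_ι, sharp_algebraMap, parity_ι, sharp_neg, map_neg, sharp, interior_ι] at hx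
  change contract (B x) (differential 𝔞 B Ω) + differential 𝔞 B (contract (B x) Ω) = _
  rw [h.differential_form, map_zero, zero_add, neg_smul, hx, neg_neg]

theorem bv_ι_mul (x : L) (u : ExteriorAlgebra R L) :
    bv 𝔞 B Ω (ι R x * u) =
      bv 𝔞 B Ω (ι R x) * u - ι R x * bv 𝔞 B Ω u - schouten 𝔞 (ι R x) u := by
  have hparity : sharp B Ω (parity (ι R x * u)) = -contract (B x) (sharp B Ω u) := by
    rw [map_mul, parity_ι, neg_mul, ← mul_ι_eq, sharp_neg, sharp_mul_ι]
  have hcartan : differential 𝔞 B (contract (B x) (sharp B Ω u)) =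
      lieForm 𝔞 B x (sharp B Ω u) - contract (B x) (differential 𝔞 B (sharp B Ω u)) :=
    eq_sub_of_add_eq' rfl
  have hlie : lieForm 𝔞 B x (sharp B Ω u) =
      sharp B Ω (schouten 𝔞 (ι R x) u) - divergence 𝔞 B Ω x • sharp B Ω u := by
    rw [sharp, (h.dual.lie_isDualDerivation 𝔞 x).apply_interior, h.lieForm_form, map_smul,
      neg_smul, ← sub_eq_add_neg]
    rfl
  apply h.sharp_injective
  rw [h.sharp_bv, hparity, map_neg, hcartan, hlie, h.differential_sharp, ← sharp_mul_ι, mul_ι_eq,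
    h.parity_bv, CliffordAlgebra.involute_involute, h.bv_ι, ← Algebra.smul_def]
  simp only [sub_eq_add_neg, sharp_add, sharp_neg, sharp_smul, mul_neg]
  abel

theorem bv_mul (a b : ExteriorAlgebra R L) :
    bv 𝔞 B Ω (a * b) =
      bv 𝔞 B Ω a * b + parity a * bv 𝔞 B Ω b + schouten 𝔞 (parity a) b := by
  induction a using left_induction with
  | algebraMap r =>
    rw [AlgHom.commutes, ← Algebra.smul_def, h.bv_smul, h.bv_algebraMap, schouten_algebraMap,
      ← Algebra.smul_def, zero_mul, zero_add, sub_eq_add_neg]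
  | add u v hu hv =>
    rw [add_mul, h.bv_add, hu, hv, h.bv_add, map_add, map_add, AddMonoidHom.add_apply]
    noncomm_ring
  | ι_mul u x hu =>
    rw [mul_assoc, h.bv_ι_mul, hu, h.bv_ι_mul 𝔞 x u, schouten_ι_mul, map_mul, parity_ι, neg_mul,
      map_neg, AddMonoidHom.neg_apply, schouten_mul_left, CliffordAlgebra.involute_involute]
    noncomm_ring

theorem laplacian_mul (a b : ExteriorAlgebra R L) :
    laplacian 𝔞 𝔟 B Ω (a * b) = laplacian 𝔞 𝔟 B Ω a * b + a * laplacian 𝔞 𝔟 B Ω b +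
      schoutenDefect 𝔞 𝔟 B (parity a) b := by
  have hD := differential_spec 𝔟 B.flip h.dual.flip
  simp only [laplacian, schoutenDefect, hD.map_mul, h.bv_mul, h.bv_add, map_add, h.parity_bv,
    hD.parity_apply, CliffordAlgebra.involute_involute, map_neg, AddMonoidHom.neg_apply]
  noncomm_ring

theorem differential_schouten_iff_laplacian_mul :
    (∀ (k l : ℕ), ∀ u ∈ ⋀[R]^k L, ∀ v ∈ ⋀[R]^l L,
      differential 𝔟 B.flip (schouten 𝔞 u v) = schouten 𝔞 (differential 𝔟 B.flip u) v +
        (-1 : R) ^ (k + 1) • schouten 𝔞 u (differential 𝔟 B.flip v)) ↔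
    ∀ u v, laplacian 𝔞 𝔟 B Ω (u * v) =
      laplacian 𝔞 𝔟 B Ω u * v + u * laplacian 𝔞 𝔟 B Ω v := by
  constructor
  · intro H u v
    rw [h.laplacian_mul, add_eq_left]
    induction parity u using homogeneous_induction with
    | homogeneous k a ha =>
      induction v using homogeneous_induction with
      | homogeneous l v hv => exact (schoutenDefect_eq_zero_iff 𝔞 𝔟 B ha v).mpr (H k l a ha v hv)
      | add v w hv hw => rw [schoutenDefect_add_right, hv, hw, add_zero]
    | add a b ha hb => rw [schoutenDefect_add_left, ha, hb, add_zero]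
  · intro H k l u hu v _
    have hmul := h.laplacian_mul 𝔞 𝔟 (parity u) v
    rw [H, left_eq_add, CliffordAlgebra.involute_involute] at hmul
    exact (schoutenDefect_eq_zero_iff 𝔞 𝔟 B hu v).mp hmul

theorem bv_flip_sharp (u : ExteriorAlgebra R L) :
    bv 𝔟 B.flip V (sharp B Ω u) = -sharp B Ω (differential 𝔟 B.flip (parity u)) := by
  have hD := differential_spec 𝔟 B.flip h.dual.flip
  apply h.flip.sharp_injective
  rw [h.flip.sharp_bv, h.parity_sharp, sharp_smul, sharp_neg, h.sharp_sharp, h.sharp_sharp]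
  split_ifs with hn
  · rw [hn.neg_one_pow, one_smul, hD.parity_apply, neg_neg]
  · rw [(Nat.not_even_iff_odd.mp hn).neg_one_pow, neg_smul, one_smul, map_neg]

theorem laplacian_sharp (u : ExteriorAlgebra R L) :
    laplacian 𝔟 𝔞 B.flip V (sharp B Ω u) = sharp B Ω (laplacian 𝔞 𝔟 B Ω u) := by
  have hD := differential_spec 𝔟 B.flip h.dual.flip
  rw [laplacian, laplacian, h.bv_flip_sharp, LinearMap.flip_flip, map_neg, h.differential_sharp,
    h.differential_sharp, h.bv_flip_sharp, h.parity_bv, CliffordAlgebra.involute_involute,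
    hD.parity_apply, CliffordAlgebra.involute_involute, h.bv_neg, sharp_neg, map_neg, sharp_neg,
    sharp_add, neg_neg, neg_neg, add_comm]

theorem laplacian_mem {k : ℕ} {u : ExteriorAlgebra R L} (hu : u ∈ ⋀[R]^k L) :
    laplacian 𝔞 𝔟 B Ω u ∈ ⋀[R]^k L := by
  have hD := differential_spec 𝔟 B.flip h.dual.flip
  refine Submodule.add_mem _ ?_ (h.bv_mem 𝔞 (hD.map_mem hu))
  rcases k with _ | k
  · obtain ⟨r, rfl⟩ := exists_eq_algebraMap hu
    rw [h.bv_algebraMap, map_zero]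
    exact Submodule.zero_mem _
  · exact hD.map_mem (h.bv_mem 𝔞 hu)

theorem laplacian_one : laplacian 𝔞 𝔟 B Ω 1 = 0 := by
  rw [laplacian, (differential_spec 𝔟 B.flip h.dual.flip).map_one, h.bv_zero, h.bv_one, map_zero,
    add_zero]

theorem laplacian_multi : laplacian 𝔞 𝔟 B Ω V = 0 := by
  apply h.sharp_injective
  rw [← h.laplacian_sharp, h.sharp_multi, h.flip.laplacian_one, sharp_zero]

theorem laplacian_pairing (H : ∀ u v, laplacian 𝔞 𝔟 B Ω (u * v) =
      laplacian 𝔞 𝔟 B Ω u * v + u * laplacian 𝔞 𝔟 B Ω v) (x : L) (θ : L') :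
    laplacian 𝔟 𝔞 B.flip V (algebraMap R _ (B x θ)) =
      algebraMap R _ (pair B (ι R x) (laplacian 𝔟 𝔞 B.flip V (ι R θ)) +
        pair B (laplacian 𝔞 𝔟 B Ω (ι R x)) (ι R θ)) := by
  obtain ⟨U, hU⟩ := h.sharp_surjective (ι R θ)
  rw [map_add, ← interior_eq_pair B (ι_mem x) (h.flip.laplacian_mem 𝔟 𝔞 (ι_mem θ)),
    ← interior_eq_pair B (h.laplacian_mem 𝔞 𝔟 (ι_mem x)) (ι_mem θ), interior_ι,
    ← contract_ι, ← hU, ← sharp_mul_ι, h.laplacian_sharp, H, sharp_add, sharp_mul_ι,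
    ← h.laplacian_sharp]
  simp only [sharp, interior_mul]

end IsTopPair

end BatalinVilkovisky

section TopDegree

variable {R L L' : Type*} [CommRing R] [AddCommGroup L] [Module R L]
  [AddCommGroup L'] [Module R L'] {B : L →ₗ[R] L' →ₗ[R] R} {n : ℕ} {Ω : ExteriorAlgebra R L'}
  {V : ExteriorAlgebra R L} (h : IsTopPair B n Ω V) {Y : R → R}
  {D : ExteriorAlgebra R L →+ ExteriorAlgebra R L}
  {D' : ExteriorAlgebra R L' →+ ExteriorAlgebra R L'} (hD : IsDualDerivation B Y D D')

include h hD

theorem IsTopPair.pair_derivation_add : pair B (D V) Ω + pair B V (D' Ω) = 0 := by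
  have hone : D' 1 = 0 := by
    have hmul := hD.right.map_mul 1 1
    rwa [mul_one, mul_one, one_mul, left_eq_add] at hmul
  have hinterior := hD.apply_interior V Ω
  rw [interior_eq_pair B h.multi_mem h.form_mem, h.pair_eq_one, map_one, hone,
    interior_eq_pair B (hD.left.map_mem h.multi_mem) h.form_mem,
    interior_eq_pair B h.multi_mem (hD.right.map_mem h.form_mem), ← map_add,
    ← map_zero (algebraMap R _), algebraMap_inj] at hinterior
  exact hinterior.symm

end TopDegree

namespace IsTopPair

variable {𝕜 R L L' : Type*} [Field 𝕜] [CharZero 𝕜] [CommRing R] [Algebra 𝕜 R]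
  [AddCommGroup L] [Module R L] [AddCommGroup L'] [Module R L']
  {B : L →ₗ[R] L' →ₗ[R] R} {n : ℕ} {Ω : ExteriorAlgebra R L'} {V : ExteriorAlgebra R L}
  (h : IsTopPair B n Ω V) (𝔞 : LieAlgebroid 𝕜 R L) (𝔟 : LieAlgebroid 𝕜 R L')

include h

theorem lieMulti_multi (x : L) : lieMulti 𝔞 x V = divergence 𝔞 B Ω x • V := by
  have hL := h.dual.lie_isDualDerivation 𝔞 x
  have hpair := h.pair_derivation_add hL
  rw [h.lieForm_form, pair_smul, h.pair_eq_one, mul_one, add_neg_eq_zero] at hpair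
  rw [h.flip.eq_smul_of_mem (hL.left.map_mem h.multi_mem), pair_flip, hpair]

theorem laplacian_flip_eq {Y : R → R} {D : ExteriorAlgebra R L →+ ExteriorAlgebra R L}
    {D' : ExteriorAlgebra R L' →+ ExteriorAlgebra R L'} (hD : IsDualDerivation B Y D D')
    {r : R} (hr : IsUnit r) (H : ∀ u, laplacian 𝔞 𝔟 B Ω u = r • D u) (w : ExteriorAlgebra R L') :
    laplacian 𝔟 𝔞 B.flip V w = r • D' w := by
  have hDV : D V = 0 := hr.smul_eq_zero.mp ((H V).symm.trans (h.laplacian_multi 𝔞 𝔟))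
  have hDΩ : D' Ω = 0 := by
    have hpair := h.pair_derivation_add hD
    rw [hDV, pair, interior_zero, map_zero, zero_add] at hpair
    rw [h.eq_smul_of_mem (hD.right.map_mem h.form_mem), hpair, zero_smul]
  obtain ⟨u, rfl⟩ := h.sharp_surjective w
  rw [h.laplacian_sharp, H, sharp_smul, sharp, sharp, hD.apply_interior, hDΩ, map_zero, add_zero]

end IsTopPair

section Compatibility

variable {𝕜 R L L' : Type*} [Field 𝕜] [CharZero 𝕜] [CommRing R] [Algebra 𝕜 R]
  [AddCommGroup L] [Module R L] [AddCommGroup L'] [Module R L']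
  (𝔞 : LieAlgebroid 𝕜 R L) (𝔟 : LieAlgebroid 𝕜 R L') (B : L →ₗ[R] L' →ₗ[R] R)
  (Ω : ExteriorAlgebra R L') (V : ExteriorAlgebra R L)

/-- The Laplacian `Δf` of a function, as a function. -/
def laplacianFun (f : R) : R := algebraMapInv (laplacian 𝔞 𝔟 B Ω (algebraMap R _ f))

/-- The Laplacian `Δx` of a section, as a section. -/
def laplacianSection (x : L) : L := ιInv (laplacian 𝔞 𝔟 B Ω (ι R x))

/-- The section `[x, d_* f] - L_{df} x`, which is the defect `Δ(f x) - f Δx - (Δf) x` of the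
Leibniz rule for the Laplacian on the product of a function and a section. -/
def leibnizDefect (f : R) (x : L) : L :=
  𝔞.bracket x (differentialFun 𝔟 B.flip f) - lieSection 𝔟 B.flip (differentialFun 𝔞 B f) x

/-- The Laplacians are compatible with the pairing of sections, where the one on `Γ(∧A*)` is
applied to functions. -/
def LaplacianCompatible : Prop := ∀ (x : L) (θ : L'),
  laplacianFun 𝔟 𝔞 B.flip V (B x θ) =
    B x (laplacianSection 𝔟 𝔞 B.flip V θ) + B (laplacianSection 𝔞 𝔟 B Ω x) θ

variable {B Ω V}

namespace IsTopPair

variable {n : ℕ} (h : IsTopPair B n Ω V)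

include h

theorem divergence_smul (f : R) (x : L) :
    divergence 𝔞 B Ω (f • x) = f * divergence 𝔞 B Ω x - 𝔞.anchor x f := by
  rw [← algebraMap_inj (L := L), ← h.bv_ι, map_smul, h.bv_smul, h.bv_ι, contract_ι,
    Algebra.smul_def, map_sub, map_mul, anchorDual_apply]

theorem laplacian_algebraMap (f : R) :
    laplacian 𝔞 𝔟 B Ω (algebraMap R _ f) = algebraMap R _ (laplacianFun 𝔞 𝔟 B Ω f) :=
  (algebraMap_algebraMapInv (h.laplacian_mem 𝔞 𝔟 (algebraMap_mem f))).symm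

theorem laplacian_ι (x : L) :
    laplacian 𝔞 𝔟 B Ω (ι R x) = ι R (laplacianSection 𝔞 𝔟 B Ω x) :=
  (ι_ιInv (h.laplacian_mem 𝔞 𝔟 (ι_mem x))).symm

theorem laplacianFun_eq (f : R) :
    laplacianFun 𝔞 𝔟 B Ω f = divergence 𝔞 B Ω (differentialFun 𝔟 B.flip f) := by
  rw [← algebraMap_inj (L := L), ← h.laplacian_algebraMap, laplacian, h.bv_algebraMap, map_zero,
    zero_add, h.dual.flip.differential_algebraMap, h.bv_ι]

theorem laplacianFun_mul (f g : R) :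
    laplacianFun 𝔞 𝔟 B Ω (f * g) = f * laplacianFun 𝔞 𝔟 B Ω g + g * laplacianFun 𝔞 𝔟 B Ω f -
      𝔞.anchor (differentialFun 𝔟 B.flip f) g - 𝔟.anchor (differentialFun 𝔞 B f) g := by
  rw [h.laplacianFun_eq, h.dual.flip.differentialFun_mul, h.divergence_add, h.divergence_smul,
    h.divergence_smul, h.laplacianFun_eq, h.laplacianFun_eq,
    h.dual.anchor_differentialFun_comm 𝔞 𝔟 g f]
  ring

theorem laplacianSection_smul (f : R) (x : L) :
    laplacianSection 𝔞 𝔟 B Ω (f • x) = f • laplacianSection 𝔞 𝔟 B Ω x +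
      laplacianFun 𝔞 𝔟 B Ω f • x + leibnizDefect 𝔞 𝔟 B f x := by
  have hdf : anchorDual 𝔞 f = B.flip (differentialFun 𝔞 B f) :=
    LinearMap.ext fun y => (h.dual.pair_differentialFun 𝔞 y f).symm
  have hanchor : 𝔞.anchor x f = B.flip (differentialFun 𝔞 B f) x :=
    (h.dual.pair_differentialFun 𝔞 x f).symm
  apply (ExteriorAlgebra.ι_inj R _ _).mp
  rw [← h.laplacian_ι, map_smul, Algebra.smul_def, h.laplacian_mul, AlgHom.commutes,
    schoutenDefect, AlgHom.commutes, schouten_algebraMap, schouten_algebraMap,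
    h.dual.flip.differential_algebraMap, (schouten_spec 𝔞).section_section, contract_ι,
    anchorDual_apply, hanchor, hdf, h.dual.flip.contract_differential_ι, map_neg,
    h.dual.flip.differential_algebraMap, h.laplacian_algebraMap, h.laplacian_ι, leibnizDefect,
    h.dual.flip.lieSection_eq, 𝔞.bracket_skew x, ← Algebra.smul_def, ← Algebra.smul_def]
  simp only [map_add, map_sub, map_neg, map_smul]
  abel

theorem bv_contract_add_contract_bv (θ : L') {U : ExteriorAlgebra R L} (hU : U ∈ ⋀[R]^2 L) :
    bv 𝔞 B Ω (contract (B.flip θ) U) + contract (B.flip θ) (bv 𝔞 B Ω U) =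
      algebraMap R _ (pair B U (differential 𝔞 B (ι R θ))) := by
  have hD := differential_spec 𝔞 B h.dual
  have hmul := hD.map_mul (ι R θ) (sharp B Ω U)
  rw [parity_ι, h.ι_mul_sharp, h.differential_sharp, h.differential_sharp,
    h.mul_sharp_of_mem_two (hD.degree_section θ), neg_mul, h.ι_mul_sharp, parity_contract,
    parity_contract, h.parity_bv, CliffordAlgebra.involute_involute,
    interior_eq_pair B.flip (hD.degree_section θ) hU, pair_flip, map_neg parity,
    parity_contract, CliffordAlgebra.involute_involute, neg_neg, map_neg, neg_neg] at hmul
  apply h.sharp_injective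
  rw [sharp_add, hmul]
  abel

theorem pair_laplacianSection (x : L) (θ : L') :
    B (laplacianSection 𝔞 𝔟 B Ω x) θ = 𝔟.anchor θ (divergence 𝔞 B Ω x) -
      divergence 𝔞 B Ω (interiorDifferential 𝔟 B.flip θ x) +
      pair B (differential 𝔟 B.flip (ι R x)) (differential 𝔞 B (ι R θ)) := by
  have hbv := h.bv_contract_add_contract_bv 𝔞 θ
    ((differential_spec 𝔟 B.flip h.dual.flip).degree_section x)
  rw [h.dual.flip.contract_differential_ι, h.bv_ι] at hbv
  have hcontract := congrArg (contract (B.flip θ)) (h.laplacian_ι 𝔞 𝔟 x)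
  rw [laplacian, map_add, contract_ι, h.bv_ι, h.dual.flip.differential_algebraMap, contract_ι,
    eq_sub_of_add_eq' hbv, ← map_sub, ← map_add, algebraMap_inj,
    h.dual.flip.pair_differentialFun, LinearMap.flip_apply] at hcontract
  rw [← hcontract]
  ring

theorem pair_leibnizDefect_add (f : R) (x : L) (θ : L') :
    B (leibnizDefect 𝔞 𝔟 B f x) θ + B x (leibnizDefect 𝔟 𝔞 B.flip f θ) =
      -(𝔞.anchor (differentialFun 𝔟 B.flip f) (B x θ) +
        𝔟.anchor (differentialFun 𝔞 B f) (B x θ)) := by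
  have hlie := h.dual.pair_lieSection 𝔞 (differentialFun 𝔟 B.flip f) x θ
  have hlie' := h.dual.flip.pair_lieSection 𝔟 (differentialFun 𝔞 B f) θ x
  simp only [LinearMap.flip_apply] at hlie'
  simp only [leibnizDefect, LinearMap.flip_flip, map_sub, LinearMap.sub_apply, hlie, hlie',
    𝔞.bracket_skew x, 𝔟.bracket_skew θ, map_neg, LinearMap.neg_apply]
  ring

theorem laplacianCompatible_iff :
    (∀ (x : L) (θ : L'), laplacian 𝔟 𝔞 B.flip V (algebraMap R _ (B x θ)) =
      algebraMap R _ (pair B (ι R x) (laplacian 𝔟 𝔞 B.flip V (ι R θ)) +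
        pair B (laplacian 𝔞 𝔟 B Ω (ι R x)) (ι R θ))) ↔ LaplacianCompatible 𝔞 𝔟 B Ω V := by
  refine forall₂_congr fun x θ => ?_
  rw [h.flip.laplacian_algebraMap, h.flip.laplacian_ι, h.laplacian_ι, pair_ι_ι, pair_ι_ι,
    algebraMap_inj]

theorem laplacianCompatible_flip_iff :
    (∀ (x : L) (θ : L'), laplacian 𝔞 𝔟 B Ω (algebraMap R _ (B x θ)) =
      algebraMap R _ (pair B (ι R x) (laplacian 𝔟 𝔞 B.flip V (ι R θ)) +
        pair B (laplacian 𝔞 𝔟 B Ω (ι R x)) (ι R θ))) ↔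
      LaplacianCompatible 𝔟 𝔞 B.flip V Ω := by
  rw [LaplacianCompatible, forall_comm]
  refine forall₂_congr fun θ x => ?_
  rw [h.laplacian_algebraMap, h.flip.laplacian_ι, h.laplacian_ι, pair_ι_ι, pair_ι_ι,
    algebraMap_inj, add_comm]
  rfl

variable {𝔞 𝔟}

theorem leibnizDefect_eq_zero (H : LaplacianCompatible 𝔞 𝔟 B Ω V) (f : R) (x : L) :
    leibnizDefect 𝔞 𝔟 B f x = 0 := by
  refine h.dual.flip.ext_right fun θ => ?_
  have hsmul := H x (f • θ)
  rw [map_smul, smul_eq_mul, h.flip.laplacianSection_smul, map_smul, smul_eq_mul, map_add, map_add,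
    map_smul, map_smul, smul_eq_mul, smul_eq_mul] at hsmul
  have hmul := h.flip.laplacianFun_mul 𝔟 𝔞 f (B x θ)
  rw [LinearMap.flip_flip] at hmul
  rw [LinearMap.flip_apply, LinearMap.flip_apply, map_zero, LinearMap.zero_apply]
  linear_combination h.pair_leibnizDefect_add 𝔞 𝔟 f x θ - hmul + hsmul - f * H x θ

theorem anchor_add_anchor_pair (H : LaplacianCompatible 𝔞 𝔟 B Ω V) (f : R) (x : L) (θ : L') :
    𝔞.anchor (differentialFun 𝔟 B.flip f) (B x θ) + 𝔟.anchor (differentialFun 𝔞 B f) (B x θ) =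
      -(laplacianFun 𝔞 𝔟 B Ω f - laplacianFun 𝔟 𝔞 B.flip V f) * B x θ := by
  have hsmul := H (f • x) θ
  rw [map_smul, LinearMap.smul_apply, smul_eq_mul, h.laplacianSection_smul,
    h.leibnizDefect_eq_zero H, LinearMap.smul_apply, smul_eq_mul, add_zero, map_add,
    LinearMap.add_apply, map_smul, map_smul, LinearMap.smul_apply, smul_eq_mul,
    LinearMap.smul_apply, smul_eq_mul] at hsmul
  have hmul := h.flip.laplacianFun_mul 𝔟 𝔞 f (B x θ)
  rw [LinearMap.flip_flip] at hmul
  linear_combination hmul - hsmul + f * H x θ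

theorem eq_zero_of_forall_mul_pair (hn : n ≠ 0) {r : R} (hr : ∀ x θ, r * B x θ = 0) : r = 0 :=
  h.eq_zero_of_forall_smul hn fun θ =>
    h.dual.ext_right fun x => by rw [map_smul, smul_eq_mul, hr, map_zero]

theorem anchor_add_anchor_eq_zero (H : LaplacianCompatible 𝔞 𝔟 B Ω V) (f g : R) :
    𝔞.anchor (differentialFun 𝔟 B.flip f) g + 𝔟.anchor (differentialFun 𝔞 B f) g = 0 := by
  rcases eq_or_ne n 0 with hn | hn
  · rw [h.section_eq_zero hn (differentialFun 𝔟 B.flip f),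
      h.flip.section_eq_zero hn (differentialFun 𝔞 B f)]
    simp only [map_zero, Derivation.coe_zero, Pi.zero_apply, add_zero]
  -- On pairings the derivation `ρ(d_* f) + ρ_*(df)` acts by scalars; so it kills every function.
  refine h.eq_zero_of_forall_mul_pair hn fun x θ => ?_
  have hsmul := h.anchor_add_anchor_pair H f x (g • θ)
  rw [map_smul, smul_eq_mul, Derivation.leibniz, Derivation.leibniz] at hsmul
  simp only [smul_eq_mul] at hsmul
  linear_combination hsmul - g * h.anchor_add_anchor_pair H f x θ

theorem laplacianFun_flip_eq (H : LaplacianCompatible 𝔞 𝔟 B Ω V) (f : R) :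
    laplacianFun 𝔟 𝔞 B.flip V f = laplacianFun 𝔞 𝔟 B Ω f := by
  rcases eq_or_ne n 0 with hn | hn
  · rw [h.laplacianFun_eq, h.flip.laplacianFun_eq, h.section_eq_zero hn (differentialFun _ _ _),
      h.flip.section_eq_zero hn (differentialFun _ _ _), h.divergence_zero, h.flip.divergence_zero]
  refine sub_eq_zero.mp (h.eq_zero_of_forall_mul_pair hn fun x θ => ?_)
  linear_combination h.anchor_add_anchor_eq_zero H f (B x θ) - h.anchor_add_anchor_pair H f x θ

theorem laplacianCompatible_flip (H : LaplacianCompatible 𝔞 𝔟 B Ω V) :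
    LaplacianCompatible 𝔟 𝔞 B.flip V Ω := fun θ x => by
  rw [LinearMap.flip_flip, LinearMap.flip_apply, ← h.laplacianFun_flip_eq H, H, add_comm]
  rfl

theorem laplacianCompatible_comm :
    LaplacianCompatible 𝔞 𝔟 B Ω V ↔ LaplacianCompatible 𝔟 𝔞 B.flip V Ω :=
  ⟨h.laplacianCompatible_flip, h.flip.laplacianCompatible_flip⟩

end IsTopPair

end Compatibility

section FrameTrace

variable {R L L' : Type*} [CommRing R] [AddCommGroup L] [Module R L] [AddCommGroup L'] [Module R L']

/-- `t` is the trace of `T` computed in any pair of dual bases, in the sense of `HasDualBasis`.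
The index types are restricted to `Type`, as they are there. -/
def IsFrameTrace (B : L →ₗ[R] L' →ₗ[R] R) (T : L' →ₗ[R] L') (t : R) : Prop :=
  ∀ (J : Type) (_ : Fintype J) (e : J → L) (ε : J → L'),
    (∀ x, x = ∑ i, B x (ε i) • e i) → (∀ θ, θ = ∑ i, B (e i) θ • ε i) →
      ∑ i, B (e i) (T (ε i)) = t

namespace IsTopPair

variable {B : L →ₗ[R] L' →ₗ[R] R} {n : ℕ} {Ω : ExteriorAlgebra R L'} {V : ExteriorAlgebra R L}
  (h : IsTopPair B n Ω V) {Y : R → R} {D : ExteriorAlgebra R L' →+ ExteriorAlgebra R L'}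
  (hD : IsDerivationOver Y D) {T : L' →ₗ[R] L'} (hT : ∀ θ, ι R (T θ) = D (ι R θ))

include h hD hT

theorem isFrameTrace_iff (hY : ∀ f, Y f = 0) {t : R} : IsFrameTrace B T t ↔ D Ω = t • Ω := by
  have hform : ∀ {J : Type} [Fintype J] (e : J → L) (ε : J → L'),
      (∀ θ, θ = ∑ i, B (e i) θ • ε i) → D Ω = (∑ i, B (e i) (T (ε i))) • Ω := by
    intro J _ e ε hε
    rw [hD.apply_eq_sum hY hT hε, Finset.sum_smul]
    refine Finset.sum_congr rfl fun i _ => ?_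
    have hcontract := contract_ι_mul (B (e i)) (T (ε i)) Ω
    rw [h.ι_mul_form, map_zero, eq_comm, sub_eq_zero] at hcontract
    exact hcontract.symm
  constructor
  · intro ht
    obtain ⟨J, hJ, e, ε, he, hε⟩ := h.dual
    rw [hform e ε hε, ht J hJ e ε he hε]
  · intro ht J _ e ε _ hε
    exact h.smul_form_injective ((hform e ε hε).symm.trans ht)

theorem apply_fun_eq_zero (hn : n ≠ 0) (f : R) : Y f = 0 :=
  h.eq_zero_of_forall_smul hn fun θ => by
    have hsmul := hT (f • θ)
    rw [map_smul, map_smul, map_smul, hT, hD.map_smul, right_eq_add, ← map_smul] at hsmul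
    exact (map_eq_zero_iff _ (ExteriorAlgebra.ι_leftInverse (R := R)).injective).mp hsmul

end IsTopPair

end FrameTrace

section Dorfman

variable {𝕜 R L L' : Type*} [Field 𝕜] [CharZero 𝕜] [CommRing R] [Algebra 𝕜 R]
  [AddCommGroup L] [Module R L] [AddCommGroup L'] [Module R L']
  (𝔞 : LieAlgebroid 𝕜 R L) (𝔟 : LieAlgebroid 𝕜 R L') {B : L →ₗ[R] L' →ₗ[R] R}

variable (B) in
/-- The operator `L_{x ∘ θ} - [L_x, L_θ]` on `Γ(∧A*)`, bundled as an additive map. -/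
def dorfmanDefectHom (x : L) (θ : L') : ExteriorAlgebra R L' →+ ExteriorAlgebra R L' :=
  AddMonoidHom.mk' (dorfmanDefect 𝔞 𝔟 B x θ) fun α β => by
    simp only [dorfmanDefect, map_add]
    abel

namespace HasDualBasis

variable (hB : HasDualBasis B)

include hB

theorem pair_interiorDifferential (x y : L) (θ : L') :
    B y (interiorDifferential 𝔞 B x θ) =
      𝔞.anchor x (B y θ) - 𝔞.anchor y (B x θ) - B (𝔞.bracket x y) θ := by
  have hlie := hB.pair_lieSection 𝔞 x y θ
  rw [hB.lieSection_eq, map_add, hB.pair_differentialFun] at hlie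
  linear_combination hlie

theorem anchor_dorfman (x : L) (θ : L') (f : R) :
    𝔞.anchor (-interiorDifferential 𝔟 B.flip θ x) f + 𝔟.anchor (lieSection 𝔞 B x θ) f -
        (𝔞.anchor x (𝔟.anchor θ f) - 𝔟.anchor θ (𝔞.anchor x f)) =
      -B (leibnizDefect 𝔞 𝔟 B f x) θ := by
  have hinterior := hB.flip.pair_interiorDifferential 𝔟 θ (differentialFun 𝔞 B f) x
  have hlie := hB.pair_lieSection 𝔞 x (differentialFun 𝔟 B.flip f) θ
  have hlie' := hB.flip.pair_lieSection 𝔟 (differentialFun 𝔞 B f) θ x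
  have hanchor := fun η => hB.flip.pair_differentialFun 𝔟 η f
  simp only [LinearMap.flip_apply] at hinterior hlie' hanchor
  rw [hB.pair_differentialFun, hB.pair_differentialFun, 𝔟.bracket_skew θ, map_neg] at hinterior
  rw [hanchor, hanchor] at hlie
  rw [map_neg, Derivation.neg_apply, leibnizDefect, map_sub, LinearMap.sub_apply]
  linear_combination -hinterior + hlie - hlie'

theorem dorfmanDefect_isDerivationOver (x : L) (θ : L') :
    IsDerivationOver (fun f => -B (leibnizDefect 𝔞 𝔟 B f x) θ) (dorfmanDefectHom 𝔞 𝔟 B x θ) :=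
  funext (hB.anchor_dorfman 𝔞 𝔟 x θ) ▸
    ((hB.lieForm_isDerivationOver 𝔞 (-interiorDifferential 𝔟 B.flip θ x)).add
      (lieMulti_isDerivationOver 𝔟 (lieSection 𝔞 B x θ))).sub
      ((hB.lieForm_isDerivationOver 𝔞 x).commutator (lieMulti_isDerivationOver 𝔟 θ))

end HasDualBasis

namespace IsTopPair

variable {n : ℕ} {Ω : ExteriorAlgebra R L'} {V : ExteriorAlgebra R L} (h : IsTopPair B n Ω V)

include h

theorem divergence_lieSection (x : L) (θ : L') :
    divergence 𝔟 B.flip V (lieSection 𝔞 B x θ) =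
      divergence 𝔟 B.flip V (interiorDifferential 𝔞 B x θ) +
        laplacianFun 𝔟 𝔞 B.flip V (B x θ) := by
  rw [h.dual.lieSection_eq, h.flip.divergence_add, h.flip.laplacianFun_eq, LinearMap.flip_flip]

theorem pair_laplacianSection_flip (x : L) (θ : L') :
    B x (laplacianSection 𝔟 𝔞 B.flip V θ) = 𝔞.anchor x (divergence 𝔟 B.flip V θ) -
      divergence 𝔟 B.flip V (interiorDifferential 𝔞 B x θ) +
      pair B (differential 𝔟 B.flip (ι R x)) (differential 𝔞 B (ι R θ)) := by
  rw [← LinearMap.flip_apply, h.flip.pair_laplacianSection, pair_flip, LinearMap.flip_flip]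

theorem dorfmanDefect_form (x : L) (θ : L') :
    dorfmanDefect 𝔞 𝔟 B x θ Ω =
      (2 * pair B (differential 𝔟 B.flip (ι R x)) (differential 𝔞 B (ι R θ)) +
        (laplacianFun 𝔟 𝔞 B.flip V (B x θ) -
          (B x (laplacianSection 𝔟 𝔞 B.flip V θ) + B (laplacianSection 𝔞 𝔟 B Ω x) θ))) • Ω := by
  change lieForm 𝔞 B (-interiorDifferential 𝔟 B.flip θ x) Ω +
    lieMulti 𝔟 (lieSection 𝔞 B x θ) Ω -
    (lieForm 𝔞 B x (lieMulti 𝔟 θ Ω) - lieMulti 𝔟 θ (lieForm 𝔞 B x Ω)) = _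
  simp only [h.lieForm_form, h.flip.lieMulti_multi, (h.dual.lieForm_isDerivationOver 𝔞 x).map_smul,
    (lieMulti_isDerivationOver 𝔟 θ).map_smul, h.divergence_neg, h.divergence_lieSection,
    h.pair_laplacianSection, h.pair_laplacianSection_flip, smul_smul, ← add_smul, ← sub_smul,
    map_neg]
  congr 1
  ring

theorem isFrameTrace_dorfmanDefect_iff {x : L} {θ : L'} {T : L' →ₗ[R] L'}
    (hT : ∀ α, ι R (T α) = dorfmanDefect 𝔞 𝔟 B x θ (ι R α))
    (hY : ∀ f, -B (leibnizDefect 𝔞 𝔟 B f x) θ = 0) :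
    IsFrameTrace B T
        (2 * pair B (differential 𝔟 B.flip (ι R x)) (differential 𝔞 B (ι R θ))) ↔
      laplacianFun 𝔟 𝔞 B.flip V (B x θ) =
        B x (laplacianSection 𝔟 𝔞 B.flip V θ) + B (laplacianSection 𝔞 𝔟 B Ω x) θ := by
  rw [h.isFrameTrace_iff (h.dual.dorfmanDefect_isDerivationOver 𝔞 𝔟 x θ) hT hY, ← sub_eq_zero,
    dorfmanDefectHom, AddMonoidHom.mk'_apply, h.dorfmanDefect_form, ← sub_smul,
    add_sub_cancel_left, ← sub_eq_zero (a := laplacianFun _ _ _ _ _)]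
  exact ⟨fun hr => h.smul_form_injective (hr.trans (zero_smul R Ω).symm),
    fun hr => by rw [hr, zero_smul]⟩

theorem laplacianCompatible_iff_exists_trace :
    LaplacianCompatible 𝔞 𝔟 B Ω V ↔ ∀ (x : L) (θ : L'), ∃ T : L' →ₗ[R] L',
      (∀ α, ι R (T α) = dorfmanDefect 𝔞 𝔟 B x θ (ι R α)) ∧
      IsFrameTrace B T
        (2 * pair B (differential 𝔟 B.flip (ι R x)) (differential 𝔞 B (ι R θ))) := by
  refine ⟨fun H x θ => ?_, fun H x θ => ?_⟩
  · have hY : ∀ f, -B (leibnizDefect 𝔞 𝔟 B f x) θ = 0 := fun f => by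
      rw [h.leibnizDefect_eq_zero H, map_zero, LinearMap.zero_apply, neg_zero]
    obtain ⟨T, hT⟩ := (h.dual.dorfmanDefect_isDerivationOver 𝔞 𝔟 x θ).exists_linearMap hY
    exact ⟨T, hT, (h.isFrameTrace_dorfmanDefect_iff 𝔞 𝔟 hT hY).mpr (H x θ)⟩
  · obtain ⟨T, hT, ht⟩ := H x θ
    have hY : ∀ f, -B (leibnizDefect 𝔞 𝔟 B f x) θ = 0 := by
      rcases eq_or_ne n 0 with hn | hn
      · intro f
        rw [h.section_eq_zero hn (leibnizDefect 𝔞 𝔟 B f x), map_zero, LinearMap.zero_apply,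
          neg_zero]
      · exact h.apply_fun_eq_zero (h.dual.dorfmanDefect_isDerivationOver 𝔞 𝔟 x θ) hT hn
    exact (h.isFrameTrace_dorfmanDefect_iff 𝔞 𝔟 hT hY).mp ht

end IsTopPair

end Dorfman

section BaseLie

variable {𝕜 R : Type*} [Field 𝕜] [CommRing R] [Algebra 𝕜 R]

theorem lieBaseForm_spec (X : Derivation 𝕜 R R) :
    (∀ f, lieBaseForm X (algebraMap R _ f) = algebraMap R _ (X f)) ∧
    (∀ α, lieBaseForm X (ι R α) = ι R (lieOneForm X α)) ∧
    ∀ a b, lieBaseForm X (a * b) = a * lieBaseForm X b + lieBaseForm X a * b :=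
  (exists_lieBaseForm X).choose_spec

theorem lieBaseForm_isDerivationOver (X : Derivation 𝕜 R R) :
    IsDerivationOver X (lieBaseForm X) where
  map_algebraMap := (lieBaseForm_spec X).1
  map_mul a b := ((lieBaseForm_spec X).2.2 a b).trans (add_comm _ _)
  map_ι_mem α := (lieBaseForm_spec X).2.1 α ▸ ι_mem _

theorem lieBaseForm_add (X Y : Derivation 𝕜 R R) :
    lieBaseForm (X + Y) = lieBaseForm X + lieBaseForm Y := by
  refine (lieBaseForm_isDerivationOver _).ext
    ((lieBaseForm_isDerivationOver X).add (lieBaseForm_isDerivationOver Y)) rfl fun α => ?_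
  rw [AddMonoidHom.add_apply, (lieBaseForm_spec _).2.1, (lieBaseForm_spec _).2.1,
    (lieBaseForm_spec _).2.1, ← map_add]
  congr 1
  refine LinearMap.ext fun Z => ?_
  change (X + Y) (α Z) - α ⁅X + Y, Z⁆ = X (α Z) - α ⁅X, Z⁆ + (Y (α Z) - α ⁅Y, Z⁆)
  rw [Derivation.add_apply, add_lie, map_add]
  ring

theorem lieBaseForm_zero : lieBaseForm (0 : Derivation 𝕜 R R) = 0 := by
  have hadd := lieBaseForm_add (0 : Derivation 𝕜 R R) 0
  rw [add_zero] at hadd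
  exact left_eq_add.mp hadd

theorem lieBaseForm_lie (X Y : Derivation 𝕜 R R) :
    lieBaseForm ⁅X, Y⁆ =
      (lieBaseForm X).comp (lieBaseForm Y) - (lieBaseForm Y).comp (lieBaseForm X) := by
  refine (lieBaseForm_isDerivationOver _).ext
    ((lieBaseForm_isDerivationOver X).commutator (lieBaseForm_isDerivationOver Y))
    (funext Derivation.commutator_apply) fun α => ?_
  simp only [AddMonoidHom.sub_apply, AddMonoidHom.comp_apply, (lieBaseForm_spec _).2.1]
  rw [← map_sub]
  congr 1
  refine LinearMap.ext fun Z => ?_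
  change ⁅X, Y⁆ (α Z) - α ⁅⁅X, Y⁆, Z⁆ =
    X (Y (α Z) - α ⁅Y, Z⁆) - (Y (α ⁅X, Z⁆) - α ⁅Y, ⁅X, Z⁆⁆) -
      (Y (X (α Z) - α ⁅X, Z⁆) - (X (α ⁅Y, Z⁆) - α ⁅X, ⁅Y, Z⁆⁆))
  rw [Derivation.commutator_apply, lie_lie, map_sub, map_sub, map_sub]
  ring

end BaseLie

section Modular

variable {𝕜 R L L' : Type*} [Field 𝕜] [CharZero 𝕜] [CommRing R] [Algebra 𝕜 R]
  [AddCommGroup L] [Module R L] [AddCommGroup L'] [Module R L']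
  (𝔞 : LieAlgebroid 𝕜 R L) (𝔟 : LieAlgebroid 𝕜 R L') {B : L →ₗ[R] L' →ₗ[R] R}
  {Ω : ExteriorAlgebra R L'} {V : ExteriorAlgebra R L} {s : BaseForms 𝕜 R} {X₀ : L} {ξ₀ : L'}

theorem half_mul_two : algebraMap 𝕜 R (1 / 2) * 2 = 1 := by
  rw [← map_ofNat (algebraMap 𝕜 R) 2, ← map_mul, one_div_mul_cancel two_ne_zero, map_one]

theorem eq_half_mul_iff {a b : R} : a = algebraMap 𝕜 R (1 / 2) * b ↔ 2 * a = b := by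
  have h := half_mul_two (𝕜 := 𝕜) (R := R)
  constructor
  · rintro rfl
    linear_combination b * h
  · rintro rfl
    linear_combination -a * h

theorem lieSum_isDualDerivation (hB : HasDualBasis B) (x : L) (ξ : L') :
    IsDualDerivation B (fun f => 𝔟.anchor ξ f + 𝔞.anchor x f) (lieSum 𝔟 𝔞 B.flip ξ x)
      (lieSum 𝔞 𝔟 B x ξ) := by
  rw [lieSum, lieSum, add_comm (lieForm 𝔞 B x)]
  exact (hB.flip.lie_isDualDerivation 𝔟 ξ).flip.add (hB.lie_isDualDerivation 𝔞 x)

theorem HasDualBasis.lieSum_ι (hB : HasDualBasis B) (x u : L) (ξ : L') :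
    lieSum 𝔟 𝔞 B.flip ξ x (ι R u) = ι R (lieSection 𝔟 B.flip ξ u + 𝔞.bracket x u) := by
  rw [lieSum, AddMonoidHom.add_apply, hB.flip.lieForm_ι, lieMulti,
    (schouten_spec 𝔞).section_section, map_add]

variable (B) in
/-- The pairing with a fixed form, as a linear functional on multisections. -/
def pairRight (w : ExteriorAlgebra R L') : ExteriorAlgebra R L →ₗ[R] R where
  toFun U := pair B U w
  map_add' U W := pair_add_left B U W w
  map_smul' c U := by simp [pair, interior_smul]

namespace IsTopPair

variable {n : ℕ} (h : IsTopPair B n Ω V)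

include h

theorem lieBaseForm_anchor (hξ₀ : IsModularCocycle 𝔞 B V s ξ₀) (u : L) :
    lieBaseForm (𝔞.anchor u) s = (B u ξ₀ - divergence 𝔞 B Ω u) • s := by
  have hcocycle := congrArg
    (TensorProduct.lift (LinearMap.lsmul R (BaseForms 𝕜 R) ∘ₗ pairRight B Ω)) (hξ₀ u)
  have hone : pairRight B Ω V = 1 := h.pair_eq_one
  rw [h.lieMulti_multi 𝔞] at hcocycle
  simp only [map_add, map_smul, TensorProduct.lift.tmul, LinearMap.comp_apply, hone,
    LinearMap.lsmul_apply, one_smul, LinearMap.smul_apply] at hcocycle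
  rw [sub_smul, ← hcocycle, add_sub_cancel_left]

variable (hs : ∀ r : R, r • s = 0 → r = 0) (hX₀ : IsModularCocycle 𝔟 B.flip Ω s X₀)
  (hξ₀ : IsModularCocycle 𝔞 B V s ξ₀)

include hs hX₀ hξ₀

theorem modular_dorfman {u : L} {θ : L'} (hdefect : ∀ f, B (leibnizDefect 𝔞 𝔟 B f u) θ = 0) :
    B X₀ (lieSection 𝔞 B u θ) - divergence 𝔟 B.flip V (lieSection 𝔞 B u θ) =
      𝔞.anchor u (B X₀ θ - divergence 𝔟 B.flip V θ) -
        𝔟.anchor θ (B u ξ₀ - divergence 𝔞 B Ω u) +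
        (B (interiorDifferential 𝔟 B.flip θ u) ξ₀ -
          divergence 𝔞 B Ω (interiorDifferential 𝔟 B.flip θ u)) := by
  have hanchor : 𝔟.anchor (lieSection 𝔞 B u θ) =
      ⁅𝔞.anchor u, 𝔟.anchor θ⁆ + 𝔞.anchor (interiorDifferential 𝔟 B.flip θ u) := by
    ext f
    have hdorfman := h.dual.anchor_dorfman 𝔞 𝔟 u θ f
    rw [hdefect, map_neg, Derivation.neg_apply] at hdorfman
    rw [Derivation.add_apply, Derivation.commutator_apply]
    linear_combination hdorfman
  -- Both sides are the coefficient of `s` in its Lie derivative along the field above.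
  have hlie := h.lieBaseForm_anchor 𝔞 hξ₀
  have hlie' := h.flip.lieBaseForm_anchor 𝔟 hX₀
  have hform := hlie' (lieSection 𝔞 B u θ)
  rw [hanchor, lieBaseForm_add, AddMonoidHom.add_apply, lieBaseForm_lie, AddMonoidHom.sub_apply,
    AddMonoidHom.comp_apply, AddMonoidHom.comp_apply, hlie, hlie, hlie',
    (lieBaseForm_isDerivationOver _).map_smul, (lieBaseForm_isDerivationOver _).map_smul, hlie,
    hlie', smul_smul, smul_smul, ← add_smul, ← add_smul, ← sub_smul, ← add_smul, ← sub_eq_zero,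
    ← sub_smul] at hform
  have hcoeff := hs _ hform
  simp only [LinearMap.flip_apply] at hcoeff
  linear_combination -hcoeff

theorem pair_laplacianSection_sub {u : L} {θ : L'}
    (hdefect : ∀ f, B (leibnizDefect 𝔞 𝔟 B f u) θ = 0) :
    B u (laplacianSection 𝔟 𝔞 B.flip V θ) - B (laplacianSection 𝔞 𝔟 B Ω u) θ -
        laplacianFun 𝔟 𝔞 B.flip V (B u θ) =
      -B (lieSection 𝔟 B.flip ξ₀ u + 𝔞.bracket X₀ u) θ := by
  have hmodular := h.modular_dorfman 𝔞 𝔟 hs hX₀ hξ₀ hdefect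
  have hinterior := h.dual.flip.pair_interiorDifferential 𝔟 θ ξ₀ u
  have hξ := h.dual.flip.pair_lieSection 𝔟 ξ₀ θ u
  have hX := h.dual.pair_lieSection 𝔞 u X₀ θ
  simp only [LinearMap.flip_apply] at hinterior hξ
  rw [𝔟.bracket_skew, map_neg] at hinterior
  rw [𝔞.bracket_skew, map_neg, LinearMap.neg_apply] at hX
  rw [h.divergence_lieSection, hinterior, hX, map_sub, map_sub] at hmodular
  rw [map_add, LinearMap.add_apply, hξ, h.pair_laplacianSection, h.pair_laplacianSection_flip]
  linear_combination hmodular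

theorem laplacianFun_add_flip {f : R}
    (hanchor : ∀ r, 𝔞.anchor (differentialFun 𝔟 B.flip f) r +
      𝔟.anchor (differentialFun 𝔞 B f) r = 0) :
    laplacianFun 𝔞 𝔟 B Ω f + laplacianFun 𝔟 𝔞 B.flip V f =
      𝔟.anchor ξ₀ f + 𝔞.anchor X₀ f := by
  have hfield : 𝔞.anchor (differentialFun 𝔟 B.flip f) + 𝔟.anchor (differentialFun 𝔞 B f) = 0 :=
    Derivation.ext hanchor
  have hform := congrArg (lieBaseForm · s) hfield
  simp only [lieBaseForm_add, AddMonoidHom.add_apply, lieBaseForm_zero,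
    AddMonoidHom.zero_apply] at hform
  rw [h.lieBaseForm_anchor 𝔞 hξ₀, h.flip.lieBaseForm_anchor 𝔟 hX₀, ← add_smul,
    LinearMap.flip_apply, h.dual.pair_differentialFun, ← LinearMap.flip_apply (f := B),
    h.dual.flip.pair_differentialFun] at hform
  rw [h.laplacianFun_eq, h.flip.laplacianFun_eq, LinearMap.flip_flip]
  linear_combination -hs _ hform

omit hs hX₀ hξ₀ in
theorem laplacian_eq_half_lieSum_iff :
    ((∀ f : R, laplacian 𝔞 𝔟 B Ω (algebraMap R _ f) =
        algebraMap 𝕜 R (1 / 2) • lieSum 𝔟 𝔞 B.flip ξ₀ X₀ (algebraMap R _ f)) ∧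
      ∀ u : L, laplacian 𝔞 𝔟 B Ω (ι R u) =
        algebraMap 𝕜 R (1 / 2) • lieSum 𝔟 𝔞 B.flip ξ₀ X₀ (ι R u)) ↔
      (∀ f : R, laplacianFun 𝔞 𝔟 B Ω f =
        algebraMap 𝕜 R (1 / 2) * (𝔟.anchor ξ₀ f + 𝔞.anchor X₀ f)) ∧
      ∀ u : L, laplacianSection 𝔞 𝔟 B Ω u =
        algebraMap 𝕜 R (1 / 2) • (lieSection 𝔟 B.flip ξ₀ u + 𝔞.bracket X₀ u) := by
  have hL := lieSum_isDualDerivation 𝔞 𝔟 h.dual X₀ ξ₀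
  refine and_congr (forall_congr' fun f => ?_) (forall_congr' fun u => ?_)
  · rw [h.laplacian_algebraMap, hL.left.map_algebraMap, Algebra.smul_def, ← map_mul,
      algebraMap_inj]
  · rw [h.laplacian_ι, h.dual.lieSum_ι, ← map_smul, ExteriorAlgebra.ι_inj]

theorem laplacianCompatible_of_eq_half
    (hfun : ∀ f : R, laplacianFun 𝔞 𝔟 B Ω f =
      algebraMap 𝕜 R (1 / 2) * (𝔟.anchor ξ₀ f + 𝔞.anchor X₀ f))
    (hsection : ∀ u : L, laplacianSection 𝔞 𝔟 B Ω u =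
      algebraMap 𝕜 R (1 / 2) • (lieSection 𝔟 B.flip ξ₀ u + 𝔞.bracket X₀ u)) :
    LaplacianCompatible 𝔞 𝔟 B Ω V := by
  have hdefect : ∀ f u, leibnizDefect 𝔞 𝔟 B f u = 0 := fun f u => by
    have hsmul := h.laplacianSection_smul 𝔞 𝔟 f u
    rw [hsection, hsection, hfun, h.dual.flip.lieSection_smul, 𝔞.leibniz] at hsmul
    rw [← sub_eq_zero.mpr hsmul.symm]
    module
  intro u θ
  have hsub := h.pair_laplacianSection_sub 𝔞 𝔟 hs hX₀ hξ₀ (u := u) (θ := θ) fun f => by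
    rw [hdefect, map_zero, LinearMap.zero_apply]
  have hhalf : B (laplacianSection 𝔞 𝔟 B Ω u) θ =
      algebraMap 𝕜 R (1 / 2) * B (lieSection 𝔟 B.flip ξ₀ u + 𝔞.bracket X₀ u) θ := by
    rw [hsection, map_smul, LinearMap.smul_apply, smul_eq_mul]
  linear_combination -hsub - eq_half_mul_iff.mp hhalf

theorem laplacianCompatible_iff_laplacian_eq :
    LaplacianCompatible 𝔞 𝔟 B Ω V ↔
      (∀ f : R, laplacian 𝔞 𝔟 B Ω (algebraMap R _ f) =
        algebraMap 𝕜 R (1 / 2) • lieSum 𝔟 𝔞 B.flip ξ₀ X₀ (algebraMap R _ f)) ∧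
      ∀ u : L, laplacian 𝔞 𝔟 B Ω (ι R u) =
        algebraMap 𝕜 R (1 / 2) • lieSum 𝔟 𝔞 B.flip ξ₀ X₀ (ι R u) := by
  rw [h.laplacian_eq_half_lieSum_iff]
  refine ⟨fun H => ⟨fun f => eq_half_mul_iff.mpr ?_, fun u => h.dual.flip.ext_right fun θ => ?_⟩,
    fun H => h.laplacianCompatible_of_eq_half 𝔞 𝔟 hs hX₀ hξ₀ H.1 H.2⟩
  · rw [two_mul, ← h.laplacianFun_add_flip 𝔞 𝔟 hs hX₀ hξ₀ (h.anchor_add_anchor_eq_zero H f),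
      h.laplacianFun_flip_eq H]
  · have hsub := h.pair_laplacianSection_sub 𝔞 𝔟 hs hX₀ hξ₀ (u := u) (θ := θ) fun f => by
      rw [h.leibnizDefect_eq_zero H, map_zero, LinearMap.zero_apply]
    rw [map_smul, smul_eq_mul, LinearMap.flip_apply, LinearMap.flip_apply]
    refine eq_half_mul_iff.mpr ?_
    linear_combination -hsub - H u θ

theorem laplacian_eq_half_lieSum (H : ∀ u v, laplacian 𝔞 𝔟 B Ω (u * v) =
      laplacian 𝔞 𝔟 B Ω u * v + u * laplacian 𝔞 𝔟 B Ω v) (u : ExteriorAlgebra R L) :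
    laplacian 𝔞 𝔟 B Ω u = algebraMap 𝕜 R (1 / 2) • lieSum 𝔟 𝔞 B.flip ξ₀ X₀ u := by
  obtain ⟨hfun, hsection⟩ := (h.laplacianCompatible_iff_laplacian_eq 𝔞 𝔟 hs hX₀ hξ₀).mp
    ((h.laplacianCompatible_iff 𝔞 𝔟).mp (h.laplacian_pairing 𝔞 𝔟 H))
  induction u using ExteriorAlgebra.induction with
  | algebraMap r => exact hfun r
  | ι x => exact hsection x
  | mul a b ha hb =>
    rw [H, ha, hb, (lieSum_isDualDerivation 𝔞 𝔟 h.dual X₀ ξ₀).left.map_mul, smul_add,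
      smul_mul_assoc, mul_smul_comm]
  | add a b ha hb => rw [h.laplacian_add, ha, hb, map_add, smul_add]

omit hs hX₀ hξ₀ in
theorem laplacian_mul_of_eq_half
    (H : ∀ u, laplacian 𝔞 𝔟 B Ω u = algebraMap 𝕜 R (1 / 2) • lieSum 𝔟 𝔞 B.flip ξ₀ X₀ u)
    (u v : ExteriorAlgebra R L) : laplacian 𝔞 𝔟 B Ω (u * v) =
      laplacian 𝔞 𝔟 B Ω u * v + u * laplacian 𝔞 𝔟 B Ω v := by
  rw [H, H, H, (lieSum_isDualDerivation 𝔞 𝔟 h.dual X₀ ξ₀).left.map_mul, smul_add, smul_mul_assoc,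
    mul_smul_comm]

end IsTopPair

end Modular

section LocalGenerators

variable {R L L' : Type*} [CommRing R] [AddCommGroup L] [Module R L] [AddCommGroup L'] [Module R L']
  {B : L →ₗ[R] L' →ₗ[R] R} {n : ℕ}

theorem pow_smul_exteriorPower_eq_zero {r : R} {v : Fin n → L}
    (hr : ∀ x, r • x ∈ Submodule.span R (Set.range v)) {u : ExteriorAlgebra R L}
    (hu : u ∈ ⋀[R]^(n + 1) L) : r ^ (n + 1) • u = 0 := by
  simp only [Submodule.mem_span_range_iff_exists_fun] at hr
  choose c hc using hr
  rw [← ExteriorAlgebra.ιMulti_span_fixedDegree] at hu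
  induction hu using Submodule.span_induction with
  | mem u hu =>
    obtain ⟨x, rfl⟩ := hu
    have hsmul := (ExteriorAlgebra.ιMulti R (M := L) (n + 1)).map_smul_univ (fun _ => r) x
    rw [Finset.prod_const, Finset.card_univ, Fintype.card_fin] at hsmul
    simp only [← hsmul, ← hc]
    refine ((ExteriorAlgebra.ιMulti R (n + 1)).toMultilinearMap.map_sum
      fun i k => c (x i) k • v k).trans (Finset.sum_eq_zero fun κ _ => ?_)
    have hrepeat : ¬Function.Injective fun i => v (κ i) := fun hinj =>
      Nat.not_succ_le_self n (by simpa using Fintype.card_le_of_injective κ (.of_comp hinj))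
    exact ((ExteriorAlgebra.ιMulti R (n + 1)).map_smul_univ _ _).trans
      (by rw [(ExteriorAlgebra.ιMulti R (n + 1)).map_eq_zero_of_not_injective _ hrepeat, smul_zero])
  | zero => exact smul_zero _
  | add u w _ _ hu hw => rw [smul_add, hu, hw, add_zero]
  | smul a u _ hu => rw [smul_comm, hu, smul_zero]

theorem HasDualBasis.exists_smul_mem_span (hB : HasDualBasis B) {r : R} {v : Fin n → L}
    (hr : ∀ x, r • x ∈ Submodule.span R (Set.range v)) :
    ∃ η : Fin n → L', ∀ θ, r • θ ∈ Submodule.span R (Set.range η) := by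
  obtain ⟨J, _, e, ε, -, hε⟩ := hB
  simp only [Submodule.mem_span_range_iff_exists_fun] at hr ⊢
  choose c hc using hr
  refine ⟨fun k => ∑ i, c (e i) k • ε i, fun θ => ⟨fun k => B (v k) θ, ?_⟩⟩
  have hpair : ∀ i, ∑ k, B (v k) θ * c (e i) k = r * B (e i) θ := fun i => by
    have hexpand := congrArg (B · θ) (hc (e i))
    simpa only [map_sum, map_smul, LinearMap.sum_apply, LinearMap.smul_apply, smul_eq_mul,
      mul_comm (c _ _)] using hexpand
  calc ∑ k, B (v k) θ • ∑ i, c (e i) k • ε i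
      = ∑ i, (∑ k, B (v k) θ * c (e i) k) • ε i := by
        simp only [Finset.smul_sum, Finset.sum_smul, smul_smul]
        exact Finset.sum_comm
    _ = r • ∑ i, B (e i) θ • ε i := by simp only [hpair, Finset.smul_sum, smul_smul]
    _ = r • θ := by rw [← hε]

variable (B) in
/-- The value `Ω(v₁, …, vₙ)` of a form on sections. -/
def formEval (Ω : ExteriorAlgebra R L') (v : Fin n → L) : R :=
  pair B (ExteriorAlgebra.ιMulti R n v) Ω

theorem span_formEval_eq_top {Ω : ExteriorAlgebra R L'} {V : ExteriorAlgebra R L}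
    (hV : V ∈ ⋀[R]^n L) (hΩV : pair B V Ω = 1) :
    Ideal.span (Set.range (formEval B Ω : (Fin n → L) → R)) = ⊤ := by
  have himage : pair B V Ω ∈ (⋀[R]^n L).map (pairRight B Ω) := ⟨V, hV, rfl⟩
  rw [← ExteriorAlgebra.ιMulti_span_fixedDegree, Submodule.map_span, ← Set.range_comp, hΩV]
    at himage
  exact (Ideal.eq_top_iff_one _).mpr himage

theorem isTopPair_of_formEval_sq_smul_mem_span (hB : HasDualBasis B) {Ω : ExteriorAlgebra R L'}
    (hΩ : Ω ∈ ⋀[R]^n L') {V : ExteriorAlgebra R L} (hV : V ∈ ⋀[R]^n L) (hΩV : pair B V Ω = 1)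
    (hspan : ∀ (v : Fin n → L) x, formEval B Ω v ^ 2 • x ∈ Submodule.span R (Set.range v)) :
    IsTopPair B n Ω V := by
  have htop := span_formEval_eq_top hV hΩV
  refine ⟨hB, hΩ, hV, hΩV, fun u hu => ?_, fun u hu => ?_⟩
  all_goals
    rw [← Submodule.mem_bot R]
    refine Submodule.mem_of_span_eq_top_of_smul_pow_mem _ _ htop u ?_
    rintro ⟨_, v, rfl⟩
    refine ⟨2 * (n + 1), ?_⟩
    rw [pow_mul, Submodule.mem_bot]
  · exact pow_smul_exteriorPower_eq_zero (hspan v) hu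
  · obtain ⟨η, hη⟩ := hB.exists_smul_mem_span (hspan v)
    exact pow_smul_exteriorPower_eq_zero hη hu

end LocalGenerators

section FibreTrace

theorem trace_eq_sum_of_frame {K P J : Type*} [CommRing K] [AddCommGroup P] [Module K P]
    [Module.Free K P] [Module.Finite K P] [Fintype J] {b : J → P} {φ : J → Module.Dual K P}
    (hb : ∀ y, y = ∑ i, φ i y • b i) (T : P →ₗ[K] P) :
    LinearMap.trace K P T = ∑ i, φ i (T (b i)) := by
  have hT : T = ∑ i, (φ i).smulRight (T (b i)) := LinearMap.ext fun y => by
    conv_lhs => rw [hb y]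
    simp
  conv_lhs => rw [hT]
  simp

variable {R L L' : Type*} [CommRing R] [AddCommGroup L] [Module R L] [AddCommGroup L']
  [Module R L'] {B : L →ₗ[R] L' →ₗ[R] R}

theorem HasDualBasis.iff_isFrameTrace_of_forall (hB : HasDualBasis B) {T : L' →ₗ[R] L'} {t : R}
    {p : Prop} (hp : ∀ (J : Type) (_ : Fintype J) (e : J → L) (ε : J → L'),
      (∀ θ, θ = ∑ i, B (e i) θ • ε i) → (p ↔ ∑ i, B (e i) (T (ε i)) = t)) :
    p ↔ IsFrameTrace B T t := by
  refine ⟨fun h J _ e ε _ hε => (hp J _ e ε hε).mp h, fun h => ?_⟩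
  obtain ⟨J, _, e, ε, he, hε⟩ := hB
  exact (hp J _ e ε hε).mpr (h J _ e ε he hε)

variable {K P : Type*} [CommRing K] [AddCommGroup P] [Module K P] [Module.Free K P]
  [Module.Finite K P] {φ : R →+* K} {ev : L' →ₛₗ[φ] P} {coev : L → Module.Dual K P}

theorem exists_trace_iff_of_frame (hev : Function.Surjective ev)
    (hpair : ∀ x θ, coev x (ev θ) = φ (B x θ)) {J : Type*} [Fintype J] {e : J → L} {ε : J → L'}
    (hε : ∀ θ, θ = ∑ i, B (e i) θ • ε i) (T : L' →ₗ[R] L') (c : K) :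
    (∃ Tp : P →ₗ[K] P, (∀ θ, ev (T θ) = Tp (ev θ)) ∧ LinearMap.trace K P Tp = c) ↔
      φ (∑ i, B (e i) (T (ε i))) = c := by
  have hframe : ∀ y, y = ∑ i, coev (e i) y • ev (ε i) := fun y => by
    obtain ⟨θ, rfl⟩ := hev y
    conv_lhs => rw [hε θ]
    simp only [map_sum, map_smulₛₗ, hpair]
  have htrace : ∀ Tp : P →ₗ[K] P, (∀ θ, ev (T θ) = Tp (ev θ)) →
      LinearMap.trace K P Tp = φ (∑ i, B (e i) (T (ε i))) := fun Tp hTp => by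
    simp only [trace_eq_sum_of_frame hframe, map_sum, ← hTp, hpair]
  have hexists : ∃ Tp : P →ₗ[K] P, ∀ θ, ev (T θ) = Tp (ev θ) := by
    refine ⟨∑ i, (coev (e i)).smulRight (ev (T (ε i))), fun θ => ?_⟩
    conv_lhs => rw [hε θ]
    simp only [map_sum, map_smul, map_smulₛₗ, LinearMap.sum_apply, LinearMap.smulRight_apply, hpair]
  constructor
  · rintro ⟨Tp, hTp, htr⟩
    rw [← htrace Tp hTp, htr]
  · intro h
    obtain ⟨Tp, hTp⟩ := hexists
    exact ⟨Tp, hTp, (htrace Tp hTp).trans h⟩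

end FibreTrace

theorem finite_fibre (𝕜 : Type*) [RCLike 𝕜] (n : ℕ) {M : Type*} [TopologicalSpace M]
    {A : M → Type*} [TopologicalSpace (Bundle.TotalSpace (Fin n → 𝕜) A)]
    [∀ p, TopologicalSpace (A p)] [∀ p, AddCommGroup (A p)] [∀ p, Module 𝕜 (A p)]
    [FiberBundle (Fin n → 𝕜) A] [VectorBundle 𝕜 (Fin n → 𝕜) A] (p : M) : Module.Finite 𝕜 (A p) :=
  .equiv ((trivializationAt (Fin n → 𝕜) A p).linearEquivAt 𝕜 p
    (FiberBundle.mem_baseSet_trivializationAt' p)).symm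

section Geometry

variable {𝕜 : Type*} [RCLike 𝕜] {m n : ℕ} {M : Type*} [TopologicalSpace M]
  [ChartedSpace (EuclideanSpace ℝ (Fin m)) M]

theorem eq_iff_evalAt {f g : Fn 𝕜 m M} : f = g ↔ ∀ p, evalAt p f = evalAt p g :=
  ⟨fun h _ => by rw [h], fun h => Subtype.ext (funext h)⟩

theorem IsVolumeForm.smul_eq_zero {s : BaseForms 𝕜 (Fn 𝕜 m M)} (hs : IsVolumeForm s)
    (f : Fn 𝕜 m M) (hf : f • s = 0) : f = 0 := by
  refine eq_iff_evalAt.mpr fun p => ?_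
  obtain ⟨Y, hY⟩ := hs.2 p
  have hmul : f * evalBaseForm s Y = 0 := by
    rw [evalBaseForm, ← pair_smul, hf]
    simp [pair]
  have hmul_p := congrArg (evalAt p) hmul
  rw [map_mul, map_zero] at hmul_p
  rw [map_zero]
  exact (mul_eq_zero.mp hmul_p).resolve_right hY

variable {A : M → Type*} [TopologicalSpace (Bundle.TotalSpace (Fin n → 𝕜) A)]
  [∀ p, TopologicalSpace (A p)] [∀ p, AddCommGroup (A p)] [∀ p, Module 𝕜 (A p)]
  [∀ p, Module ℝ (A p)] [FiberBundle (Fin n → 𝕜) A]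
  [VectorBundle 𝕜 (Fin n → 𝕜) A] [VectorBundle ℝ (Fin n → 𝕜) A]

/-- Evaluation of sections at a point, semilinear over evaluation of functions. -/
def secEval (p : M) : Sec 𝕜 m n M A →ₛₗ[evalAt (𝕜 := 𝕜) (m := m) p] A p where
  toFun x := x.1 p
  map_add' _ _ := rfl
  map_smul' _ _ := rfl

/-- Evaluation of dual sections at a point, semilinear over evaluation of functions. -/
def dualSecEval (p : M) :
    DualSec 𝕜 m n M A →ₛₗ[evalAt (𝕜 := 𝕜) (m := m) p] Module.Dual 𝕜 (A p) where
  toFun θ := θ.1 p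
  map_add' _ _ := rfl
  map_smul' _ _ := rfl

theorem dualSecEval_secEval (p : M) (x : Sec 𝕜 m n M A) (θ : DualSec 𝕜 m n M A) :
    dualSecEval p θ (secEval p x) = evalAt p (duality 𝕜 m n M A x θ) :=
  rfl

theorem sec_ext {x y : Sec 𝕜 m n M A} (h : ∀ p, secEval p x = secEval p y) : x = y :=
  Subtype.ext (funext h)

theorem secEval_update (p : M) (v : Fin n → Sec 𝕜 m n M A) (k : Fin n) (y : Sec 𝕜 m n M A) :
    (fun i => secEval p (Function.update v k y i)) =
      Function.update (fun i => secEval p (v i)) k (secEval p y) :=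
  funext fun i => Function.apply_update (fun _ => secEval p) v k y i

theorem formEval_sq_smul_mem_span (Ω : ExteriorAlgebra (Fn 𝕜 m M) (DualSec 𝕜 m n M A))
    (v : Fin n → Sec 𝕜 m n M A) (y : Sec 𝕜 m n M A) :
    formEval (duality 𝕜 m n M A) Ω v ^ 2 • y ∈ Submodule.span (Fn 𝕜 m M) (Set.range v) := by
  set F := formEval (n := n) (duality 𝕜 m n M A) Ω
  have hcramer : F v ^ 2 • y = ∑ k, (F v * F (Function.update v k y)) • v k := by
    refine sec_ext fun p => ?_
    obtain ⟨w, hw⟩ := exists_fibre_form (n := n) Ω p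
    have hF : ∀ v, evalAt p (F v) = w fun i => secEval p (v i) := hw
    have := finite_fibre 𝕜 n (A := A) p
    simp only [map_smulₛₗ, map_sum, map_pow, map_mul, hF, secEval_update]
    exact smul_eq_sum_update (finrank_fibre p) w _ _
  rw [hcramer]
  exact Submodule.sum_mem _ fun k _ => Submodule.smul_mem _ _ (Submodule.subset_span ⟨k, rfl⟩)

variable {Ω : ExteriorAlgebra (Fn 𝕜 m M) (DualSec 𝕜 m n M A)}
  {V : ExteriorAlgebra (Fn 𝕜 m M) (Sec 𝕜 m n M A)}

theorem isTopPair_duality (hΩ : Ω ∈ ⋀[Fn 𝕜 m M]^n (DualSec 𝕜 m n M A))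
    (hV : V ∈ ⋀[Fn 𝕜 m M]^n (Sec 𝕜 m n M A)) (hΩV : pair (duality 𝕜 m n M A) V Ω = 1) :
    IsTopPair (duality 𝕜 m n M A) n Ω V :=
  isTopPair_of_formEval_sq_smul_mem_span (hasDualBasis_duality Ω V hV hΩV) hΩ hV hΩV
    (formEval_sq_smul_mem_span Ω)

theorem secEval_surjective (hV : V ∈ ⋀[Fn 𝕜 m M]^n (Sec 𝕜 m n M A))
    (hΩV : pair (duality 𝕜 m n M A) V Ω = 1) (p : M) :
    Function.Surjective (secEval (𝕜 := 𝕜) (m := m) (n := n) (A := A) p) := by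
  intro y
  obtain ⟨w, hw⟩ := exists_fibre_form (n := n) Ω p
  obtain ⟨v, hv⟩ : ∃ v, evalAt p (formEval (n := n) (duality 𝕜 m n M A) Ω v) ≠ 0 := by
    by_contra! hzero
    have hle : Ideal.span (Set.range (formEval (n := n) (duality 𝕜 m n M A) Ω)) ≤
        RingHom.ker (evalAt p) := Ideal.span_le.mpr (Set.range_subset_iff.mpr hzero)
    rw [span_formEval_eq_top hV hΩV, top_le_iff] at hle
    exact RingHom.ker_ne_top _ hle
  have hwv : w (fun i => secEval p (v i)) ≠ 0 := hw v ▸ hv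
  have := finite_fibre 𝕜 n (A := A) p
  have hcramer := smul_eq_sum_update (finrank_fibre p) w (fun i => secEval p (v i)) y
  have hconst : ∀ c : 𝕜, evalAt p (algebraMap 𝕜 (Fn 𝕜 m M) c) = c := fun _ => rfl
  refine ⟨algebraMap 𝕜 (Fn 𝕜 m M) ((w fun i => secEval p (v i)) ^ 2)⁻¹ •
    ∑ k, algebraMap 𝕜 (Fn 𝕜 m M) ((w fun i => secEval p (v i)) *
      w (Function.update (fun i => secEval p (v i)) k y)) • v k, ?_⟩
  simp only [map_smulₛₗ, map_sum, hconst]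
  rw [← hcramer, inv_smul_smul₀ (pow_ne_zero 2 hwv)]

theorem dualSecEval_surjective (hV : V ∈ ⋀[Fn 𝕜 m M]^n (Sec 𝕜 m n M A))
    (hΩV : pair (duality 𝕜 m n M A) V Ω = 1) (p : M) :
    Function.Surjective (dualSecEval (𝕜 := 𝕜) (m := m) (n := n) (A := A) p) := by
  intro α
  obtain ⟨J, _, e, ε, he, -⟩ := hasDualBasis_duality Ω V hV hΩV
  have hconst : ∀ c : 𝕜, evalAt p (algebraMap 𝕜 (Fn 𝕜 m M) c) = c := fun _ => rfl
  refine ⟨∑ i, algebraMap 𝕜 (Fn 𝕜 m M) (α (secEval p (e i))) • ε i, LinearMap.ext fun y => ?_⟩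
  obtain ⟨x, rfl⟩ := secEval_surjective hV hΩV p y
  conv_rhs => rw [he x]
  simp only [map_sum, map_smulₛₗ, hconst, LinearMap.sum_apply, LinearMap.smul_apply,
    dualSecEval_secEval, smul_eq_mul, mul_comm, RingHom.id_apply]

theorem hasTrace_iff (hV : V ∈ ⋀[Fn 𝕜 m M]^n (Sec 𝕜 m n M A))
    (hΩV : pair (duality 𝕜 m n M A) V Ω = 1)
    (T : Sec 𝕜 m n M A →ₗ[Fn 𝕜 m M] Sec 𝕜 m n M A) (t : Fn 𝕜 m M) :
    HasTrace T t ↔ IsFrameTrace (duality 𝕜 m n M A).flip T t := by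
  refine (hasDualBasis_duality Ω V hV hΩV).flip.iff_isFrameTrace_of_forall ?_
  intro J _ e ε hε
  rw [eq_iff_evalAt]
  refine forall_congr' fun p => ?_
  have := finite_fibre 𝕜 n (A := A) p
  exact exists_trace_iff_of_frame (secEval_surjective hV hΩV p)
    (fun θ x => dualSecEval_secEval p x θ) hε T _

theorem hasDualTrace_iff (hV : V ∈ ⋀[Fn 𝕜 m M]^n (Sec 𝕜 m n M A))
    (hΩV : pair (duality 𝕜 m n M A) V Ω = 1)
    (T : DualSec 𝕜 m n M A →ₗ[Fn 𝕜 m M] DualSec 𝕜 m n M A) (t : Fn 𝕜 m M) :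
    HasDualTrace T t ↔ IsFrameTrace (duality 𝕜 m n M A) T t := by
  refine (hasDualBasis_duality Ω V hV hΩV).iff_isFrameTrace_of_forall ?_
  intro J _ e ε hε
  rw [eq_iff_evalAt]
  refine forall_congr' fun p => ?_
  have := finite_fibre 𝕜 n (A := A) p
  exact exists_trace_iff_of_frame (coev := fun x => Module.Dual.eval 𝕜 (A p) (secEval p x))
    (dualSecEval_surjective hV hΩV p) (dualSecEval_secEval p) hε T _

end Geometry

end LieAlgebroidPair

end

open ExteriorAlgebra (ι) in
theorem theorem2p4_general {𝕜 R L L' : Type*} [Field 𝕜] [CharZero 𝕜] [CommRing R] [Algebra 𝕜 R]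
    [AddCommGroup L] [Module R L] [AddCommGroup L'] [Module R L'] (𝔞 : LieAlgebroid 𝕜 R L)
    (𝔟 : LieAlgebroid 𝕜 R L') {B : L →ₗ[R] L' →ₗ[R] R} {n : ℕ} {Ω : ExteriorAlgebra R L'}
    {V : ExteriorAlgebra R L} {s : BaseForms 𝕜 R} {X₀ : L} {ξ₀ : L'} (h : IsTopPair B n Ω V)
    (hs : ∀ r : R, r • s = 0 → r = 0)
    (hX₀ : IsModularCocycle 𝔟 B.flip Ω s X₀) (hξ₀ : IsModularCocycle 𝔞 B V s ξ₀) :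
    let d := differential 𝔞 B
    let dStar := differential 𝔟 B.flip
    let Δ := laplacian 𝔞 𝔟 B Ω
    let ΔStar := laplacian 𝔟 𝔞 B.flip V
    let half : R := algebraMap 𝕜 R (1 / 2)
    let Lie := lieSum 𝔟 𝔞 B.flip ξ₀ X₀
    let LieStar := lieSum 𝔞 𝔟 B X₀ ξ₀
    List.TFAE [
      ∀ (k l : ℕ), ∀ u ∈ ⋀[R]^k L, ∀ v ∈ ⋀[R]^l L, dStar (schouten 𝔞 u v) =
        schouten 𝔞 (dStar u) v + (-1 : R) ^ (k + 1) • schouten 𝔞 u (dStar v),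
      ∀ (k l : ℕ), ∀ θ ∈ ⋀[R]^k L', ∀ η ∈ ⋀[R]^l L', d (schouten 𝔟 θ η) =
        schouten 𝔟 (d θ) η + (-1 : R) ^ (k + 1) • schouten 𝔟 θ (d η),
      ∀ u v, Δ (u * v) = Δ u * v + u * Δ v,
      ∀ θ η, ΔStar (θ * η) = ΔStar θ * η + θ * ΔStar η,
      ∀ u, Δ u = half • Lie u,
      ∀ θ, ΔStar θ = half • LieStar θ] ∧
    ((∀ (k l : ℕ), ∀ u ∈ ⋀[R]^k L, ∀ v ∈ ⋀[R]^l L, dStar (schouten 𝔞 u v) =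
        schouten 𝔞 (dStar u) v + (-1 : R) ^ (k + 1) • schouten 𝔞 u (dStar v)) →
      ∀ (u : L) (θ : L'), ΔStar (algebraMap R _ (B u θ)) =
        algebraMap R _ (pair B (ι R u) (ΔStar (ι R θ)) + pair B (Δ (ι R u)) (ι R θ))) ∧
    List.TFAE [
      ∀ (u : L) (θ : L'), ΔStar (algebraMap R _ (B u θ)) =
        algebraMap R _ (pair B (ι R u) (ΔStar (ι R θ)) + pair B (Δ (ι R u)) (ι R θ)),
      ∀ (u : L) (θ : L'), Δ (algebraMap R _ (B u θ)) =
        algebraMap R _ (pair B (ι R u) (ΔStar (ι R θ)) + pair B (Δ (ι R u)) (ι R θ)),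
      ∀ (u : L) (θ : L'), ∃ T : L' →ₗ[R] L',
        (∀ α, ι R (T α) = dorfmanDefect 𝔞 𝔟 B u θ (ι R α)) ∧
        IsFrameTrace B T (2 * pair B (dStar (ι R u)) (d (ι R θ))),
      ∀ (θ : L') (u : L), ∃ T : L →ₗ[R] L,
        (∀ x, ι R (T x) = dorfmanDefect 𝔟 𝔞 B.flip θ u (ι R x)) ∧
        IsFrameTrace B.flip T (2 * pair B.flip (d (ι R θ)) (dStar (ι R u))),
      (∀ f : R, Δ (algebraMap R _ f) = half • Lie (algebraMap R _ f)) ∧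
        ∀ u : L, Δ (ι R u) = half • Lie (ι R u),
      (∀ f : R, ΔStar (algebraMap R _ f) = half • LieStar (algebraMap R _ f)) ∧
        ∀ θ : L', ΔStar (ι R θ) = half • LieStar (ι R θ)] := by
  intro d dStar Δ ΔStar half Lie LieStar
  have hL := lieSum_isDualDerivation 𝔞 𝔟 h.dual X₀ ξ₀
  have hhalf : IsUnit half := .of_mul_eq_one _ half_mul_two
  refine ⟨?_, fun H => h.laplacian_pairing 𝔞 𝔟
    ((h.differential_schouten_iff_laplacian_mul 𝔞 𝔟).mp H), ?_⟩
  · tfae_have 1 ↔ 3 := h.differential_schouten_iff_laplacian_mul 𝔞 𝔟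
    tfae_have 2 ↔ 4 := h.flip.differential_schouten_iff_laplacian_mul 𝔟 𝔞
    tfae_have 3 → 5 := h.laplacian_eq_half_lieSum 𝔞 𝔟 hs hX₀ hξ₀
    tfae_have 5 → 6 := h.laplacian_flip_eq 𝔞 𝔟 hL hhalf
    tfae_have 6 → 4 := h.flip.laplacian_mul_of_eq_half 𝔟 𝔞
    tfae_have 4 → 6 := h.flip.laplacian_eq_half_lieSum 𝔟 𝔞 hs hξ₀ hX₀
    tfae_have 6 → 5 := h.flip.laplacian_flip_eq 𝔟 𝔞 hL.flip hhalf
    tfae_have 5 → 3 := h.laplacian_mul_of_eq_half 𝔞 𝔟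
    tfae_finish
  · rw [h.laplacianCompatible_iff, h.laplacianCompatible_flip_iff]
    tfae_have 1 ↔ 2 := h.laplacianCompatible_comm
    tfae_have 1 ↔ 3 := h.laplacianCompatible_iff_exists_trace 𝔞 𝔟
    tfae_have 2 ↔ 4 := h.flip.laplacianCompatible_iff_exists_trace 𝔟 𝔞
    tfae_have 1 ↔ 5 := h.laplacianCompatible_iff_laplacian_eq 𝔞 𝔟 hs hX₀ hξ₀
    tfae_have 2 ↔ 6 := h.flip.laplacianCompatible_iff_laplacian_eq 𝔟 𝔞 hs hξ₀ hX₀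
    tfae_finish

theorem theorem2p4 {𝕜 : Type*} [RCLike 𝕜] {m n : ℕ}
    {M : Type*} [TopologicalSpace M] [ChartedSpace (EuclideanSpace ℝ (Fin m)) M]
    [IsManifold (𝓡 m) ∞ M] [T2Space M] [SigmaCompactSpace M]
    {A : M → Type*} [TopologicalSpace (Bundle.TotalSpace (Fin n → 𝕜) A)]
    [∀ p, TopologicalSpace (A p)] [∀ p, AddCommGroup (A p)] [∀ p, Module 𝕜 (A p)]
    [∀ p, Module ℝ (A p)] [∀ p, IsScalarTower ℝ 𝕜 (A p)] [FiberBundle (Fin n → 𝕜) A]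
    [VectorBundle 𝕜 (Fin n → 𝕜) A] [VectorBundle ℝ (Fin n → 𝕜) A]
    [ContMDiffVectorBundle ∞ (Fin n → 𝕜) A (𝓡 m)]
    (𝔞 : LieAlgebroid 𝕜 (Fn 𝕜 m M) (Sec 𝕜 m n M A))
    (𝔟 : LieAlgebroid 𝕜 (Fn 𝕜 m M) (DualSec 𝕜 m n M A))
    (Ω : ExteriorAlgebra (Fn 𝕜 m M) (DualSec 𝕜 m n M A))
    (hΩ : Ω ∈ ⋀[Fn 𝕜 m M]^n (DualSec 𝕜 m n M A))
    (V : ExteriorAlgebra (Fn 𝕜 m M) (Sec 𝕜 m n M A))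
    (hV : V ∈ ⋀[Fn 𝕜 m M]^n (Sec 𝕜 m n M A))
    (hΩV : pair (duality 𝕜 m n M A) V Ω = 1)
    (s : BaseForms 𝕜 (Fn 𝕜 m M)) (hs : IsVolumeForm s)
    (X₀ : Sec 𝕜 m n M A) (hX₀ : IsModularCocycle 𝔟 (duality 𝕜 m n M A).flip Ω s X₀)
    (ξ₀ : DualSec 𝕜 m n M A) (hξ₀ : IsModularCocycle 𝔞 (duality 𝕜 m n M A) V s ξ₀) :
    let R := Fn 𝕜 m M
    let B := duality 𝕜 m n M A
    let d := differential 𝔞 B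
    let dStar := differential 𝔟 B.flip
    let Δ := laplacian 𝔞 𝔟 B Ω
    let ΔStar := laplacian 𝔟 𝔞 B.flip V
    let half : R := algebraMap 𝕜 R (1 / 2)
    -- `L_{X₀} + L_{ξ₀}` on `Γ(∧A)` and on `Γ(∧A*)`
    let Lie := lieSum 𝔟 𝔞 B.flip ξ₀ X₀
    let LieStar := lieSum 𝔞 𝔟 B X₀ ξ₀
    List.TFAE [
      ∀ (k l : ℕ), ∀ u ∈ ⋀[R]^k (Sec 𝕜 m n M A), ∀ v ∈ ⋀[R]^l (Sec 𝕜 m n M A),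
        dStar (schouten 𝔞 u v) =
          schouten 𝔞 (dStar u) v + (-1 : R) ^ (k + 1) • schouten 𝔞 u (dStar v),
      ∀ (k l : ℕ), ∀ θ ∈ ⋀[R]^k (DualSec 𝕜 m n M A),
        ∀ η ∈ ⋀[R]^l (DualSec 𝕜 m n M A),
        d (schouten 𝔟 θ η) = schouten 𝔟 (d θ) η + (-1 : R) ^ (k + 1) • schouten 𝔟 θ (d η),
      ∀ u v, Δ (u * v) = Δ u * v + u * Δ v,
      ∀ θ η, ΔStar (θ * η) = ΔStar θ * η + θ * ΔStar η,
      ∀ u, Δ u = half • Lie u,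
      ∀ θ, ΔStar θ = half • LieStar θ] ∧
    ((∀ (k l : ℕ), ∀ u ∈ ⋀[R]^k (Sec 𝕜 m n M A), ∀ v ∈ ⋀[R]^l (Sec 𝕜 m n M A),
        dStar (schouten 𝔞 u v) =
          schouten 𝔞 (dStar u) v + (-1 : R) ^ (k + 1) • schouten 𝔞 u (dStar v)) →
      ∀ (u : Sec 𝕜 m n M A) (θ : DualSec 𝕜 m n M A),
        ΔStar (algebraMap R _ (B u θ)) =
          algebraMap R _ (pair B (ExteriorAlgebra.ι R u) (ΔStar (ExteriorAlgebra.ι R θ)) +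
            pair B (Δ (ExteriorAlgebra.ι R u)) (ExteriorAlgebra.ι R θ))) ∧
    List.TFAE [
      ∀ (u : Sec 𝕜 m n M A) (θ : DualSec 𝕜 m n M A),
        ΔStar (algebraMap R _ (B u θ)) =
          algebraMap R _ (pair B (ExteriorAlgebra.ι R u) (ΔStar (ExteriorAlgebra.ι R θ)) +
            pair B (Δ (ExteriorAlgebra.ι R u)) (ExteriorAlgebra.ι R θ)),
      ∀ (u : Sec 𝕜 m n M A) (θ : DualSec 𝕜 m n M A),
        Δ (algebraMap R _ (B u θ)) =
          algebraMap R _ (pair B (ExteriorAlgebra.ι R u) (ΔStar (ExteriorAlgebra.ι R θ)) +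
            pair B (Δ (ExteriorAlgebra.ι R u)) (ExteriorAlgebra.ι R θ)),
      ∀ (u : Sec 𝕜 m n M A) (θ : DualSec 𝕜 m n M A),
        ∃ T : DualSec 𝕜 m n M A →ₗ[R] DualSec 𝕜 m n M A,
          (∀ α, ExteriorAlgebra.ι R (T α) = dorfmanDefect 𝔞 𝔟 B u θ (ExteriorAlgebra.ι R α)) ∧
          HasDualTrace T (2 * pair B (dStar (ExteriorAlgebra.ι R u)) (d (ExteriorAlgebra.ι R θ))),
      ∀ (θ : DualSec 𝕜 m n M A) (u : Sec 𝕜 m n M A),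
        ∃ T : Sec 𝕜 m n M A →ₗ[R] Sec 𝕜 m n M A,
          (∀ x, ExteriorAlgebra.ι R (T x) =
            dorfmanDefect 𝔟 𝔞 B.flip θ u (ExteriorAlgebra.ι R x)) ∧
          HasTrace T (2 * pair B.flip (d (ExteriorAlgebra.ι R θ)) (dStar (ExteriorAlgebra.ι R u))),
      (∀ f : R, Δ (algebraMap R _ f) = half • Lie (algebraMap R _ f)) ∧
        ∀ u : Sec 𝕜 m n M A,
          Δ (ExteriorAlgebra.ι R u) = half • Lie (ExteriorAlgebra.ι R u),
      (∀ f : R, ΔStar (algebraMap R _ f) = half • LieStar (algebraMap R _ f)) ∧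
        ∀ θ : DualSec 𝕜 m n M A,
          ΔStar (ExteriorAlgebra.ι R θ) = half • LieStar (ExteriorAlgebra.ι R θ)] := by
  simpa only [hasTrace_iff hV hΩV, hasDualTrace_iff hV hΩV] using
    theorem2p4_general 𝔞 𝔟 (isTopPair_duality hΩ hV hΩV) hs.smul_eq_zero hX₀ hξ₀
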